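/- Let $d\ge 1$, $N,M\ge 1$ be integers, let $a_1,\dots,a_N\in\mathbb R$ with $a_N=1$, let $b_\alpha\in\mathbb R$ ($\alpha\in\mathbb N^d$, $|\alpha|\le M$) with $b_\alpha\ne 0$ for some $|\alpha|=M$, and let $p_1,\dots,p_N>0$ with $p_1+\dots+p_N=1$. Let $f_1,\dots,f_N:\mathbb R^d\to\mathbb R$ and $F:[0,\infty)\times\mathbb R^d\to\mathbb R$ be bounded and continuous. Consider the Cauchy problem $$\sum_{n=1}^N a_n\,\partial_t^n u-\sum_{|\alpha|\le M} b_\alpha D^\alpha u-F=0,\qquad \partial_t^{n-1}u(0,\cdot)=p_nf_n,\quad n=1,\dots,N. \tag{1}$$ Put $b(\xi):=\sum_{|\alpha|\le M} i^{|\alpha|}b_\alpha\xi^\alpha$, let $B(\xi)\in\mathbb C^{N\times N}$ be the companion matrix with ones on the superdiagonal, last row $(b(\xi),-a_1,\dots,-a_{N-1})$ and zeros elsewhere (so $B=b$ if $N=1$), and let $\hat g(t,\xi)=(\hat g_1,\dots,\hat g_N)(t,\xi):=(2\pi)^{-d/2}e^{tB(\xi)^{\rm T}}e_1$, where $e_1$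 is the first canonical basis vector. Let $T\in(0,\infty]$ and assume: 1. for every $t\in[0,T)$ and $n$, the function $\hat g_n(t,\cdot)$ defines a tempered distribution. Let $g_n(t,\cdot):=\mathfrak F^{-1}\hat g_n(t,\cdot)$, where $\mathfrak F^{-1}\varphi(x)=(2\pi)^{-d/2}\int_{\mathbb R^d} e^{i\xi\cdot x}\varphi(\xi)\,d\xi$ for Schwartz functions $\varphi$, and $\langle\mathfrak F^{-1}L,\varphi\rangle=\langle L,\mathfrak F^{-1}\varphi\rangle$ for tempered distributions $L$; 2. for every $n$ and $t\in[0,T)$, $g_n(t,\cdot)$ is a signed measure $g_n(t,dx)=g_n^+(t,dx)-g_n^-(t,dx)$ (Jordan decomposition), the function $(t,x)\mapsto (g_n(t,\cdot)*\phi)(x)=\int\phi(x-y)\,g_n(t,dy)$ is continuous on $[0,T)\times\mathbb R^d$ for every bounded continuous $\phi:\mathbb R^d\to\mathbb R$, and there are probability measures $\mu_n(t,\cdot)$ with $|g_n|(t,\cdot)=g_n^+(t,\cdot)+g_n^-(t,\cdot)\ll\mu_n(t,\cdot)$ and densities $g_n^\pm(t,dx)=\gamma_n^\pm(t,x)\mu_n(t,dx)$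 such that $\gamma_n(t,\cdot):=\gamma_n^+(t,\cdot)-\gamma_n^-(t,\cdot)$ is bounded and integrable with respect to $\mu_n(t,\cdot)$, and $s\mapsto\int|\gamma_N(s,x)|\,\mu_N(s,dx)$ is integrable on $[0,t]$ for every $t\in[0,T)$. Let $X_T$ be the set of functions $u:[0,T)\times\mathbb R^d\to\mathbb R$ that are continuous and are bounded on $([0,T)\cap[0,S])\times\mathbb R^d$ for every $S<\infty$; thus $X_T=C^0_b([0,T)\times\mathbb R^d)$ if $T<\infty$. A function $u\in X_T$ is called a solution of (1) if for every real Schwartz function $\varphi$ on $\mathbb R^d$ the function $h_\varphi(t):=\int_{\mathbb R^d}u(t,x)\varphi(x)\,dx$ is of class $C^N$ on $[0,T)$ (with one-sided derivatives at $0$), satisfies $$\sum_{n=1}^N a_n h_\varphi^{(n)}(t)-\sum_{|\alpha|\le M}b_\alpha(-1)^{|\alpha|}\int_{\mathbb R^d} u(t,x)\,D^\alpha\varphi(x)\,dx-\int_{\mathbb R^d} F(t,x)\varphi(x)\,dx=0,\qquad t\in[0,T),$$ and $h_\varphi^{(n-1)}(0)=p_n\int_{\mathbb R^d} f_n(x)\varphi(x)\,dx$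 for $n=1,\dots,N$. Then the Cauchy problem (1) has a unique solution in $X_T$. It is given by $$u(t,x)=\sum_{n=1}^N p_n\,\big(f_n*g_n(t,\cdot)\big)(x)+\int_0^t\big(F(t-s,\cdot)*g_N(s,\cdot)\big)(x)\,ds,\qquad t\in[0,T),\ x\in\mathbb R^d,$$ where the integrand in the last term is Lebesgue integrable in $s$ on $[0,t]$ for all $t\in[0,T)$ and $x\in\mathbb R^d$. -/

import Mathlib

open scoped SchwartzMap BoundedContinuousFunction

noncomputable section

namespace LinearCauchy

open MeasureTheory

/-- The space variable ranges over Euclidean `ℝ^d`. -/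
abbrev Space (d : ℕ) : Type := EuclideanSpace ℝ (Fin d)

/-- The multi-indices `α ∈ ℕ^d` with `|α| ≤ M`. -/
def multiIndices (d M : ℕ) : Finset (Fin d → ℕ) :=
  (Fintype.piFinset fun _ => Finset.range (M + 1)).filter fun α => ∑ i, α i ≤ M

theorem mem_multiIndices {d M : ℕ} {α : Fin d → ℕ} :
    α ∈ multiIndices d M ↔ ∑ i, α i ≤ M := by
  simp only [multiIndices, Finset.mem_filter, Fintype.mem_piFinset, Finset.mem_range,
    and_iff_right_iff_imp]
  intro h i
  have := Finset.single_le_sum (f := α) (fun j _ => Nat.zero_le _) (Finset.mem_univ i)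
  omega

/-- The orders and the real coefficients of the constant-coefficient operator
`∑_{n=1}^N a_n ∂_t^n - ∑_{|α| ≤ M} b_α D^α`. Only the values `a 1, …, a N` and `b α` with
`|α| ≤ M` are ever used. -/
structure Coeffs (d : ℕ) where
  N : ℕ
  M : ℕ
  a : ℕ → ℝ
  b : (Fin d → ℕ) → ℝ
  one_le_N : 1 ≤ N
  one_le_M : 1 ≤ M
  a_N : a N = 1
  exists_top : ∃ α : Fin d → ℕ, ∑ i, α i = M ∧ b α ≠ 0

variable {d : ℕ}

namespace Coeffs

/-- The first index (`n = 1` in the one-based numbering). -/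
def first (c : Coeffs d) : Fin c.N := ⟨0, c.one_le_N⟩

/-- The last index (`n = N` in the one-based numbering). -/
def last (c : Coeffs d) : Fin c.N := ⟨c.N - 1, Nat.sub_lt c.one_le_N Nat.one_pos⟩

/-- The symbol `b(ξ) = ∑_{|α| ≤ M} i^{|α|} b_α ξ^α`. -/
def symbol (c : Coeffs d) (ξ : Space d) : ℂ :=
  ∑ α ∈ multiIndices d c.M,
    Complex.I ^ (∑ i, α i) * (c.b α : ℂ) * ∏ i, ((ξ i : ℝ) : ℂ) ^ α i

/-- The companion matrix `B(ξ)`, with ones on the superdiagonal and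
last row `(b(ξ), -a_1, …, -a_{N-1})`. Rows and columns are numbered from `0`. -/
def companion (c : Coeffs d) (ξ : Space d) : Matrix (Fin c.N) (Fin c.N) ℂ :=
  Matrix.of fun i j =>
    if i.val + 1 = c.N then
      if j.val = 0 then c.symbol ξ else -(c.a j.val : ℂ)
    else if j.val = i.val + 1 then 1 else 0

/-- The vector `ĝ(t, ξ) = (2π)^{-d/2} e^{t B(ξ)ᵀ} e_1 ∈ ℂ^N`. -/
def greenHat (c : Coeffs d) (t : ℝ) (ξ : Space d) : Fin c.N → ℂ :=
  (((2 * Real.pi) ^ (-(d : ℝ) / 2) : ℝ) : ℂ) •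
    (NormedSpace.exp ((t : ℂ) • (c.companion ξ).transpose)).mulVec (Pi.single c.first 1)

end Coeffs

/-- The time interval `[0, T)`, with `T = ∞` allowed. -/
def timeInterval (T : EReal) : Set ℝ := {t | 0 ≤ t ∧ (t : EReal) < T}

/-! ### Fourier transform in the unitary normalization -/

/-- The dilation `x ↦ x / (2π)`. -/
def dilation (d : ℕ) : Space d ≃L[ℝ] Space d :=
  ContinuousLinearEquiv.smulLeft (Units.mk0 ((2 * Real.pi)⁻¹) (by positivity))

/-- The inverse Fourier transform on Schwartz functions, in the normalization
`(2π)^{-d/2} ∫ e^{i ξ·x} φ(ξ) dξ` (see `invFourier_apply`). -/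
def invFourier (d : ℕ) : 𝓢(Space d, ℂ) →L[ℂ] 𝓢(Space d, ℂ) :=
  (((2 * Real.pi) ^ (-(d : ℝ) / 2) : ℝ) : ℂ) •
    ((SchwartzMap.compCLMOfContinuousLinearEquiv ℂ (dilation d)).comp
      (FourierTransform.fourierInvCLM ℂ 𝓢(Space d, ℂ)))

theorem invFourier_apply (φ : 𝓢(Space d, ℂ)) (x : Space d) :
    invFourier d φ x = (((2 * Real.pi) ^ (-(d : ℝ) / 2) : ℝ) : ℂ) *
      ∫ ξ, Complex.exp (Complex.I * ((inner ℝ ξ x : ℝ) : ℂ)) * φ ξ := by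
  have h : invFourier d φ x = (((2 * Real.pi) ^ (-(d : ℝ) / 2) : ℝ) : ℂ) *
      (FourierTransformInv.fourierInv φ : 𝓢(Space d, ℂ)) (((2 * Real.pi)⁻¹ : ℝ) • x) := rfl
  rw [h, SchwartzMap.fourierInv_coe, Real.fourierInv_eq']
  congr 1
  refine integral_congr_ae (Filter.Eventually.of_forall fun ξ => ?_)
  simp only [smul_eq_mul, inner_smul_right]
  congr 2
  have : (2 * Real.pi * ((2 * Real.pi)⁻¹ * inner ℝ ξ x) : ℝ) = inner ℝ ξ x := by
    field_simp
  rw [this, mul_comm]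

/-- The inverse Fourier transform of a tempered distribution,
`⟨𝓕⁻¹ L, φ⟩ = ⟨L, 𝓕⁻¹ φ⟩`. -/
def invFourierDist (L : 𝓢'(Space d, ℂ)) : 𝓢'(Space d, ℂ) :=
  PointwiseConvergenceCLM.precomp ℂ (invFourier d) L

theorem invFourierDist_apply (L : 𝓢'(Space d, ℂ)) (φ : 𝓢(Space d, ℂ)) :
    invFourierDist L φ = L (invFourier d φ) := rfl

/-- The tempered distribution `L` is the one given by the locally integrable function `h`:
the two agree on compactly supported test functions (which are dense in `𝓢`, so that `L` is
determined by `h`). -/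
def Represents (L : 𝓢'(Space d, ℂ)) (h : Space d → ℂ) : Prop :=
  LocallyIntegrable h volume ∧
    ∀ φ : 𝓢(Space d, ℂ), HasCompactSupport φ → L φ = ∫ ξ, h ξ * φ ξ

/-- The distribution given by the function `h` is tempered, i.e. `h ∈ 𝓢'`. -/
def IsTempered (h : Space d → ℂ) : Prop := ∃ L : 𝓢'(Space d, ℂ), Represents L h

/-! ### Signed measures -/

/-- The convolution `(γ * φ)(x) = ∫ φ(x - y) γ(dy)` of a function with a signed measure. -/
def conv (γ : SignedMeasure (Space d)) (φ : Space d → ℝ) (x : Space d) : ℝ :=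
  (∫ y, φ (x - y) ∂γ.toJordanDecomposition.posPart) -
    ∫ y, φ (x - y) ∂γ.toJordanDecomposition.negPart

/-- The signed measure `γ` represents the tempered distribution `G`. -/
def MeasureRepresents (γ : SignedMeasure (Space d)) (G : 𝓢'(Space d, ℂ)) : Prop :=
  ∀ φ : 𝓢(Space d, ℂ), G φ =
    (∫ x, φ x ∂γ.toJordanDecomposition.posPart) - ∫ x, φ x ∂γ.toJordanDecomposition.negPart

/-! ### The two assumptions -/

/-- `ĝ(t, ·) ∈ 𝓢'` for all `t ∈ [0, T)`. -/
def TemperedHat (c : Coeffs d) (T : EReal) : Prop :=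
  ∀ t ∈ timeInterval T, ∀ n, IsTempered fun ξ => c.greenHat t ξ n

/-- The Green functions `g_n(t, ·) = 𝓕⁻¹ ĝ_n(t, ·)`, `t ∈ [0, T)`, are the signed
measures `g n t`; convolution with them is continuous in `(t, x)`; and they have bounded densities
with respect to probability measures. -/
structure GreenMeasures (c : Coeffs d) (T : EReal)
    (g : Fin c.N → ℝ → SignedMeasure (Space d)) : Prop where
  isGreen : ∀ t ∈ timeInterval T, ∀ n, ∀ L : 𝓢'(Space d, ℂ),
    Represents L (fun ξ => c.greenHat t ξ n) → MeasureRepresents (g n t) (invFourierDist L)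
  continuous_conv : ∀ n, ∀ φ : Space d →ᵇ ℝ,
    ContinuousOn (fun z : ℝ × Space d => conv (g n z.1) φ z.2) (timeInterval T ×ˢ Set.univ)
  density : ∃ (μ : Fin c.N → ℝ → Measure (Space d)) (γp γm : Fin c.N → ℝ → Space d → NNReal),
    (∀ n, ∀ t ∈ timeInterval T,
      IsProbabilityMeasure (μ n t) ∧
      (g n t).totalVariation ≪ μ n t ∧
      Measurable (γp n t) ∧ Measurable (γm n t) ∧
      (g n t).toJordanDecomposition.posPart = (μ n t).withDensity (fun x => (γp n t x : ENNReal)) ∧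
      (g n t).toJordanDecomposition.negPart = (μ n t).withDensity (fun x => (γm n t x : ENNReal)) ∧
      (∃ C : ℝ, ∀ᵐ x ∂(μ n t), |(γp n t x : ℝ) - γm n t x| ≤ C) ∧
      Integrable (fun x => (γp n t x : ℝ) - γm n t x) (μ n t)) ∧
    ∀ t ∈ timeInterval T,
      IntegrableOn (fun s => ∫ x, |(γp c.last s x : ℝ) - γm c.last s x| ∂(μ c.last s))
        (Set.Icc 0 t)

/-! ### Solutions of the Cauchy problem -/

/-- The derivative `D^α φ` of a Schwartz function. -/
def partialDeriv (α : Fin d → ℕ) (φ : 𝓢(Space d, ℝ)) : 𝓢(Space d, ℝ) :=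
  (List.finRange d).foldr
    (fun i ψ => (fun χ : 𝓢(Space d, ℝ) =>
      LineDeriv.lineDerivOp (EuclideanSpace.single i (1 : ℝ)) χ)^[α i] ψ) φ

/-- The pairing `⟨u(t, ·), φ⟩` as a function of `t`. -/
def pairing (u : ℝ → Space d → ℝ) (φ : 𝓢(Space d, ℝ)) (t : ℝ) : ℝ := ∫ x, u t x * φ x

/-- `u` is continuous on `[0, T) × ℝ^d` and bounded on `([0, T) ∩ [0, S]) × ℝ^d` for every
finite `S`. For `T < ∞` this is exactly `C^0_b([0, T) × ℝ^d)`. -/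
structure IsBoundedContinuous (T : EReal) (u : ℝ → Space d → ℝ) : Prop where
  continuousOn : ContinuousOn (fun z : ℝ × Space d => u z.1 z.2) (timeInterval T ×ˢ Set.univ)
  bounded : ∀ S : ℝ, ∃ C : ℝ, ∀ t ∈ timeInterval T, t ≤ S → ∀ x, |u t x| ≤ C

/-- `u` solves, in the sense of distributions in the space variable,
`∑_{n=1}^N a_n ∂_t^n u - ∑_{|α| ≤ M} b_α D^α u - F = 0` on `[0, T) × ℝ^d`, with the initial
conditions `∂_t^{n-1} u(0, ·) = p_n f_n` for `n = 1, …, N` (here `n` is numbered from `0`). -/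
structure IsSolution (c : Coeffs d) (T : EReal) (p : Fin c.N → ℝ)
    (f : Fin c.N → Space d → ℝ) (F : ℝ → Space d → ℝ) (u : ℝ → Space d → ℝ) : Prop where
  contDiffOn : ∀ φ : 𝓢(Space d, ℝ),
    ContDiffOn ℝ (c.N : ℕ∞) (pairing u φ) (timeInterval T)
  equation : ∀ φ : 𝓢(Space d, ℝ), ∀ t ∈ timeInterval T,
    (∑ n ∈ Finset.Icc 1 c.N, c.a n * iteratedDerivWithin n (pairing u φ) (timeInterval T) t)
      - (∑ α ∈ multiIndices d c.M,
          c.b α * ((-1) ^ (∑ i, α i) * pairing u (partialDeriv α φ) t))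
      - pairing F φ t = 0
  initial : ∀ φ : 𝓢(Space d, ℝ), ∀ n : Fin c.N,
    iteratedDerivWithin n.val (pairing u φ) (timeInterval T) 0 = p n * ∫ x, f n x * φ x

/-- The Duhamel formula
`u(t, x) = ∑_n p_n (f_n * g_n(t, ·))(x) + ∫_0^t (F(t - s, ·) * g_N(s, ·))(x) ds`. -/
def duhamel (c : Coeffs d) (p : Fin c.N → ℝ) (f : Fin c.N → Space d → ℝ)
    (F : ℝ → Space d → ℝ) (g : Fin c.N → ℝ → SignedMeasure (Space d))
    (t : ℝ) (x : Space d) : ℝ :=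
  (∑ n, p n * conv (g n t) (f n) x) + ∫ s in (0 : ℝ)..t, conv (g c.last s) (F (t - s)) x

end LinearCauchy

end

open scoped SchwartzMap BoundedContinuousFunction

noncomputable section

namespace LinearCauchy

open MeasureTheory

variable {d : ℕ}

/-! ### Companion matrices -/

/-! On the Fourier side the problem is an ordinary differential equation for each frequency, with
companion matrix `B(ξ)`. The Green functions are the first row of `e^{tB(ξ)}`, and by
`propagator_eq_stieltjes` this row consists of the Fourier–Stieltjes transforms of the measures `g n
t`.

Mass bound. Weak continuity and the uniform boundedness principle control the mass of `g n t` on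
compact subsets of `[0, T)` only, whereas a solution must stay bounded up to a finite `T`. The gap
is closed algebraically in `exists_totalMass_le`. With `A = e^{tB/(N+1)}`, the first rows of `A, …,
A^N` belong to times at most `tN/(N+1)`, which stay in a compact subinterval. Matrices commuting
with a companion matrix have their diagonal entries in the algebra generated over `ℝ` by their first
row, so the traces of these powers are transforms of measures of bounded mass. By Newton's
identities so are the coefficients of the characteristic polynomial of `A`, and Cayley–Hamilton
expresses the first row of `A^{N+1} = e^{tB}` through them.

Existence. The row satisfies `(e_1ᵀ e^{tB})' = e_1ᵀ e^{tB} B`, and the entries of `B` are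
polynomials in the symbol. Multiplication by the symbol corresponds to `adjointOp` on test
functions, so pairings with the convolutions obey a first-order system driven by the companion
matrix over `ℝ[X]` (`pairing_conv_eq_add_integral`). The Duhamel terms obey the same system with
source `F` in the first component (`pairing_duhamelTerm_eq_add_integral`). The first row of `B^j` is
a basis vector for `j < N`: this gives the initial values and makes `F` enter at order `N` only. The
identity `∑ a_j B^j = b · 1` then gives the equation.

Uniqueness. For a difference `w` of two solutions, test with functions whose Fourier transform lives
in a fixed ball. There the adjoint operator is bounded in `L¹` by Bernstein's inequality
(`exists_integral_abs_adjointOp_le`), so an exponentially weighted estimate for the ordinary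
differential equation can be iterated, gaining a factor `1/2` each time. All such pairings vanish,
and band-limited functions contain an approximate identity (`eq_zero_of_forall_bandlimited`), so `w
= 0`. -/

/-- The companion matrix with ones on the superdiagonal and
last row `(b, -a_1, …, -a_{N-1})`. -/
def companionMatrix {R : Type*} [CommRing R] (N : ℕ) (a : ℕ → R) (b : R) :
    Matrix (Fin N) (Fin N) R :=
  Matrix.of fun i j =>
    if i.val + 1 = N then
      if j.val = 0 then b else -(a j.val)
    else if j.val = i.val + 1 then 1 else 0

theorem companion_eq_companionMatrix (c : Coeffs d) (ξ : Space d) :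
    c.companion ξ = companionMatrix c.N (fun n => (c.a n : ℂ)) (c.symbol ξ) := rfl

section Companion

variable {R : Type*} [CommRing R] {m : ℕ} (a : ℕ → R) (b : R)

theorem companionMatrix_castSucc (i : Fin m) (j : Fin (m + 1)) :
    companionMatrix (m + 1) a b i.castSucc j = if j = i.succ then 1 else 0 := by
  have h : ¬(i.val + 1 = m + 1) := by omega
  rw [companionMatrix, Matrix.of_apply, Fin.val_castSucc, if_neg h]
  simp only [Fin.ext_iff, Fin.val_succ]

theorem companionMatrix_last_zero :
    companionMatrix (m + 1) a b (Fin.last m) 0 = b := by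
  simp [companionMatrix]

theorem companionMatrix_last_succ (j : Fin m) :
    companionMatrix (m + 1) a b (Fin.last m) j.succ = -(a (j.val + 1)) := by
  simp [companionMatrix]

/-- A column other than column `0` meets only the superdiagonal and the last row; the symbol `b`,
which sits in column `0`, does not occur. -/
theorem sum_companionMatrix_succ {A : Type*} [AddCommMonoid A]
    (f : Fin (m + 1) → R → A) (hf : ∀ k, f k 0 = 0) (n : Fin m) :
    ∑ k, f k (companionMatrix (m + 1) a b k n.succ) =
      f n.castSucc 1 + f (Fin.last m) (-(a (n.val + 1))) := by
  rw [Fin.sum_univ_castSucc, companionMatrix_last_succ, Finset.sum_eq_single n]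
  · rw [companionMatrix_castSucc, if_pos rfl]
  · intro k _ hk
    rw [companionMatrix_castSucc, if_neg (fun h => hk (Fin.succ_injective _ h).symm), hf]
  · simp

theorem companionMatrix_castSucc_mul (E : Matrix (Fin (m + 1)) (Fin (m + 1)) R) (i : Fin m)
    (j : Fin (m + 1)) : (companionMatrix (m + 1) a b * E) i.castSucc j = E i.succ j := by
  rw [Matrix.mul_apply, Finset.sum_eq_single i.succ]
  · rw [companionMatrix_castSucc, if_pos rfl, one_mul]
  · intro k _ hk
    rw [companionMatrix_castSucc, if_neg hk, zero_mul]
  · simp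

/-- Multiplication by the companion matrix on the right moves a basis row vector one place to the
right until the last place is reached. Hence `e_1` is a cyclic row vector, and a matrix commuting
with the companion matrix is determined by its first row. -/
theorem companionMatrix_pow_zero_apply (k n : Fin (m + 1)) :
    (companionMatrix (m + 1) a b ^ k.val) 0 n = if n = k then 1 else 0 := by
  induction k using Fin.induction generalizing n with
  | zero => simp [Matrix.one_apply, eq_comm]
  | succ k ih =>
    rw [Fin.val_succ, pow_succ, Matrix.mul_apply, Finset.sum_eq_single k.castSucc]
    · rw [← Fin.val_castSucc k, ih, if_pos rfl, one_mul, companionMatrix_castSucc]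
    · intro l _ hl
      rw [← Fin.val_castSucc k, ih, if_neg hl, zero_mul]
    · simp

theorem companionMatrix_pow_card_zero_apply (n : Fin (m + 1)) :
    (companionMatrix (m + 1) a b ^ (m + 1)) 0 n = companionMatrix (m + 1) a b (Fin.last m) n := by
  rw [pow_succ, Matrix.mul_apply, Finset.sum_eq_single (Fin.last m)]
  · rw [show companionMatrix (m + 1) a b ^ m = companionMatrix (m + 1) a b ^ (Fin.last m).val
      from rfl, companionMatrix_pow_zero_apply, if_pos rfl, one_mul]
  · intro l _ hl
    rw [show companionMatrix (m + 1) a b ^ m = companionMatrix (m + 1) a b ^ (Fin.last m).val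
      from rfl, companionMatrix_pow_zero_apply, if_neg hl, zero_mul]
  · simp

/-- The companion matrix is annihilated by its characteristic polynomial. -/
theorem sum_smul_companionMatrix_pow (ha : a (m + 1) = 1) :
    ∑ j ∈ Finset.Icc 1 (m + 1), a j • companionMatrix (m + 1) a b ^ j = b • 1 := by
  set B := companionMatrix (m + 1) a b with hB
  set P := ∑ j ∈ Finset.Icc 1 (m + 1), a j • B ^ j with hP
  -- In row `0` the term `B^(m+1)` contributes the last row of `B`, and its entries `-a_j` cancel
  -- the lower powers; only `b` in column `0` survives.
  have hrow : ∀ n, P 0 n = if n = 0 then b else 0 := by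
    intro n
    rw [hP, Finset.sum_Icc_succ_top (by omega), ha, one_smul, Matrix.add_apply,
      companionMatrix_pow_card_zero_apply, Matrix.sum_apply]
    have h : ∀ j ∈ Finset.Icc 1 m, (a j • B ^ j) 0 n = if n.val = j then a j else 0 := by
      intro j hj
      have hj' : j < m + 1 := by have := (Finset.mem_Icc.1 hj).2; omega
      have := companionMatrix_pow_zero_apply a b ⟨j, hj'⟩ n
      rw [Matrix.smul_apply, hB, this]
      simp [Fin.ext_iff]
    rw [Finset.sum_congr rfl h]
    refine Fin.cases ?_ (fun k => ?_) n
    · rw [Finset.sum_eq_zero, companionMatrix_last_zero]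
      · simp
      · intro j hj
        have := (Finset.mem_Icc.1 hj).1
        rw [Fin.val_zero, if_neg (by omega)]
    · rw [companionMatrix_last_succ, Finset.sum_ite_eq, if_pos, if_neg (Fin.succ_ne_zero k)]
      · simp
      · simp
  have hcomm : ∀ k, B ^ k * P = P * B ^ k := by
    intro k
    rw [hP, Finset.mul_sum, Finset.sum_mul]
    refine Finset.sum_congr rfl fun j _ => ?_
    rw [Matrix.mul_smul, Matrix.smul_mul, ← pow_add, ← pow_add, add_comm k]
  ext k n
  -- Row `k` of `P` is row `0` of `B^k P = P B^k`, so the knowledge of row `0` suffices.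
  have h1 : (B ^ k.val * P) 0 n = P k n := by
    rw [Matrix.mul_apply, Finset.sum_eq_single k]
    · rw [companionMatrix_pow_zero_apply, if_pos rfl, one_mul]
    · intro l _ hl
      rw [companionMatrix_pow_zero_apply, if_neg hl, zero_mul]
    · simp
  rw [← h1, hcomm, Matrix.mul_apply, Finset.sum_eq_single 0]
  · rw [hrow, if_pos rfl, companionMatrix_pow_zero_apply]
    simp [Matrix.one_apply, eq_comm]
  · intro l _ hl
    rw [hrow, if_neg hl, zero_mul]
  · simp

end Companion

/-- The entries on and above the diagonal of a family of matrices commuting with companion matrices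
lie in every subalgebra that contains the entries of the first row. -/
theorem entry_mem_of_commute_companionMatrix {Ω : Type*} (𝒜 : Subalgebra ℝ (Ω → ℂ)) {m : ℕ}
    (a : ℕ → ℝ) (b : Ω → ℂ) (E : Ω → Matrix (Fin (m + 1)) (Fin (m + 1)) ℂ)
    (hE : ∀ ω, companionMatrix (m + 1) (fun n => (a n : ℂ)) (b ω) * E ω =
      E ω * companionMatrix (m + 1) (fun n => (a n : ℂ)) (b ω))
    (h0 : ∀ n, (fun ω => E ω 0 n) ∈ 𝒜) (k n : Fin (m + 1)) (hkn : k ≤ n) :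
    (fun ω => E ω k n) ∈ 𝒜 := by
  induction k using Fin.induction generalizing n with
  | zero => exact h0 n
  | succ k ih =>
    obtain ⟨n, rfl⟩ : ∃ n', n = Fin.succ n' :=
      ⟨n.pred (Fin.pos_iff_ne_zero.1 ((Fin.succ_pos k).trans_le hkn)), by simp⟩
    have hkn' : k ≤ n := Fin.succ_le_succ_iff.1 hkn
    -- Comparison of the entries `(k, n+1)` of `B E = E B`. Staying on or above the diagonal avoids
    -- column `0` of `B`, so `b`, which need not lie in the algebra, never enters.
    have key : (fun ω => E ω k.succ n.succ) =
        (fun ω => E ω k.castSucc n.castSucc) -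
          a (n.val + 1) • fun ω => E ω k.castSucc (Fin.last m) := by
      funext ω
      rw [← companionMatrix_castSucc_mul (fun n => (a n : ℂ)) (b ω) (E ω), hE, Matrix.mul_apply,
        sum_companionMatrix_succ (fun n => (a n : ℂ)) (b ω) (fun l r => E ω k.castSucc l * r)
          (fun _ => mul_zero _)]
      simp [sub_eq_add_neg, mul_comm]
    rw [key]
    exact sub_mem (ih _ (by simpa using hkn'))
      (𝒜.smul_mem (ih _ (Fin.le_last _)) _)

theorem trace_mem_of_commute_companionMatrix {Ω : Type*} (𝒜 : Subalgebra ℝ (Ω → ℂ)) {m : ℕ}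
    (a : ℕ → ℝ) (b : Ω → ℂ) (E : Ω → Matrix (Fin (m + 1)) (Fin (m + 1)) ℂ)
    (hE : ∀ ω, companionMatrix (m + 1) (fun n => (a n : ℂ)) (b ω) * E ω =
      E ω * companionMatrix (m + 1) (fun n => (a n : ℂ)) (b ω))
    (h0 : ∀ n, (fun ω => E ω 0 n) ∈ 𝒜) : (fun ω => (E ω).trace) ∈ 𝒜 := by
  have : (fun ω => (E ω).trace) = ∑ k, fun ω => E ω k k := by
    funext ω
    simp [Matrix.trace]
  rw [this]
  exact sum_mem fun k _ => entry_mem_of_commute_companionMatrix 𝒜 a b E hE h0 k k le_rfl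

theorem trace_mem_of_commute_companion {Ω : Type*} (𝒜 : Subalgebra ℝ (Ω → ℂ)) (c : Coeffs d)
    (ξ : Ω → Space d) (E : Ω → Matrix (Fin c.N) (Fin c.N) ℂ)
    (hE : ∀ ω, c.companion (ξ ω) * E ω = E ω * c.companion (ξ ω))
    (h0 : ∀ n, (fun ω => E ω c.first n) ∈ 𝒜) : (fun ω => (E ω).trace) ∈ 𝒜 := by
  simp only [companion_eq_companionMatrix, Coeffs.first] at hE h0
  -- The symbol becomes an arbitrary function, so that `c` can be taken apart and `N` replaced by `m
  -- + 1`.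
  generalize hb : (fun ω => c.symbol (ξ ω)) = b
  replace hb : ∀ ω, c.symbol (ξ ω) = b ω := fun ω => congrFun hb ω
  simp only [hb] at hE
  clear hb
  obtain ⟨N, M, a, b', hN, _, _, _⟩ := c
  obtain ⟨m, rfl⟩ : ∃ m, N = m + 1 := ⟨N - 1, by omega⟩
  exact trace_mem_of_commute_companionMatrix 𝒜 a _ E hE h0

/-! ### Newton's identities for a matrix -/

section Newton

open Polynomial

variable {n : Type*} [Fintype n] [DecidableEq n]

/-- Jacobi's formula: with `M` the resolvent at `z`, `det(z + y - A) = det(z - A) det(1 + yM)`, and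
the linear coefficient of `det(1 + yM)` in `y` is the trace of `M`. -/
theorem eval_derivative_charpoly (A : Matrix n n ℂ) (z : ℂ) (hz : A.charpoly.eval z ≠ 0) :
    A.charpoly.derivative.eval z =
      A.charpoly.eval z * ((Matrix.scalar n z - A)⁻¹).trace := by
  set M := (Matrix.scalar n z - A)⁻¹
  have hdet : (Matrix.scalar n z - A).det = A.charpoly.eval z := (Matrix.eval_charpoly A z).symm
  have hM : (Matrix.scalar n z - A) * M = 1 :=
    Matrix.mul_nonsing_inv _ (by rw [hdet]; exact hz.isUnit)
  have hp : A.charpoly.comp (X + C z) =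
      C (A.charpoly.eval z) * (1 + (X : ℂ[X]) • M.map C).det := by
    refine Polynomial.funext fun y => ?_
    rw [eval_comp, eval_mul, eval_C, Matrix.eval_charpoly, ← hdet]
    have h1 : eval y (1 + (X : ℂ[X]) • M.map C).det = (1 + y • M).det := by
      rw [← coe_evalRingHom, RingHom.map_det]
      congr 1
      ext i j
      simp only [RingHom.mapMatrix_apply, Matrix.map_apply, Matrix.add_apply, Matrix.smul_apply,
        smul_eq_mul, coe_evalRingHom, eval_add, eval_mul, eval_X, eval_C, Matrix.one_apply]
      split_ifs <;> simp
    rw [h1, ← Matrix.det_mul, mul_add, mul_one, Matrix.mul_smul, hM]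
    congr 1
    ext i j
    simp [Matrix.scalar_apply, Matrix.diagonal_apply, Matrix.one_apply]
    split_ifs <;> ring
  have := congrArg (fun p => (derivative p).eval 0) hp
  simpa [derivative_comp, Matrix.derivative_det_one_add_X_smul] using this

/-- Since `p(A) = 0`, the matrix `p(z)(z - A)⁻¹` is the quotient `Q` of `p(z) - p(A)` by `z - A`, a
polynomial in `z` and `A`. Its trace is the right-hand side, and Jacobi's formula identifies it with
`p'(z)`. -/
theorem derivative_charpoly_eq_sum (A : Matrix n n ℂ) :
    derivative A.charpoly =
      ∑ j ∈ Finset.range (A.charpoly.natDegree + 1), ∑ i ∈ Finset.range j,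
        C (A.charpoly.coeff j * (A ^ (j - 1 - i)).trace) * X ^ i := by
  set p := A.charpoly with hp
  have hp0 : p ≠ 0 := (Matrix.charpoly_monic A).ne_zero
  -- After multiplication by `p` the identity is trivial at the eigenvalues, so the resolvent may be
  -- assumed to exist.
  refine mul_right_cancel₀ hp0 (Polynomial.funext fun z => ?_)
  rw [eval_mul, eval_mul]
  by_cases hz : p.eval z = 0
  · rw [hz, mul_zero, mul_zero]
  congr 1
  have hdet : (Matrix.scalar n z - A).det = p.eval z := (Matrix.eval_charpoly A z).symm
  have hcomm : Commute (Matrix.scalar n z) A := Matrix.scalar_commute _ (fun _ => Commute.all _ _) _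
  set Q : Matrix n n ℂ := ∑ j ∈ Finset.range (p.natDegree + 1),
    p.coeff j • ∑ i ∈ Finset.range j, Matrix.scalar n z ^ i * A ^ (j - 1 - i) with hQ
  have hCH : ∑ j ∈ Finset.range (p.natDegree + 1), p.coeff j • A ^ j = 0 := by
    rw [← aeval_eq_sum_range, hp, Matrix.aeval_self_charpoly]
  have h1 : (Matrix.scalar n z - A) * Q = p.eval z • 1 := by
    rw [hQ, Finset.mul_sum]
    simp_rw [Matrix.mul_smul, hcomm.mul_geom_sum₂, smul_sub]
    rw [Finset.sum_sub_distrib, hCH, sub_zero, eval_eq_sum_range, Finset.sum_smul]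
    refine Finset.sum_congr rfl fun j _ => ?_
    rw [← map_pow, mul_smul, ← Algebra.algebraMap_eq_smul_one]
    rfl
  have h2 : p.eval z • (Matrix.scalar n z - A)⁻¹ = Q := by
    rw [← mul_one (Matrix.scalar n z - A)⁻¹, ← Matrix.mul_smul, ← h1, ← mul_assoc,
      Matrix.nonsing_inv_mul _ (by rw [hdet]; exact Ne.isUnit hz), one_mul]
  rw [hp, eval_derivative_charpoly A z hz, ← smul_eq_mul, ← Matrix.trace_smul, h2, hQ,
    Matrix.trace_sum, eval_finsetSum]
  refine Finset.sum_congr rfl fun j _ => ?_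
  rw [Matrix.trace_smul, Matrix.trace_sum, eval_finsetSum, Finset.smul_sum]
  refine Finset.sum_congr rfl fun i _ => ?_
  rw [← map_pow, eval_mul, eval_C, eval_pow, eval_X, Matrix.scalar_apply,
    ← Matrix.smul_eq_diagonal_mul, Matrix.trace_smul]
  simp only [smul_eq_mul]
  ring

/-- Newton's identities for the coefficients of the characteristic polynomial. -/
theorem newton_charpoly (A : Matrix n n ℂ) {k : ℕ} (hk : k < Fintype.card n) :
    ((Fintype.card n - k : ℕ) : ℂ) * A.charpoly.coeff k =
      -∑ j ∈ Finset.Ioc k (Fintype.card n), A.charpoly.coeff j * (A ^ (j - k)).trace := by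
  have hdeg : A.charpoly.natDegree = Fintype.card n := Matrix.charpoly_natDegree_eq_dim A
  cases k with
  -- The derivative does not see the constant coefficient; here the identity is the trace of
  -- Cayley–Hamilton.
  | zero =>
    have hCH : ∑ j ∈ Finset.range (Fintype.card n + 1), A.charpoly.coeff j • A ^ j = 0 := by
      rw [← hdeg, ← aeval_eq_sum_range, Matrix.aeval_self_charpoly]
    have := congrArg Matrix.trace hCH
    rw [Matrix.trace_sum, Finset.range_eq_Ico, Finset.sum_eq_sum_Ico_succ_bot (by omega)] at this
    simp only [Matrix.trace_smul, pow_zero, Matrix.trace_one, Matrix.trace_zero,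
      smul_eq_mul] at this
    have hI : Finset.Ioc 0 (Fintype.card n) = Finset.Ico (0 + 1) (Fintype.card n + 1) := by
      ext; simp; omega
    rw [hI]
    simp only [Nat.sub_zero]
    linear_combination this
  | succ i =>
    have h := congrArg (fun q => q.coeff i) (derivative_charpoly_eq_sum A)
    simp only [coeff_derivative, finsetSum_coeff, coeff_C_mul, coeff_X_pow, hdeg, mul_ite,
      mul_one, mul_zero, Finset.sum_ite_eq, Finset.mem_range] at h
    rw [← Finset.sum_filter] at h
    have hI : (Finset.range (Fintype.card n + 1)).filter (fun j => i < j) =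
        insert (i + 1) (Finset.Ioc (i + 1) (Fintype.card n)) := by
      ext; simp; omega
    rw [hI, Finset.sum_insert (by simp)] at h
    -- The term `j = i + 1` carries the trace of the identity, the size of the matrix. Together with
    -- the factor `i + 1` from differentiation it gives the factor on the left.
    simp only [show i + 1 - 1 - i = 0 by omega, pow_zero, Matrix.trace_one] at h
    rw [Nat.cast_sub hk.le]
    have h' : ∀ j, j - 1 - i = j - (i + 1) := fun j => by omega
    simp only [h'] at h
    push_cast
    linear_combination -h

end Newton

/-- If the traces of the first `N` powers of a family of matrices of size `N` and the entries
`(i, j)` of these powers lie in a subalgebra, then so does the entry `(i, j)` of the next power. -/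
theorem pow_entry_mem {Ω : Type*} (𝒜 : Subalgebra ℝ (Ω → ℂ)) {N : ℕ}
    (A : Ω → Matrix (Fin N) (Fin N) ℂ)
    (htr : ∀ k, 1 ≤ k → k ≤ N → (fun ω => (A ω ^ k).trace) ∈ 𝒜) (i j : Fin N)
    (hij : ∀ k, 1 ≤ k → k ≤ N → (fun ω => (A ω ^ k) i j) ∈ 𝒜) :
    (fun ω => (A ω ^ (N + 1)) i j) ∈ 𝒜 := by
  have hmonic : ∀ ω, (A ω).charpoly.coeff N = 1 := fun ω => by
    have h := Matrix.charpoly_monic (A ω)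
    rw [Polynomial.Monic, Polynomial.leadingCoeff, Matrix.charpoly_natDegree_eq_dim,
      Fintype.card_fin] at h
    exact h
  -- Newton's identities give the coefficient of degree `N - l` from those of higher degree and the
  -- traces of `A, …, A^l`; the division by `l` is harmless in a real algebra.
  have hcoeff : ∀ l, l ≤ N → (fun ω => (A ω).charpoly.coeff (N - l)) ∈ 𝒜 := by
    intro l
    induction l using Nat.strong_induction_on with
    | _ l ih =>
      intro hl
      rcases Nat.eq_zero_or_pos l with rfl | hpos
      · simp only [Nat.sub_zero, hmonic]
        exact 𝒜.one_mem
      · have key : (fun ω => (A ω).charpoly.coeff (N - l)) = (-(l : ℝ)⁻¹) •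
            ∑ q ∈ Finset.Ioc (N - l) N, (fun ω => (A ω).charpoly.coeff q) *
              fun ω => (A ω ^ (q - (N - l))).trace := by
          funext ω
          have h := newton_charpoly (A ω) (k := N - l) (by rw [Fintype.card_fin]; omega)
          rw [Fintype.card_fin, Nat.sub_sub_self hl] at h
          have hl0 : (l : ℂ) ≠ 0 := by exact_mod_cast hpos.ne'
          simp only [Pi.smul_apply, Finset.sum_apply, Pi.mul_apply, Complex.real_smul]
          push_cast
          rw [eq_comm, neg_mul, ← mul_neg, ← h, inv_mul_cancel_left₀ hl0]
        rw [key]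
        refine 𝒜.smul_mem (sum_mem fun q hq => ?_) _
        obtain ⟨h1, h2⟩ := Finset.mem_Ioc.1 hq
        refine 𝒜.mul_mem ?_ (htr _ (by omega) (by omega))
        have := ih (N - q) (by omega) (by omega)
        rwa [Nat.sub_sub_self h2] at this
  -- Cayley–Hamilton multiplied once more by `A`, so that only the exponents `1, …, N` occur on the
  -- right.
  have key : (fun ω => (A ω ^ (N + 1)) i j) =
      -∑ k ∈ Finset.range N, (fun ω => (A ω).charpoly.coeff k) *
        fun ω => (A ω ^ (k + 1)) i j := by
    funext ω
    have hCH : ∑ k ∈ Finset.range (N + 1), (A ω).charpoly.coeff k • A ω ^ k = 0 := by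
      have := Matrix.aeval_self_charpoly (A ω)
      rwa [Polynomial.aeval_eq_sum_range, Matrix.charpoly_natDegree_eq_dim,
        Fintype.card_fin] at this
    rw [Finset.sum_range_succ, hmonic, one_smul] at hCH
    have h2 := congrArg (fun M => (M * A ω) i j) hCH
    simp only [add_mul, zero_mul, Matrix.add_apply, Finset.sum_mul, Matrix.sum_apply,
      Matrix.smul_mul, ← pow_succ, Matrix.smul_apply, Matrix.zero_apply, smul_eq_mul] at h2
    simp only [Pi.neg_apply, Finset.sum_apply, Pi.mul_apply]
    linear_combination h2
  rw [key]
  refine neg_mem (sum_mem fun k hk => ?_)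
  have hk' := Finset.mem_range.1 hk
  refine 𝒜.mul_mem ?_ (hij _ (by omega) (by omega))
  have := hcoeff (N - k) (by omega)
  rwa [Nat.sub_sub_self hk'.le] at this

/-! ### Total mass of a signed measure -/

section Mass

open Set

/-- The total mass `|γ|(ℝ^d)`. -/
def totalMass (γ : SignedMeasure (Space d)) : ℝ :=
  γ.toJordanDecomposition.posPart.real univ + γ.toJordanDecomposition.negPart.real univ

theorem totalMass_nonneg (γ : SignedMeasure (Space d)) : 0 ≤ totalMass γ :=
  add_nonneg measureReal_nonneg measureReal_nonneg

theorem abs_conv_le (γ : SignedMeasure (Space d)) {φ : Space d → ℝ} {C : ℝ}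
    (hφ : ∀ x, |φ x| ≤ C) (x : Space d) : |conv γ φ x| ≤ C * totalMass γ := by
  have h : ∀ μ : Measure (Space d), [IsFiniteMeasure μ] →
      |∫ y, φ (x - y) ∂μ| ≤ C * μ.real univ := fun μ _ => by
    rw [← Real.norm_eq_abs]
    exact norm_integral_le_of_norm_le_const (Filter.Eventually.of_forall fun y => hφ (x - y))
  rw [conv, totalMass, mul_add]
  exact (abs_sub _ _).trans (add_le_add (h _) (h _))

/-- The mass is attained on the sign function of the Hahn decomposition. This function is
approximated in `L¹` of the total variation by a bounded continuous one, and clamping the latter to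
`[-1, 1]` only improves the approximation. -/
theorem totalMass_le_of_conv_le (γ : SignedMeasure (Space d)) {K : ℝ}
    (h : ∀ φ : Space d →ᵇ ℝ, ‖φ‖ ≤ 1 → conv γ φ 0 ≤ K) : totalMass γ ≤ K := by
  obtain ⟨S, hS, hpS, hnS⟩ := γ.toJordanDecomposition.mutuallySingular
  set μ := γ.toJordanDecomposition.posPart
  set ν := γ.toJordanDecomposition.negPart
  refine le_of_forall_pos_le_add fun ε hε => ?_
  -- The positive part does not charge `S` and the negative part does not charge `Sᶜ`, so `s` is the
  -- sign of `γ`.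
  set s : Space d → ℝ := Sᶜ.indicator 1 - S.indicator 1 with hs
  have hs_meas : Measurable s :=
    (measurable_one.indicator hS.compl).sub (measurable_one.indicator hS)
  have hs_bdd : ∀ x, |s x| ≤ 1 := fun x => by
    by_cases hx : x ∈ S <;> simp [hs, hx]
  have hs_int : ∀ ρ : Measure (Space d), [IsFiniteMeasure ρ] → Integrable s ρ := fun ρ _ =>
    Integrable.of_bound hs_meas.aestronglyMeasurable 1 (Filter.Eventually.of_forall hs_bdd)
  obtain ⟨g, hg, -⟩ := (hs_int (μ + ν)).exists_boundedContinuous_integral_sub_le hε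
  let clamp : ℝ → ℝ := fun r => max (-1) (min 1 r)
  have hclamp : ∀ r, |clamp r| ≤ 1 := fun r =>
    abs_le.2 ⟨le_max_left _ _, max_le (by norm_num) (min_le_left _ _)⟩
  have hclamp_sub : ∀ r q, |r| ≤ 1 → |r - clamp q| ≤ |r - q| := by
    intro r q hr
    obtain ⟨h1, h2⟩ := abs_le.1 hr
    simp only [clamp]
    grind
  have hclamp_cont : Continuous clamp := by fun_prop
  have hgc : Continuous fun y => clamp (g y) := hclamp_cont.comp g.continuous
  -- The reflection undoes the one in `conv γ φ 0 = ∫ φ(0 - y) γ(dy)`.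
  let φ : Space d →ᵇ ℝ := BoundedContinuousFunction.ofNormedAddCommGroup
    (fun y => clamp (g (-y))) (hgc.comp continuous_neg) 1 (fun y => hclamp _)
  have hφ : ‖φ‖ ≤ 1 :=
    (BoundedContinuousFunction.norm_le zero_le_one).2 fun y => hclamp _
  have hconv : conv γ φ 0 = ∫ y, clamp (g y) ∂μ - ∫ y, clamp (g y) ∂ν := by
    simp [conv, φ, BoundedContinuousFunction.coe_ofNormedAddCommGroup, μ, ν]
  have hint : ∀ ρ : Measure (Space d), [IsFiniteMeasure ρ] →
      Integrable (fun y => clamp (g y)) ρ := fun ρ _ =>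
    Integrable.of_bound hgc.aestronglyMeasurable 1
      (Filter.Eventually.of_forall fun y => hclamp _)
  have hμs : ∫ y, s y ∂μ = μ.real univ := by
    have : s =ᵐ[μ] fun _ => (1 : ℝ) := by
      filter_upwards [measure_eq_zero_iff_ae_notMem.1 hpS] with y hy
      simp [hs, hy]
    rw [integral_congr_ae this]
    simp
  have hνs : ∫ y, s y ∂ν = -ν.real univ := by
    have : s =ᵐ[ν] fun _ => (-1 : ℝ) := by
      filter_upwards [measure_eq_zero_iff_ae_notMem.1 hnS] with y hy
      have : y ∈ S := by simpa using hy
      simp [hs, this]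
    rw [integral_congr_ae this]
    simp
  have hdiff : ∫ y, |s y - clamp (g y)| ∂μ + ∫ y, |s y - clamp (g y)| ∂ν ≤ ε := by
    have h1 : ∀ ρ : Measure (Space d), [IsFiniteMeasure ρ] →
        Integrable (fun y => |s y - clamp (g y)|) ρ := fun ρ _ =>
      ((hs_int ρ).sub (hint ρ)).abs
    rw [← integral_add_measure (h1 μ) (h1 ν)]
    refine le_trans (integral_mono (h1 _) ((hs_int _).sub (g.integrable _)).abs fun y => ?_) hg
    exact hclamp_sub _ _ (hs_bdd y)
  have h1 : ∫ y, s y ∂μ - ∫ y, clamp (g y) ∂μ ≤ ∫ y, |s y - clamp (g y)| ∂μ := by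
    rw [← integral_sub (hs_int μ) (hint μ)]
    exact (le_abs_self _).trans abs_integral_le_integral_abs
  have h2 : ∫ y, clamp (g y) ∂ν - ∫ y, s y ∂ν ≤ ∫ y, |s y - clamp (g y)| ∂ν := by
    rw [← integral_sub (hint ν) (hs_int ν)]
    refine (le_abs_self _).trans (abs_integral_le_integral_abs.trans_eq ?_)
    simp_rw [abs_sub_comm]
  have := h φ hφ
  rw [hconv] at this
  rw [totalMass]
  change μ.real univ + ν.real univ ≤ K + ε
  linarith

/-- Integrability is required for all finite measures because it is applied to the image measures
under `y ↦ x - y`. -/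
theorem conv_add (γ : SignedMeasure (Space d)) {φ ψ : Space d → ℝ}
    (hφ : ∀ μ : Measure (Space d), [IsFiniteMeasure μ] → Integrable φ μ)
    (hψ : ∀ μ : Measure (Space d), [IsFiniteMeasure μ] → Integrable ψ μ) (x : Space d) :
    conv γ (fun y => φ y + ψ y) x = conv γ φ x + conv γ ψ x := by
  have h : ∀ χ : Space d → ℝ,
      (∀ μ : Measure (Space d), [IsFiniteMeasure μ] → Integrable χ μ) →
      ∀ μ : Measure (Space d), [IsFiniteMeasure μ] → Integrable (fun y => χ (x - y)) μ := by
    intro χ hχ μ _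
    have := hχ (μ.map fun y => x - y)
    exact this.comp_measurable (by fun_prop)
  simp only [conv]
  rw [integral_add (h φ hφ _) (h ψ hψ _), integral_add (h φ hφ _) (h ψ hψ _)]
  ring

theorem conv_const_mul (γ : SignedMeasure (Space d)) (r : ℝ) (φ : Space d → ℝ) (x : Space d) :
    conv γ (fun y => r * φ y) x = r * conv γ φ x := by
  simp only [conv, integral_const_mul]
  ring

/-- A family of signed measures that is weakly continuous on a compact set has bounded mass. -/
theorem exists_totalMass_le_of_isCompact {ι : Type*} [TopologicalSpace ι]
    (g : ι → SignedMeasure (Space d)) {s : Set ι} (hs : IsCompact s)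
    (h : ∀ φ : Space d →ᵇ ℝ, ContinuousOn (fun t => conv (g t) φ 0) s) :
    ∃ K : ℝ, ∀ t ∈ s, totalMass (g t) ≤ K := by
  let Λ : s → (Space d →ᵇ ℝ) →L[ℝ] ℝ := fun t =>
    LinearMap.mkContinuous
      { toFun := fun φ => conv (g t) φ 0
        map_add' := fun φ ψ => conv_add (g t) (fun μ _ => φ.integrable μ)
          (fun μ _ => ψ.integrable μ) 0
        map_smul' := fun r φ => conv_const_mul (g t) r φ 0 }
      (totalMass (g t)) fun φ => by
        rw [mul_comm]
        exact abs_conv_le (g t) (fun x => φ.norm_coe_le_norm x) 0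
  -- For each `φ` the values are bounded by continuity on a compact set; Banach–Steinhaus turns this
  -- into a bound on the norms of the functionals.
  obtain ⟨K, hK⟩ := banach_steinhaus (g := Λ) fun φ => by
    obtain ⟨C, hC⟩ := hs.exists_bound_of_continuousOn (h φ)
    exact ⟨C, fun t => hC t t.2⟩
  refine ⟨K, fun t ht => totalMass_le_of_conv_le _ fun φ hφ => ?_⟩
  have h1 : conv (g t) φ 0 = Λ ⟨t, ht⟩ φ := rfl
  rw [h1]
  calc Λ ⟨t, ht⟩ φ ≤ ‖Λ ⟨t, ht⟩ φ‖ := le_abs_self _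
    _ ≤ ‖Λ ⟨t, ht⟩‖ * ‖φ‖ := (Λ ⟨t, ht⟩).le_opNorm φ
    _ ≤ ‖Λ ⟨t, ht⟩‖ * 1 := by gcongr
    _ ≤ K := by rw [mul_one]; exact hK _

/-! ### Fourier–Stieltjes transforms -/

/-- The Fourier–Stieltjes transform `∫ e^{-i ξ·x} γ(dx)` of a signed measure. -/
def stieltjes (γ : SignedMeasure (Space d)) (ξ : Space d) : ℂ :=
  charFun γ.toJordanDecomposition.posPart (-ξ) - charFun γ.toJordanDecomposition.negPart (-ξ)

theorem charFun_add_measure (μ ν : Measure (Space d)) [IsFiniteMeasure μ] [IsFiniteMeasure ν]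
    (ξ : Space d) : charFun (μ + ν) ξ = charFun μ ξ + charFun ν ξ := by
  simp only [charFun_eq_integral_innerProbChar]
  exact integral_add_measure (BoundedContinuousFunction.integrable _ _)
    (BoundedContinuousFunction.integrable _ _)

/-- A finite measure is determined by its characteristic function, so `γ⁺ + ν = γ⁻ + μ`. Restricting
this to the two Hahn sets shows that the Jordan decomposition has the least mass among all
representations as a difference. -/
theorem totalMass_le_of_stieltjes_eq (γ : SignedMeasure (Space d)) (μ ν : Measure (Space d))
    [IsFiniteMeasure μ] [IsFiniteMeasure ν]
    (h : ∀ ξ, stieltjes γ ξ = charFun μ (-ξ) - charFun ν (-ξ)) :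
    totalMass γ ≤ μ.real univ + ν.real univ := by
  obtain ⟨S, hS, hpS, hnS⟩ := γ.toJordanDecomposition.mutuallySingular
  have key : γ.toJordanDecomposition.posPart + ν = γ.toJordanDecomposition.negPart + μ := by
    refine Measure.ext_of_charFun (funext fun ξ => ?_)
    have := h (-ξ)
    rw [stieltjes, neg_neg] at this
    rw [charFun_add_measure, charFun_add_measure]
    linear_combination this
  have hval : ∀ A : Set (Space d), γ.toJordanDecomposition.posPart.real A + ν.real A =
      γ.toJordanDecomposition.negPart.real A + μ.real A := fun A => by
    rw [← measureReal_add_apply, ← measureReal_add_apply, key]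
  have hp : γ.toJordanDecomposition.posPart.real univ ≤ μ.real univ := by
    have h1 := hval Sᶜ
    have h2 : γ.toJordanDecomposition.negPart.real Sᶜ = 0 := by simp [Measure.real, hnS]
    have h3 := measureReal_add_measureReal_compl
      (μ := γ.toJordanDecomposition.posPart) hS
    have h4 : γ.toJordanDecomposition.posPart.real S = 0 := by simp [Measure.real, hpS]
    have h5 : μ.real Sᶜ ≤ μ.real univ := measureReal_mono (subset_univ _)
    have h6 : 0 ≤ ν.real Sᶜ := measureReal_nonneg
    linarith
  have hn : γ.toJordanDecomposition.negPart.real univ ≤ ν.real univ := by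
    have h1 := hval S
    have h2 : γ.toJordanDecomposition.negPart.real Sᶜ = 0 := by simp [Measure.real, hnS]
    have h3 := measureReal_add_measureReal_compl
      (μ := γ.toJordanDecomposition.negPart) hS
    have h4 : γ.toJordanDecomposition.posPart.real S = 0 := by simp [Measure.real, hpS]
    have h5 : ν.real S ≤ ν.real univ := measureReal_mono (subset_univ _)
    have h6 : 0 ≤ μ.real S := measureReal_nonneg
    linarith
  exact add_le_add hp hn

theorem charFun_smul_dirac_zero (r : NNReal) (ξ : Space d) :
    charFun (r • Measure.dirac (0 : Space d)) ξ = r := by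
  simp [charFun_apply, integral_smul_nnreal_measure, NNReal.smul_def]

/-- The algebra of families of Fourier–Stieltjes transforms of differences of finite measures with
uniformly bounded mass. -/
def uniformTransforms (ι : Type*) (d : ℕ) : Subalgebra ℝ (ι × Space d → ℂ) where
  carrier := {m | ∃ K : ℝ, ∀ i, ∃ μ ν : Measure (Space d), IsFiniteMeasure μ ∧ IsFiniteMeasure ν ∧
    μ.real univ + ν.real univ ≤ K ∧ ∀ ξ, m (i, ξ) = charFun μ (-ξ) - charFun ν (-ξ)}
  add_mem' := by
    rintro m m' ⟨K, hK⟩ ⟨K', hK'⟩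
    refine ⟨K + K', fun i => ?_⟩
    obtain ⟨μ, ν, _, _, hle, hm⟩ := hK i
    obtain ⟨μ', ν', _, _, hle', hm'⟩ := hK' i
    refine ⟨μ + μ', ν + ν', inferInstance, inferInstance, ?_, fun ξ => ?_⟩
    · rw [measureReal_add_apply, measureReal_add_apply]
      linarith
    · rw [Pi.add_apply, hm, hm', charFun_add_measure, charFun_add_measure]
      ring
  mul_mem' := by
    rintro m m' ⟨K, hK⟩ ⟨K', hK'⟩
    refine ⟨K * K', fun i => ?_⟩
    obtain ⟨μ, ν, _, _, hle, hm⟩ := hK i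
    obtain ⟨μ', ν', _, _, hle', hm'⟩ := hK' i
    -- The mass of a convolution is read off from its characteristic function at `0`.
    have hmass : ∀ ρ ρ' : Measure (Space d), [IsFiniteMeasure ρ] → [IsFiniteMeasure ρ'] →
        (ρ.conv ρ').real univ = ρ.real univ * ρ'.real univ := by
      intro ρ ρ' _ _
      have := charFun_conv (μ := ρ) (ν := ρ') 0
      rw [charFun_zero, charFun_zero, charFun_zero] at this
      exact_mod_cast this
    -- The positive and the negative terms in the expansion of `(μ - ν) * (μ' - ν')`.
    refine ⟨μ.conv μ' + ν.conv ν', μ.conv ν' + ν.conv μ', inferInstance, inferInstance,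
      ?_, fun ξ => ?_⟩
    · rw [measureReal_add_apply, measureReal_add_apply, hmass, hmass, hmass, hmass]
      have h0 : 0 ≤ μ.real univ + ν.real univ := add_nonneg measureReal_nonneg measureReal_nonneg
      have h0' : 0 ≤ μ'.real univ + ν'.real univ :=
        add_nonneg measureReal_nonneg measureReal_nonneg
      have := mul_le_mul hle hle' h0' (h0.trans hle)
      linarith
    · rw [Pi.mul_apply, hm, hm', charFun_add_measure, charFun_add_measure]
      simp only [charFun_conv]
      ring
  algebraMap_mem' := fun r => by
    refine ⟨|r|, fun i => ⟨r.toNNReal • Measure.dirac 0, (-r).toNNReal • Measure.dirac 0,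
      inferInstance, inferInstance, ?_, fun ξ => ?_⟩⟩
    · rw [measureReal_nnreal_smul_apply, measureReal_nnreal_smul_apply, probReal_univ]
      rcases le_total 0 r with h | h
      · simp [Real.toNNReal_of_nonpos (neg_nonpos.2 h), h, abs_of_nonneg]
      · simp [Real.toNNReal_of_nonpos h, h, abs_of_nonpos]
    · rw [charFun_smul_dirac_zero, charFun_smul_dirac_zero]
      have : r = r.toNNReal - (-r).toNNReal := by
        rcases le_total 0 r with h | h
        · simp [Real.toNNReal_of_nonpos (neg_nonpos.2 h), h]
        · simp [Real.toNNReal_of_nonpos h, h]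
      conv_lhs => rw [Pi.algebraMap_apply, Complex.coe_algebraMap, this]
      push_cast
      rfl

theorem stieltjes_mem_uniformTransforms {ι : Type*} {γ : ι → SignedMeasure (Space d)} {K : ℝ}
    (hK : ∀ i, totalMass (γ i) ≤ K) :
    (fun z : ι × Space d => stieltjes (γ z.1) z.2) ∈ uniformTransforms ι d :=
  ⟨K, fun i => ⟨_, _, inferInstance, inferInstance, hK i, fun _ => rfl⟩⟩

theorem exists_totalMass_le_of_mem_uniformTransforms {ι : Type*}
    {γ : ι → SignedMeasure (Space d)}
    (h : (fun z : ι × Space d => stieltjes (γ z.1) z.2) ∈ uniformTransforms ι d) :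
    ∃ K, ∀ i, totalMass (γ i) ≤ K := by
  obtain ⟨K, hK⟩ := h
  refine ⟨K, fun i => ?_⟩
  obtain ⟨μ, ν, _, _, hle, hm⟩ := hK i
  exact (totalMass_le_of_stieltjes_eq (γ i) μ ν hm).trans hle

end Mass

/-! ### The matrix exponential of the companion matrix -/

namespace Coeffs

/-- The matrix `e^{t B(ξ)}`. -/
def propagator (c : Coeffs d) (t : ℝ) (ξ : Space d) : Matrix (Fin c.N) (Fin c.N) ℂ :=
  NormedSpace.exp ((t : ℂ) • c.companion ξ)

/-- Transposition turns the first column of `e^{tBᵀ}` into the first row of `e^{tB}`. -/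
theorem greenHat_apply (c : Coeffs d) (t : ℝ) (ξ : Space d) (n : Fin c.N) :
    c.greenHat t ξ n =
      (((2 * Real.pi) ^ (-(d : ℝ) / 2) : ℝ) : ℂ) * c.propagator t ξ c.first n := by
  rw [greenHat, ← Matrix.transpose_smul, Matrix.exp_transpose]
  simp [propagator]

theorem propagator_zero (c : Coeffs d) (ξ : Space d) : c.propagator 0 ξ = 1 := by
  simp [propagator]

theorem propagator_pow (c : Coeffs d) (t : ℝ) (ξ : Space d) (k : ℕ) :
    c.propagator t ξ ^ k = c.propagator (k * t) ξ := by
  rw [propagator, propagator, ← Matrix.exp_nsmul, ← Nat.cast_smul_eq_nsmul ℂ, smul_smul]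
  push_cast
  rfl

theorem companion_mul_propagator (c : Coeffs d) (t : ℝ) (ξ : Space d) :
    c.companion ξ * c.propagator t ξ = c.propagator t ξ * c.companion ξ := by
  open scoped Matrix.Norms.Operator in
  exact ((Commute.refl (c.companion ξ)).smul_right (t : ℂ)).exp_right

theorem hasDerivAt_propagator (c : Coeffs d) (t : ℝ) (ξ : Space d) (i j : Fin c.N) :
    HasDerivAt (fun s => c.propagator s ξ i j)
      ((c.propagator t ξ * c.companion ξ) i j) t := by
  open scoped Matrix.Norms.Operator in
  have h : HasDerivAt (fun s : ℂ => NormedSpace.exp (s • c.companion ξ))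
    (NormedSpace.exp ((t : ℂ) • c.companion ξ) * c.companion ξ) (t : ℂ) :=
    hasDerivAt_exp_smul_const (𝕂 := ℂ) (c.companion ξ) (t : ℂ)
  have h2 := hasDerivAt_pi.1 (hasDerivAt_pi.1 h i) j
  exact h2.comp_ofReal

theorem continuous_symbol (c : Coeffs d) : Continuous c.symbol := by
  unfold symbol
  fun_prop

theorem continuous_companion (c : Coeffs d) : Continuous c.companion := by
  refine continuous_matrix fun i j => ?_
  simp only [companion, Matrix.of_apply]
  have := c.continuous_symbol
  split_ifs <;> fun_prop

theorem continuous_propagator (c : Coeffs d) :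
    Continuous fun z : ℝ × Space d => c.propagator z.1 z.2 := by
  open scoped Matrix.Norms.Operator in
  have h : Continuous fun z : ℝ × Space d => (z.1 : ℂ) • c.companion z.2 :=
    (Complex.continuous_ofReal.comp continuous_fst).smul
      (c.continuous_companion.comp continuous_snd)
  exact (NormedSpace.exp_continuous (𝔸 := Matrix (Fin c.N) (Fin c.N) ℂ)).comp h

theorem continuous_propagator_apply (c : Coeffs d) (i j : Fin c.N) :
    Continuous fun z : ℝ × Space d => c.propagator z.1 z.2 i j :=
  c.continuous_propagator.matrix_elem i j

end Coeffs

/-! ### Fourier–Stieltjes transforms of the Green measures -/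

theorem continuous_stieltjes (γ : SignedMeasure (Space d)) : Continuous (stieltjes γ) :=
  (continuous_charFun.comp continuous_neg).sub (continuous_charFun.comp continuous_neg)

/-- The Fourier transform inverse to `invFourier`. -/
def unitaryFourier (d : ℕ) (ψ : 𝓢(Space d, ℂ)) : 𝓢(Space d, ℂ) :=
  ((((2 * Real.pi) ^ (-(d : ℝ) / 2))⁻¹ : ℝ) : ℂ) •
    FourierTransform.fourier
      (SchwartzMap.compCLMOfContinuousLinearEquiv ℂ (dilation d).symm ψ)

theorem invFourier_unitaryFourier (ψ : 𝓢(Space d, ℂ)) :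
    invFourier d (unitaryFourier d ψ) = ψ := by
  have h : ((2 * Real.pi) ^ (-(d : ℝ) / 2) : ℝ) ≠ 0 := by positivity
  ext x
  rw [unitaryFourier, map_smul, invFourier]
  simp [h]

/-- The dilation contributes the Jacobian `(2π)^{-d}`, and `(2π)^{d/2} (2π)^{-d} = (2π)^{-d/2}`. -/
theorem unitaryFourier_apply (ψ : 𝓢(Space d, ℂ)) (x : Space d) :
    unitaryFourier d ψ x = (((2 * Real.pi) ^ (-(d : ℝ) / 2) : ℝ) : ℂ) *
      ∫ ξ, Complex.exp (-(Complex.I * ((inner ℝ ξ x : ℝ) : ℂ))) * ψ ξ := by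
  have hpi : (0 : ℝ) < 2 * Real.pi := by positivity
  have h : unitaryFourier d ψ x = ((((2 * Real.pi) ^ (-(d : ℝ) / 2))⁻¹ : ℝ) : ℂ) *
      (FourierTransform.fourier (SchwartzMap.compCLMOfContinuousLinearEquiv ℂ
        (dilation d).symm ψ) : 𝓢(Space d, ℂ)) x := rfl
  have hdil : ∀ v : Space d, (dilation d).symm v = (2 * Real.pi) • v := by
    intro v
    rw [ContinuousLinearEquiv.symm_apply_eq]
    change v = (2 * Real.pi)⁻¹ • ((2 * Real.pi) • v)
    rw [inv_smul_smul₀ hpi.ne']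
  have hint : ∫ v : Space d, Complex.exp (((-2 * Real.pi * inner ℝ v x : ℝ) : ℂ) * Complex.I) •
      ψ ((2 * Real.pi) • v) = (((2 * Real.pi) ^ d)⁻¹ : ℝ) •
        ∫ ξ, Complex.exp (-(Complex.I * ((inner ℝ ξ x : ℝ) : ℂ))) * ψ ξ := by
    have := Measure.integral_comp_smul (volume : Measure (Space d))
      (fun ξ => Complex.exp (-(Complex.I * ((inner ℝ ξ x : ℝ) : ℂ))) * ψ ξ) (2 * Real.pi)
    rw [finrank_euclideanSpace, Fintype.card_fin, abs_of_pos (by positivity)] at this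
    rw [← this]
    refine integral_congr_ae (Filter.Eventually.of_forall fun v => ?_)
    simp only [smul_eq_mul, inner_smul_left]
    congr 2
    push_cast
    simp
    ring
  rw [h, SchwartzMap.fourier_coe, Real.fourier_eq']
  simp only [SchwartzMap.compCLMOfContinuousLinearEquiv_apply, Function.comp_apply, hdil]
  rw [hint, Complex.real_smul, ← mul_assoc, ← Complex.ofReal_mul]
  congr 2
  rw [← Real.rpow_neg hpi.le, ← Real.rpow_natCast, ← Real.rpow_neg hpi.le, ← Real.rpow_add hpi]
  congr 1
  ring

theorem integral_unitaryFourier (ψ : 𝓢(Space d, ℂ)) (μ : Measure (Space d)) [IsFiniteMeasure μ] :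
    ∫ x, unitaryFourier d ψ x ∂μ = (((2 * Real.pi) ^ (-(d : ℝ) / 2) : ℝ) : ℂ) *
      ∫ ξ, charFun μ (-ξ) * ψ ξ := by
  simp_rw [unitaryFourier_apply]
  rw [integral_const_mul, integral_integral_swap]
  · congr 1
    refine integral_congr_ae (Filter.Eventually.of_forall fun ξ => ?_)
    simp only [charFun_apply]
    rw [integral_mul_const]
    congr 1
    refine integral_congr_ae (Filter.Eventually.of_forall fun x => ?_)
    simp only [inner_neg_right, real_inner_comm]
    push_cast
    congr 1
    ring
  · have h1 : Integrable (fun z : Space d × Space d => ψ z.2) (μ.prod volume) :=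
      ψ.integrable.comp_snd μ
    refine h1.norm.mono' ?_ (Filter.Eventually.of_forall fun z => ?_)
    · refine Continuous.aestronglyMeasurable ?_
      simp only [Function.uncurry_def]
      have := ψ.continuous
      fun_prop
    · simp only [Function.uncurry]
      rw [norm_mul, ← mul_neg, mul_comm Complex.I, ← Complex.ofReal_neg,
        Complex.norm_exp_ofReal_mul_I, one_mul]

/-- Tested against the Fourier transform of a compactly supported `ψ`, the measure and the
distribution give the integrals of `ψ` against `q` times the Stieltjes transform and against
`greenHat`. The two functions therefore agree almost everywhere, and everywhere by continuity. -/
theorem propagator_eq_stieltjes {c : Coeffs d} {T : EReal} (h_tempered : TemperedHat c T)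
    {g : Fin c.N → ℝ → SignedMeasure (Space d)} (hg : GreenMeasures c T g) {t : ℝ}
    (ht : t ∈ timeInterval T) (n : Fin c.N) (ξ : Space d) :
    c.propagator t ξ c.first n = stieltjes (g n t) ξ := by
  obtain ⟨L, hloc, hL⟩ := h_tempered t ht n
  have hG := hg.isGreen t ht n L ⟨hloc, hL⟩
  set q : ℂ := (((2 * Real.pi) ^ (-(d : ℝ) / 2) : ℝ) : ℂ) with hq
  have hq0 : q ≠ 0 := by
    rw [hq, Complex.ofReal_ne_zero]
    positivity
  have hcont1 : Continuous fun ξ => c.greenHat t ξ n := by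
    simp_rw [Coeffs.greenHat_apply]
    exact continuous_const.mul ((c.continuous_propagator_apply c.first n).comp
      (continuous_const.prodMk continuous_id))
  have hcont2 : Continuous fun ξ => q * stieltjes (g n t) ξ :=
    continuous_const.mul (continuous_stieltjes _)
  have hae : (fun ξ => c.greenHat t ξ n) =ᵐ[volume] fun ξ => q * stieltjes (g n t) ξ := by
    refine ae_eq_of_integral_contDiff_smul_eq hloc hcont2.locallyIntegrable fun w hw hsupp => ?_
    have hw' : ContDiff ℝ (⊤ : ℕ∞) fun ξ => (w ξ : ℂ) := Complex.ofRealCLM.contDiff.comp hw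
    have hsupp' : HasCompactSupport fun ξ => (w ξ : ℂ) :=
      hsupp.comp_left (g := ((↑) : ℝ → ℂ)) Complex.ofReal_zero
    set ψ : 𝓢(Space d, ℂ) := hsupp'.toSchwartzMap hw'
    have hψ : ∀ ξ, ψ ξ = w ξ := fun ξ => rfl
    have h1 := hL ψ hsupp'
    have h2 := hG (unitaryFourier d ψ)
    rw [invFourierDist_apply, invFourier_unitaryFourier, h1, integral_unitaryFourier,
      integral_unitaryFourier, ← mul_sub, ← integral_sub] at h2
    · simp only [Complex.real_smul, ← hψ]
      calc ∫ ξ, ψ ξ * c.greenHat t ξ n = ∫ ξ, c.greenHat t ξ n * ψ ξ := by simp_rw [mul_comm]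
        _ = _ := h2
        _ = ∫ ξ, ψ ξ * (q * stieltjes (g n t) ξ) := by
          rw [← integral_const_mul]
          refine integral_congr_ae (Filter.Eventually.of_forall fun ξ => ?_)
          simp only [stieltjes]
          ring
    all_goals
      refine (Continuous.integrable_of_hasCompactSupport ?_ ?_)
      · exact (continuous_charFun.comp continuous_neg).mul ψ.continuous
      · exact HasCompactSupport.mul_left hsupp'
  have := congrFun ((Continuous.ae_eq_iff_eq volume hcont1 hcont2).1 hae) ξ
  simp only [Coeffs.greenHat_apply] at this
  exact mul_left_cancel₀ hq0 this

/-! ### Bounds on the mass of the Green measures -/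

theorem zero_mem_timeInterval {T : EReal} (hT : 0 < T) : (0 : ℝ) ∈ timeInterval T :=
  ⟨le_rfl, by simpa using hT⟩

theorem mem_timeInterval_of_le {T : EReal} {s t : ℝ} (ht : t ∈ timeInterval T) (hs : 0 ≤ s)
    (hst : s ≤ t) : s ∈ timeInterval T :=
  ⟨hs, (EReal.coe_le_coe_iff.2 hst).trans_lt ht.2⟩

theorem Icc_subset_timeInterval {T : EReal} {t : ℝ} (ht : t ∈ timeInterval T) :
    Set.Icc 0 t ⊆ timeInterval T := fun _ hs => mem_timeInterval_of_le ht hs.1 hs.2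

/-- A proper fraction of `[0, T) ∩ (-∞, S]` is bounded away from `T`. -/
theorem exists_mem_timeInterval_mul_le {T : EReal} (hT : 0 < T) (S : ℝ) {r : ℝ} (hr0 : 0 ≤ r)
    (hr1 : r < 1) : ∃ S' ∈ timeInterval T, ∀ t ∈ timeInterval T, t ≤ S → r * t ≤ S' := by
  -- Either `max S 0` lies before `T` and can be taken for `S'`, or `T` is finite and `r * T` stays
  -- strictly below it.
  by_cases hS : max S 0 ∈ timeInterval T
  · refine ⟨_, hS, fun t ht htS => ?_⟩
    have := ht.1
    nlinarith [le_max_left S 0]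
  · have hTS : T ≤ ((max S 0 : ℝ) : EReal) := by
      by_contra h
      exact hS ⟨le_max_right _ _, not_le.1 h⟩
    lift T to ℝ using ⟨ne_top_of_le_ne_top (EReal.coe_ne_top _) hTS,
      ne_bot_of_gt hT⟩
    have hT0 : 0 < T := by exact_mod_cast hT
    refine ⟨r * T, ⟨by positivity, EReal.coe_lt_coe_iff.2 (by nlinarith)⟩, fun t ht _ => ?_⟩
    have : t < T := EReal.coe_lt_coe_iff.1 ht.2
    gcongr

/-- What matters is that the bound holds up to `T`, where weak continuity is not available. The
factor `N/(N+1)` moves the times `kt/(N+1)`, `k ≤ N`, into a compact subinterval, and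
`pow_entry_mem` recovers the time `t` from them within `uniformTransforms`. -/
theorem exists_totalMass_le {c : Coeffs d} {T : EReal} (hT : 0 < T)
    (h_tempered : TemperedHat c T) {g : Fin c.N → ℝ → SignedMeasure (Space d)}
    (hg : GreenMeasures c T g) (S : ℝ) :
    ∃ K : ℝ, ∀ t ∈ timeInterval T, t ≤ S → ∀ n, totalMass (g n t) ≤ K := by
  set r : ℝ := c.N / (c.N + 1) with hr
  have hr1 : r < 1 := by rw [hr, div_lt_one (by positivity)]; linarith
  obtain ⟨S', hS', hrS'⟩ := exists_mem_timeInterval_mul_le hT S (r := r) (by positivity) hr1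
  have hlocal : ∀ n, ∃ K : ℝ, ∀ t ∈ Set.Icc 0 S', totalMass (g n t) ≤ K := fun n =>
    exists_totalMass_le_of_isCompact (g n) isCompact_Icc fun φ =>
      (hg.continuous_conv n φ).comp (f := fun t : ℝ => (t, (0 : Space d))) (by fun_prop)
        fun t ht => ⟨Icc_subset_timeInterval hS' ht, Set.mem_univ _⟩
  let ι := {t : ℝ // t ∈ timeInterval T ∧ t ≤ S}
  let A : ι × Space d → Matrix (Fin c.N) (Fin c.N) ℂ := fun ω =>
    c.propagator (ω.1.1 / (c.N + 1)) ω.2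
  have hentry : ∀ k, 1 ≤ k → k ≤ c.N → ∀ n,
      (fun ω => (A ω ^ k) c.first n) ∈ uniformTransforms ι d := by
    intro k _ hk n
    obtain ⟨K, hK⟩ := hlocal n
    have hmem : ∀ t : ι, (k * (t.1 / (c.N + 1)) : ℝ) ∈ Set.Icc 0 S' := by
      rintro ⟨t, ht, htS⟩
      have h0 := ht.1
      refine ⟨by positivity, le_trans ?_ (hrS' t ht htS)⟩
      have : (k : ℝ) ≤ c.N := by exact_mod_cast hk
      rw [hr, div_mul_eq_mul_div, ← mul_div_assoc]
      gcongr
    have : (fun ω : ι × Space d => (A ω ^ k) c.first n) =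
        fun ω => stieltjes (g n (k * (ω.1.1 / (c.N + 1)))) ω.2 := by
      funext ω
      rw [Coeffs.propagator_pow, propagator_eq_stieltjes h_tempered hg
        (Icc_subset_timeInterval hS' (hmem ω.1))]
    rw [this]
    exact stieltjes_mem_uniformTransforms (γ := fun t : ι => g n (k * (t.1 / (c.N + 1))))
      fun t => hK _ (hmem t)
  have htrace : ∀ k, 1 ≤ k → k ≤ c.N → (fun ω => (A ω ^ k).trace) ∈ uniformTransforms ι d :=
    fun k h1 hk => trace_mem_of_commute_companion _ c (fun ω => ω.2) _
      (fun ω => by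
        simp only [A, Coeffs.propagator_pow]
        exact c.companion_mul_propagator _ _) (hentry k h1 hk)
  have hmass : ∀ n, ∃ K, ∀ t : ι, totalMass (g n t.1) ≤ K := by
    intro n
    refine exists_totalMass_le_of_mem_uniformTransforms (γ := fun t : ι => g n t.1) ?_
    have h := pow_entry_mem (uniformTransforms ι d) A htrace c.first n
      fun k h1 hk => hentry k h1 hk n
    convert! h using 1
    funext ω
    rw [Coeffs.propagator_pow, ← propagator_eq_stieltjes h_tempered hg ω.1.2.1]
    congr 2
    push_cast
    field_simp
  choose K hK using hmass
  refine ⟨∑ n, |K n|, fun t ht htS n => (hK n ⟨t, ht, htS⟩).trans ((le_abs_self _).trans ?_)⟩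
  exact Finset.single_le_sum (f := fun n => |K n|) (fun _ _ => abs_nonneg _) (Finset.mem_univ n)

/-! ### The adjoint of the spatial operator -/

section Adjoint

open FourierTransform LineDeriv Polynomial

/-- A real Schwartz function, viewed as a complex one. -/
def complexify (d : ℕ) : 𝓢(Space d, ℝ) →L[ℝ] 𝓢(Space d, ℂ) :=
  SchwartzMap.postcompCLM Complex.ofRealCLM

@[simp]
theorem complexify_apply (φ : 𝓢(Space d, ℝ)) (x : Space d) : complexify d φ x = φ x := rfl

theorem complexify_injective : Function.Injective (complexify d) := fun φ ψ h => by
  ext x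
  have := congrArg (fun χ : 𝓢(Space d, ℂ) => χ x) h
  simpa using this

theorem complexify_lineDerivOp (v : Space d) (φ : 𝓢(Space d, ℝ)) :
    complexify d (lineDerivOp v φ) = lineDerivOp v (complexify d φ) := by
  ext x
  have h : HasFDerivAt (complexify d φ) (Complex.ofRealCLM.comp (fderiv ℝ φ x)) x :=
    Complex.ofRealCLM.hasFDerivAt.comp x (φ.hasFDerivAt x)
  rw [complexify_apply, SchwartzMap.lineDerivOp_apply_eq_fderiv,
    SchwartzMap.lineDerivOp_apply_eq_fderiv, h.fderiv]
  rfl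

/-- The Fourier transform of a real Schwartz function. -/
def realFourier (φ : 𝓢(Space d, ℝ)) : 𝓢(Space d, ℂ) := 𝓕 (complexify d φ)

theorem realFourier_add (φ ψ : 𝓢(Space d, ℝ)) :
    realFourier (φ + ψ) = realFourier φ + realFourier ψ := by
  rw [realFourier, map_add, FourierTransform.fourier_add]
  rfl

theorem realFourier_smul (r : ℝ) (φ : 𝓢(Space d, ℝ)) :
    realFourier (r • φ) = (r : ℂ) • realFourier φ := by
  rw [realFourier, map_smul]
  have : r • complexify d φ = (r : ℂ) • complexify d φ := by
    ext x
    simp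
  rw [this, FourierTransform.fourier_smul]
  rfl

theorem realFourier_injective : Function.Injective (realFourier (d := d)) := fun φ ψ h => by
  refine complexify_injective ?_
  have := congrArg (fun χ : 𝓢(Space d, ℂ) => 𝓕⁻ χ) h
  simpa [realFourier] using this

theorem realFourier_lineDerivOp (i : Fin d) (φ : 𝓢(Space d, ℝ)) (η : Space d) :
    realFourier (lineDerivOp (EuclideanSpace.single i (1 : ℝ)) φ) η =
      (2 * Real.pi * Complex.I * (η i : ℂ)) * realFourier φ η := by
  rw [realFourier, complexify_lineDerivOp, SchwartzMap.fourier_lineDerivOp_eq]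
  have hg : (fun x : Space d => inner ℝ x (EuclideanSpace.single i (1 : ℝ))).HasTemperateGrowth :=
    ((innerSL ℝ).flip (EuclideanSpace.single i (1 : ℝ))).hasTemperateGrowth
  rw [smul_apply, SchwartzMap.smulLeftCLM_apply_apply hg]
  simp [EuclideanSpace.inner_single_right, realFourier, mul_assoc]

theorem realFourier_partialDeriv (α : Fin d → ℕ) (φ : 𝓢(Space d, ℝ)) (η : Space d) :
    realFourier (partialDeriv α φ) η =
      (∏ i, (2 * Real.pi * Complex.I * (η i : ℂ)) ^ α i) * realFourier φ η := by
  rw [partialDeriv, Fin.prod_univ_def]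
  induction List.finRange d with
  | nil => simp
  | cons i l ih =>
    rw [List.foldr_cons, List.map_cons, List.prod_cons, mul_assoc, ← ih]
    generalize List.foldr _ φ l = ψ
    induction α i with
    | zero => simp
    | succ k ihk =>
      rw [Function.iterate_succ_apply', realFourier_lineDerivOp, ihk, pow_succ]
      ring

/-- The operator `φ ↦ ∑_{|α| ≤ M} b_α (-1)^{|α|} D^α φ`, the formal adjoint of
`∑_{|α| ≤ M} b_α D^α`. -/
def Coeffs.adjointOp (c : Coeffs d) : Module.End ℝ 𝓢(Space d, ℝ) where
  toFun φ := ∑ α ∈ multiIndices d c.M, (c.b α * (-1) ^ (∑ i, α i)) • partialDeriv α φ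
  map_add' φ ψ := by
    rw [← Finset.sum_add_distrib]
    refine Finset.sum_congr rfl fun α _ => ?_
    rw [← smul_add]
    congr 1
    -- Linearity of the iterated derivatives is checked after Fourier transformation, where they
    -- multiply by a monomial.
    refine realFourier_injective (SchwartzMap.ext fun η => ?_)
    simp only [realFourier_add, add_apply, realFourier_partialDeriv]
    ring
  map_smul' r φ := by
    rw [RingHom.id_apply, Finset.smul_sum]
    refine Finset.sum_congr rfl fun α _ => ?_
    rw [smul_comm r]
    congr 1
    refine realFourier_injective (SchwartzMap.ext fun η => ?_)
    simp only [realFourier_smul, smul_apply, realFourier_partialDeriv, smul_eq_mul]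
    ring

theorem Coeffs.adjointOp_apply (c : Coeffs d) (φ : 𝓢(Space d, ℝ)) :
    c.adjointOp φ =
      ∑ α ∈ multiIndices d c.M, (c.b α * (-1) ^ (∑ i, α i)) • partialDeriv α φ := rfl

theorem realFourier_sum {ι : Type*} (s : Finset ι) (φ : ι → 𝓢(Space d, ℝ)) (η : Space d) :
    realFourier (∑ i ∈ s, φ i) η = ∑ i ∈ s, realFourier (φ i) η := by
  classical
  induction s using Finset.induction_on with
  | empty =>
    have : realFourier (0 : 𝓢(Space d, ℝ)) = 0 := by
      simpa using realFourier_smul (0 : ℝ) (0 : 𝓢(Space d, ℝ))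
    simp [this]
  | insert i s hi ih =>
    rw [Finset.sum_insert hi, Finset.sum_insert hi, realFourier_add, add_apply, ih]

/-- The sign of the adjoint is absorbed into the frequency: `(-1)^{|α|} (2πi η)^α = i^{|α|}
(-2πη)^α`. Hence all multipliers below are evaluated at `ξ = -2πη`. -/
theorem realFourier_adjointOp (c : Coeffs d) (φ : 𝓢(Space d, ℝ)) (η : Space d) :
    realFourier (c.adjointOp φ) η =
      c.symbol (-(2 * Real.pi) • η) * realFourier φ η := by
  rw [Coeffs.adjointOp_apply, realFourier_sum, Coeffs.symbol, Finset.sum_mul]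
  refine Finset.sum_congr rfl fun α _ => ?_
  rw [realFourier_smul, smul_apply, realFourier_partialDeriv, smul_eq_mul,
    ← mul_assoc]
  congr 1
  have h : (-1 : ℂ) ^ (∑ i, α i) * ∏ i, (2 * Real.pi * Complex.I * (η i : ℂ)) ^ α i =
      Complex.I ^ (∑ i, α i) * ∏ i, (((-(2 * Real.pi) • η) i : ℝ) : ℂ) ^ α i := by
    simp_rw [← Finset.prod_pow_eq_pow_sum]
    rw [← Finset.prod_mul_distrib, ← Finset.prod_mul_distrib]
    refine Finset.prod_congr rfl fun i _ => ?_
    rw [← mul_pow, ← mul_pow]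
    congr 1
    simp
    ring
  push_cast
  linear_combination (c.b α : ℂ) * h

/-- The action of a polynomial in the adjoint of the spatial operator. -/
def Coeffs.act (c : Coeffs d) (q : ℝ[X]) : Module.End ℝ 𝓢(Space d, ℝ) := aeval c.adjointOp q

theorem realFourier_act (c : Coeffs d) (q : ℝ[X]) (φ : 𝓢(Space d, ℝ)) (η : Space d) :
    realFourier (c.act q φ) η =
      q.eval₂ Complex.ofRealHom (c.symbol (-(2 * Real.pi) • η)) * realFourier φ η := by
  unfold Coeffs.act
  induction q using Polynomial.induction_on' generalizing φ with
  | add p q hp hq =>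
    rw [map_add, LinearMap.add_apply, realFourier_add, add_apply, hp, hq, eval₂_add,
      add_mul]
  | monomial k r =>
    rw [aeval_monomial, eval₂_monomial, Module.End.mul_apply, Module.algebraMap_end_apply,
      realFourier_smul, smul_apply, smul_eq_mul, mul_assoc]
    congr 1
    induction k with
    | zero => simp
    | succ k ih =>
      rw [pow_succ', Module.End.mul_apply, realFourier_adjointOp, ih, pow_succ]
      ring

/-- The companion matrix with the polynomial variable in place of the symbol. -/
def Coeffs.polyCompanion (c : Coeffs d) : Matrix (Fin c.N) (Fin c.N) ℝ[X] :=
  companionMatrix c.N (fun n => C (c.a n)) X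

theorem eval₂_polyCompanion (c : Coeffs d) (ξ : Space d) (i j : Fin c.N) :
    (c.polyCompanion i j).eval₂ Complex.ofRealHom (c.symbol ξ) = c.companion ξ i j := by
  rw [Coeffs.polyCompanion, companion_eq_companionMatrix, companionMatrix, companionMatrix,
    Matrix.of_apply, Matrix.of_apply]
  split_ifs <;> simp

end Adjoint

/-! ### The Green operators on Schwartz functions -/

section Correlation

open FourierTransform Set

/-- The function `z ↦ ∫ φ(z + y) γ(dy)`. -/
def correlation (γ : SignedMeasure (Space d)) (φ : 𝓢(Space d, ℝ)) (z : Space d) : ℝ :=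
  (∫ y, φ (z + y) ∂γ.toJordanDecomposition.posPart) -
    ∫ y, φ (z + y) ∂γ.toJordanDecomposition.negPart

theorem schwartz_eq_integral_realFourier (φ : 𝓢(Space d, ℝ)) (x : Space d) :
    (φ x : ℂ) = ∫ η, Complex.exp ((2 * Real.pi * inner ℝ η x : ℝ) * Complex.I) *
      realFourier φ η := by
  have h : 𝓕⁻ (realFourier φ) = complexify d φ := by simp [realFourier]
  rw [← complexify_apply, ← h, SchwartzMap.fourierInv_coe, Real.fourierInv_eq']
  rfl

theorem integral_translate_eq (φ : 𝓢(Space d, ℝ)) (μ : Measure (Space d)) [IsFiniteMeasure μ]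
    (z : Space d) :
    ((∫ y, φ (z + y) ∂μ : ℝ) : ℂ) =
      ∫ η, Complex.exp ((2 * Real.pi * inner ℝ η z : ℝ) * Complex.I) * realFourier φ η *
        charFun μ (-(-(2 * Real.pi) • η)) := by
  rw [← integral_complex_ofReal]
  simp_rw [schwartz_eq_integral_realFourier]
  rw [integral_integral_swap]
  · refine integral_congr_ae (Filter.Eventually.of_forall fun η => ?_)
    simp only [charFun_apply]
    rw [← integral_const_mul]
    refine integral_congr_ae (Filter.Eventually.of_forall fun y => ?_)
    have h : ((2 * Real.pi * inner ℝ η (z + y) : ℝ) : ℂ) * Complex.I =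
        ((2 * Real.pi * inner ℝ η z : ℝ) : ℂ) * Complex.I +
          ((inner ℝ y (-(-(2 * Real.pi) • η)) : ℝ) : ℂ) * Complex.I := by
      rw [neg_smul, neg_neg, inner_smul_right, inner_add_right, real_inner_comm η y]
      push_cast
      ring
    beta_reduce
    rw [h, Complex.exp_add]
    ring
  · have h1 : Integrable (fun z : Space d × Space d => realFourier φ z.2) (μ.prod volume) :=
      (realFourier φ).integrable.comp_snd μ
    refine h1.norm.mono' ?_ (Filter.Eventually.of_forall fun z => ?_)
    · refine Continuous.aestronglyMeasurable ?_
      simp only [Function.uncurry_def]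
      have := (realFourier φ).continuous
      fun_prop
    · simp only [Function.uncurry]
      rw [norm_mul, Complex.norm_exp_ofReal_mul_I, one_mul]

theorem integrable_exp_mul_realFourier_mul (φ : 𝓢(Space d, ℝ)) (z : Space d)
    {m : Space d → ℂ} (hm : Continuous m) {K : ℝ} (hK : ∀ η, ‖m η‖ ≤ K) :
    Integrable fun η => Complex.exp ((2 * Real.pi * inner ℝ η z : ℝ) * Complex.I) *
      realFourier φ η * m η := by
  refine ((realFourier φ).integrable.norm.mul_const K).mono' ?_
    (Filter.Eventually.of_forall fun η => ?_)
  · refine Continuous.aestronglyMeasurable ?_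
    have := (realFourier φ).continuous
    fun_prop
  · rw [norm_mul, norm_mul, Complex.norm_exp_ofReal_mul_I, one_mul]
    gcongr
    exact hK η

theorem norm_stieltjes_le (γ : SignedMeasure (Space d)) (ξ : Space d) :
    ‖stieltjes γ ξ‖ ≤ totalMass γ :=
  (norm_sub_le _ _).trans (add_le_add (norm_charFun_le _) (norm_charFun_le _))

/-- By Fourier inversion and Fubini, averaging the translates of `φ` multiplies `realFourier φ` by
the transform of `γ`, taken at the same point `-2πη` as the symbol in `realFourier_adjointOp`. -/
theorem correlation_eq_integral (γ : SignedMeasure (Space d)) (φ : 𝓢(Space d, ℝ)) (z : Space d) :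
    (correlation γ φ z : ℂ) =
      ∫ η, Complex.exp ((2 * Real.pi * inner ℝ η z : ℝ) * Complex.I) * realFourier φ η *
        stieltjes γ (-(2 * Real.pi) • η) := by
  have h : ∀ μ : Measure (Space d), [IsFiniteMeasure μ] →
      Integrable fun η => Complex.exp ((2 * Real.pi * inner ℝ η z : ℝ) * Complex.I) *
        realFourier φ η * charFun μ (-(-(2 * Real.pi) • η)) := fun μ _ =>
    integrable_exp_mul_realFourier_mul φ z (continuous_charFun.comp (by fun_prop))
      fun η => norm_charFun_le _
  rw [correlation, Complex.ofReal_sub, integral_translate_eq, integral_translate_eq,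
    ← integral_sub (h _) (h _)]
  refine integral_congr_ae (Filter.Eventually.of_forall fun η => ?_)
  simp only [stieltjes, mul_sub]

variable {c : Coeffs d} {T : EReal} {g : Fin c.N → ℝ → SignedMeasure (Space d)}

/-- `e^{0·B}` is the identity, whose first row is `e_1`: the first Green measure starts as the Dirac
mass at `0` and the others start at zero. -/
theorem correlation_zero (hT : 0 < T) (h_tempered : TemperedHat c T) (hg : GreenMeasures c T g)
    (n : Fin c.N) (φ : 𝓢(Space d, ℝ)) (z : Space d) :
    correlation (g n 0) φ z = if n = c.first then φ z else 0 := by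
  have h := correlation_eq_integral (g n 0) φ z
  simp_rw [← propagator_eq_stieltjes h_tempered hg (zero_mem_timeInterval hT),
    Coeffs.propagator_zero, Matrix.one_apply] at h
  split_ifs at h ⊢ with h1 h2 h2
  · simp_rw [mul_one] at h
    rw [← schwartz_eq_integral_realFourier] at h
    exact_mod_cast h
  · exact absurd h1.symm h2
  · exact absurd h2.symm h1
  · simpa using h

/-- The evolution equation of the Green operators on Schwartz functions, in integrated form. -/
theorem correlation_eq_add_integral (hT : 0 < T) (h_tempered : TemperedHat c T)
    (hg : GreenMeasures c T g) {t : ℝ} (ht : t ∈ timeInterval T) (n : Fin c.N)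
    (φ : 𝓢(Space d, ℝ)) (z : Space d) :
    correlation (g n t) φ z = correlation (g n 0) φ z +
      ∫ r in (0 : ℝ)..t, ∑ k, correlation (g k r) (c.act (c.polyCompanion k n) φ) z := by
  have hsub := Icc_subset_timeInterval ht
  obtain ⟨K, hK⟩ := exists_totalMass_le hT h_tempered hg t
  -- The mass bound controls the first row of the propagator uniformly in time and frequency,
  -- although `B(ξ)` is unbounded. This makes the integrands below integrable.
  have hyb : ∀ r ∈ Icc 0 t, ∀ k ξ, ‖c.propagator r ξ c.first k‖ ≤ K := fun r hr k ξ => by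
    rw [propagator_eq_stieltjes h_tempered hg (hsub hr)]
    exact (norm_stieltjes_le _ _).trans (hK r (hsub hr) hr.2 k)
  have hcont : ∀ k, Continuous fun w : ℝ × Space d => c.propagator w.1 w.2 c.first k :=
    fun k => c.continuous_propagator_apply c.first k
  set e : Space d → ℂ := fun η => Complex.exp ((2 * Real.pi * inner ℝ η z : ℝ) * Complex.I) with he
  have he_cont : Continuous e := by rw [he]; fun_prop
  have hft : ∀ ξ, c.propagator t ξ c.first n - c.propagator 0 ξ c.first n =
      ∫ r in (0 : ℝ)..t, ∑ k, c.propagator r ξ c.first k * c.companion ξ k n := by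
    intro ξ
    rw [← intervalIntegral.integral_eq_sub_of_hasDerivAt
      (fun r _ => c.hasDerivAt_propagator r ξ c.first n)]
    · rfl
    · refine Continuous.intervalIntegrable ?_ _ _
      simp only [Matrix.mul_apply]
      exact continuous_finsetSum _ fun k _ =>
        ((hcont k).comp (continuous_id.prodMk continuous_const)).mul continuous_const
  have hrepr : ∀ r ∈ Icc 0 t, ∀ k ψ, (correlation (g k r) ψ z : ℂ) =
      ∫ η, e η * realFourier ψ η * c.propagator r (-(2 * Real.pi) • η) c.first k := by
    intro r hr k ψ
    rw [correlation_eq_integral]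
    simp_rw [propagator_eq_stieltjes h_tempered hg (hsub hr)]
    rfl
  have hint : ∀ r ∈ Icc 0 t, ∀ k (ψ : 𝓢(Space d, ℝ)), Integrable fun η =>
      e η * realFourier ψ η * c.propagator r (-(2 * Real.pi) • η) c.first k := fun r hr k ψ =>
    integrable_exp_mul_realFourier_mul ψ z
      ((hcont k).comp (f := fun η => (r, -(2 * Real.pi) • η)) (by fun_prop))
      fun η => hyb r hr k _
  -- The entries of `B` are polynomials in the symbol, so as multipliers they are absorbed into the
  -- test function.
  have hF : ∀ k η, realFourier (c.act (c.polyCompanion k n) φ) η =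
      c.companion (-(2 * Real.pi) • η) k n * realFourier φ η := fun k η => by
    rw [realFourier_act, eval₂_polyCompanion]
  have h0 : (0 : ℝ) ∈ Icc 0 t := ⟨le_rfl, ht.1⟩
  have ht' : t ∈ Icc 0 t := ⟨ht.1, le_rfl⟩
  rw [← sub_eq_iff_eq_add']
  apply Complex.ofReal_injective
  rw [Complex.ofReal_sub, hrepr t ht', hrepr 0 h0, ← integral_sub (hint t ht' n φ) (hint 0 h0 n φ),
    ← intervalIntegral.integral_ofReal]
  have hswap : ∫ r in (0 : ℝ)..t, ∫ η, ∑ k, e η * realFourier (c.act (c.polyCompanion k n) φ) η *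
        c.propagator r (-(2 * Real.pi) • η) c.first k =
      ∫ η, ∫ r in (0 : ℝ)..t, ∑ k, e η * realFourier (c.act (c.polyCompanion k n) φ) η *
        c.propagator r (-(2 * Real.pi) • η) c.first k := by
    refine intervalIntegral_integral_swap ?_
    simp only [Function.uncurry_def]
    refine integrable_finsetSum _ fun k _ => ?_
    have : IsFiniteMeasure (volume.restrict (uIoc 0 t)) := by
      rw [uIoc_of_le ht.1]
      infer_instance
    have h1 : Integrable (fun w : ℝ × Space d =>
        ‖realFourier (c.act (c.polyCompanion k n) φ) w.2‖ * K)
        ((volume.restrict (uIoc 0 t)).prod volume) :=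
      ((realFourier (c.act (c.polyCompanion k n) φ)).integrable.norm.mul_const K).comp_snd _
    refine h1.mono' ?_ ?_
    · refine Continuous.aestronglyMeasurable ?_
      have h2 := (realFourier (c.act (c.polyCompanion k n) φ)).continuous
      have h3 := (hcont k).comp (f := fun w : ℝ × Space d => (w.1, -(2 * Real.pi) • w.2))
        (by fun_prop)
      exact ((he_cont.comp continuous_snd).mul (h2.comp continuous_snd)).mul h3
    · rw [uIoc_of_le ht.1]
      have : ∀ᵐ w ∂((volume.restrict (Ioc 0 t)).prod (volume : Measure (Space d))),
          w.1 ∈ Ioc 0 t :=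
        (Measure.quasiMeasurePreserving_fst).ae (ae_restrict_mem measurableSet_Ioc)
      filter_upwards [this] with w hw
      rw [norm_mul, norm_mul, he, Complex.norm_exp_ofReal_mul_I, one_mul]
      gcongr
      exact hyb w.1 ⟨hw.1.le, hw.2⟩ k _
  have hinner : ∫ r in (0 : ℝ)..t,
      ((∑ k, correlation (g k r) (c.act (c.polyCompanion k n) φ) z : ℝ) : ℂ) =
      ∫ r in (0 : ℝ)..t, ∫ η, ∑ k, e η * realFourier (c.act (c.polyCompanion k n) φ) η *
        c.propagator r (-(2 * Real.pi) • η) c.first k := by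
    refine intervalIntegral.integral_congr fun r hr => ?_
    rw [uIcc_of_le ht.1] at hr
    rw [integral_finsetSum _ fun k _ => hint r hr k _, Complex.ofReal_sum]
    exact Finset.sum_congr rfl fun k _ => hrepr r hr k _
  rw [hinner, hswap]
  refine integral_congr_ae (Filter.Eventually.of_forall fun η => ?_)
  simp only [hF]
  rw [← mul_sub, hft, ← intervalIntegral.integral_const_mul]
  refine intervalIntegral.integral_congr fun r _ => ?_
  simp only [Finset.mul_sum]
  refine Finset.sum_congr rfl fun k _ => ?_
  ring

end Correlation

/-! ### Pairings with Schwartz functions -/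

section Pairing

open Set Filter Topology

theorem integrable_bounded_mul_schwartz {f : Space d → ℝ} (hf : Continuous f) {C : ℝ}
    (hC : ∀ x, |f x| ≤ C) (φ : 𝓢(Space d, ℝ)) : Integrable fun x => f x * φ x :=
  φ.integrable.bdd_mul hf.aestronglyMeasurable (Eventually.of_forall hC)

theorem integrable_prod_translate (μ : Measure (Space d)) [IsFiniteMeasure μ]
    (φ : 𝓢(Space d, ℝ)) {f : Space d → ℝ} (hf : Continuous f) {C : ℝ} (hC : ∀ x, |f x| ≤ C) :
    Integrable (fun w : Space d × Space d => f w.2 * φ (w.2 + w.1)) (μ.prod volume) := by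
  have h1 : Integrable (fun w : Space d × Space d => f (w.2 - w.1) * φ w.2) (μ.prod volume) :=
    (φ.integrable.comp_snd μ).bdd_mul (by fun_prop) (Eventually.of_forall fun w => hC _)
  -- The shear `(y, x) ↦ (y, y + x)` preserves the product with Lebesgue measure.
  have h2 := (measurePreserving_prod_add μ (volume : Measure (Space d))).integrable_comp_of_integrable
    h1
  refine h2.congr (Eventually.of_forall fun w => ?_)
  simp [add_comm]

theorem integral_convolution_mul (μ : Measure (Space d)) [IsFiniteMeasure μ]
    (φ : 𝓢(Space d, ℝ)) {f : Space d → ℝ} (hf : Continuous f) {C : ℝ} (hC : ∀ x, |f x| ≤ C) :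
    Integrable (fun x => (∫ y, f (x - y) ∂μ) * φ x) ∧
    Integrable (fun z => f z * ∫ y, φ (z + y) ∂μ) ∧
    ∫ x, (∫ y, f (x - y) ∂μ) * φ x = ∫ z, f z * ∫ y, φ (z + y) ∂μ := by
  have h1 : Integrable (fun w : Space d × Space d => f (w.2 - w.1) * φ w.2) (μ.prod volume) :=
    (φ.integrable.comp_snd μ).bdd_mul (by fun_prop) (Eventually.of_forall fun w => hC _)
  have h2 := integrable_prod_translate μ φ hf hC
  refine ⟨?_, ?_, ?_⟩
  · simpa only [integral_mul_const] using h1.integral_prod_right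
  · simpa only [integral_const_mul] using h2.integral_prod_right
  · simp_rw [← integral_mul_const, ← integral_const_mul]
    rw [integral_integral_swap (f := fun x y => f (x - y) * φ x) h1.swap,
      integral_integral_swap (f := fun z y => f z * φ (z + y)) h2.swap]
    refine integral_congr_ae (Eventually.of_forall fun y => ?_)
    have := integral_sub_right_eq_self (μ := (volume : Measure (Space d)))
      (fun z => f z * φ (z + y)) y
    simpa using this

theorem integrable_translate_integral (μ : Measure (Space d)) [IsFiniteMeasure μ]
    (φ : 𝓢(Space d, ℝ)) : Integrable (fun z => ∫ y, φ (z + y) ∂μ) ∧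
      ∫ z, |∫ y, φ (z + y) ∂μ| ≤ μ.real univ * ∫ x, |φ x| := by
  have h2 := integrable_prod_translate μ φ (f := fun _ => 1) continuous_const (C := 1) (by simp)
  simp only [one_mul] at h2
  refine ⟨h2.integral_prod_right, ?_⟩
  calc ∫ z, |∫ y, φ (z + y) ∂μ| ≤ ∫ z, ∫ y, |φ (z + y)| ∂μ :=
        integral_mono h2.integral_prod_right.abs h2.abs.integral_prod_right fun z =>
          abs_integral_le_integral_abs
    _ = ∫ y, (∫ z, |φ (z + y)|) ∂μ :=
        integral_integral_swap (f := fun z y => |φ (z + y)|) h2.abs.swap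
    _ = ∫ _, (∫ x, |φ x|) ∂μ := by
        refine integral_congr_ae (Eventually.of_forall fun y => ?_)
        exact integral_add_right_eq_self (μ := (volume : Measure (Space d))) (fun z => |φ z|) y
    _ = μ.real univ * ∫ x, |φ x| := by simp

theorem integral_conv_mul (γ : SignedMeasure (Space d)) (φ : 𝓢(Space d, ℝ)) {f : Space d → ℝ}
    (hf : Continuous f) {C : ℝ} (hC : ∀ x, |f x| ≤ C) :
    ∫ x, conv γ f x * φ x = ∫ z, f z * correlation γ φ z := by
  obtain ⟨h1, h2, h3⟩ := integral_convolution_mul γ.toJordanDecomposition.posPart φ hf hC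
  obtain ⟨h1', h2', h3'⟩ := integral_convolution_mul γ.toJordanDecomposition.negPart φ hf hC
  simp only [conv, correlation, sub_mul, mul_sub]
  rw [integral_sub h1 h1', integral_sub h2 h2', h3, h3']

theorem integrable_correlation (γ : SignedMeasure (Space d)) (φ : 𝓢(Space d, ℝ)) :
    Integrable (correlation γ φ) :=
  (integrable_translate_integral _ φ).1.sub (integrable_translate_integral _ φ).1

theorem integral_abs_correlation_le (γ : SignedMeasure (Space d)) (φ : 𝓢(Space d, ℝ)) :
    ∫ z, |correlation γ φ z| ≤ totalMass γ * ∫ x, |φ x| := by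
  obtain ⟨h1, h2⟩ := integrable_translate_integral γ.toJordanDecomposition.posPart φ
  obtain ⟨h1', h2'⟩ := integrable_translate_integral γ.toJordanDecomposition.negPart φ
  rw [totalMass, add_mul]
  refine le_trans ?_ (add_le_add h2 h2')
  rw [← integral_add h1.abs h1'.abs]
  exact integral_mono (integrable_correlation γ φ).abs (h1.abs.add h1'.abs) fun z => abs_sub _ _

theorem correlation_eq_conv (γ : SignedMeasure (Space d)) (φ : 𝓢(Space d, ℝ)) (z : Space d) :
    correlation γ φ z = conv γ (fun w => φ (-w)) (-z) := by
  simp only [correlation, conv]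
  congr 2 <;> · funext y; congr 1; abel

theorem continuousOn_correlation {c : Coeffs d} {T : EReal}
    {g : Fin c.N → ℝ → SignedMeasure (Space d)} (hg : GreenMeasures c T g) (n : Fin c.N)
    (φ : 𝓢(Space d, ℝ)) : ContinuousOn (fun w : ℝ × Space d => correlation (g n w.1) φ w.2)
      (timeInterval T ×ˢ univ) := by
  let φ' : Space d →ᵇ ℝ :=
    (SchwartzMap.toBoundedContinuousFunction φ).compContinuous ⟨fun w => -w, continuous_neg⟩
  have h : ContinuousOn (fun w : ℝ × Space d => conv (g n w.1) φ' (-w.2))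
      (timeInterval T ×ˢ univ) :=
    (hg.continuous_conv n φ').comp (f := fun w : ℝ × Space d => (w.1, -w.2))
      (by fun_prop) fun w hw => ⟨hw.1, mem_univ _⟩
  exact h.congr fun w _ => correlation_eq_conv (g n w.1) φ w.2

/-! ### Continuous functions bounded on bounded time spans, and their pairings -/

section BoundedContinuous

variable {T : EReal} {u : ℝ → Space d → ℝ}

theorem IsBoundedContinuous.continuous (hu : IsBoundedContinuous T u) {t : ℝ}
    (ht : t ∈ timeInterval T) : Continuous (u t) := by
  rw [← continuousOn_univ]
  exact hu.continuousOn.comp (f := fun x => (t, x)) (by fun_prop) fun x _ => ⟨ht, mem_univ _⟩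

theorem IsBoundedContinuous.integrable_mul (hu : IsBoundedContinuous T u) {t : ℝ}
    (ht : t ∈ timeInterval T) (φ : 𝓢(Space d, ℝ)) : Integrable fun x => u t x * φ x := by
  obtain ⟨C, hC⟩ := hu.bounded t
  exact integrable_bounded_mul_schwartz (hu.continuous ht) (hC t ht le_rfl) φ

theorem IsBoundedContinuous.continuousOn_pairing (hu : IsBoundedContinuous T u)
    (φ : 𝓢(Space d, ℝ)) : ContinuousOn (pairing u φ) (timeInterval T) := by
  intro t ht
  obtain ⟨C, hC⟩ := hu.bounded (t + 1)
  have hlt : ∀ᶠ s in 𝓝[timeInterval T] t, s ∈ timeInterval T ∧ s ≤ t + 1 :=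
    eventually_mem_nhdsWithin.and
      (mem_nhdsWithin_of_mem_nhds (Iic_mem_nhds (lt_add_one t)))
  refine continuousWithinAt_of_dominated (bound := fun x => C * |φ x|) ?_ ?_ ?_ ?_
  · filter_upwards [hlt] with s hs
    exact (hu.integrable_mul hs.1 φ).aestronglyMeasurable
  · filter_upwards [hlt] with s hs
    refine Eventually.of_forall fun x => ?_
    rw [norm_mul, Real.norm_eq_abs, Real.norm_eq_abs]
    gcongr
    exact hC s hs.1 hs.2 x
  · exact φ.integrable.abs.const_mul C
  · refine Eventually.of_forall fun x => ?_
    refine ContinuousWithinAt.mul ?_ continuousWithinAt_const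
    exact (hu.continuousOn (t, x) ⟨ht, mem_univ _⟩).comp (f := fun s => (s, x))
      (by fun_prop) fun s hs => ⟨hs, mem_univ _⟩

theorem IsBoundedContinuous.abs_pairing_le {S C : ℝ}
    (hC : ∀ t ∈ timeInterval T, t ≤ S → ∀ x, |u t x| ≤ C) (φ : 𝓢(Space d, ℝ)) {t : ℝ}
    (ht : t ∈ timeInterval T) (htS : t ≤ S) : |pairing u φ t| ≤ C * ∫ x, |φ x| := by
  have h : ∀ x, ‖u t x * φ x‖ ≤ C * |φ x| := fun x => by
    rw [norm_mul, Real.norm_eq_abs, Real.norm_eq_abs]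
    gcongr
    exact hC t ht htS x
  rw [← integral_const_mul]
  exact norm_integral_le_of_norm_le (φ.integrable.abs.const_mul C) (Eventually.of_forall h)

theorem IsBoundedContinuous.add {v : ℝ → Space d → ℝ} (hu : IsBoundedContinuous T u)
    (hv : IsBoundedContinuous T v) : IsBoundedContinuous T fun t x => u t x + v t x where
  continuousOn := hu.continuousOn.add hv.continuousOn
  bounded S := by
    obtain ⟨C, hC⟩ := hu.bounded S
    obtain ⟨C', hC'⟩ := hv.bounded S
    exact ⟨C + C', fun t ht hS x =>
      (abs_add_le _ _).trans (add_le_add (hC t ht hS x) (hC' t ht hS x))⟩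

theorem IsBoundedContinuous.const_mul (hu : IsBoundedContinuous T u) (r : ℝ) :
    IsBoundedContinuous T fun t x => r * u t x where
  continuousOn := continuousOn_const.mul hu.continuousOn
  bounded S := by
    obtain ⟨C, hC⟩ := hu.bounded S
    refine ⟨|r| * C, fun t ht hS x => ?_⟩
    rw [abs_mul]
    gcongr
    exact hC t ht hS x

theorem IsBoundedContinuous.zero : IsBoundedContinuous T fun _ (_ : Space d) => (0 : ℝ) where
  continuousOn := continuousOn_const
  bounded S := ⟨0, by simp⟩

theorem IsBoundedContinuous.sum {ι : Type*} (s : Finset ι) {w : ι → ℝ → Space d → ℝ}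
    (hw : ∀ i, IsBoundedContinuous T (w i)) :
    IsBoundedContinuous T fun t x => ∑ i ∈ s, w i t x := by
  classical
  induction s using Finset.induction_on with
  | empty => simpa using IsBoundedContinuous.zero
  | insert i s hi ih =>
    simp only [Finset.sum_insert hi]
    exact (hw i).add ih

theorem pairing_add {v : ℝ → Space d → ℝ} (hu : IsBoundedContinuous T u)
    (hv : IsBoundedContinuous T v) (φ : 𝓢(Space d, ℝ)) {t : ℝ} (ht : t ∈ timeInterval T) :
    pairing (fun t x => u t x + v t x) φ t = pairing u φ t + pairing v φ t := by
  simp only [pairing, add_mul]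
  exact integral_add (hu.integrable_mul ht φ) (hv.integrable_mul ht φ)

theorem pairing_const_mul (r : ℝ) (φ : 𝓢(Space d, ℝ)) (t : ℝ) :
    pairing (fun t x => r * u t x) φ t = r * pairing u φ t := by
  simp only [pairing, mul_assoc, integral_const_mul]

theorem pairing_sum {ι : Type*} (s : Finset ι) {w : ι → ℝ → Space d → ℝ}
    (hw : ∀ i, IsBoundedContinuous T (w i)) (φ : 𝓢(Space d, ℝ)) {t : ℝ}
    (ht : t ∈ timeInterval T) :
    pairing (fun t x => ∑ i ∈ s, w i t x) φ t = ∑ i ∈ s, pairing (w i) φ t := by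
  simp only [pairing, Finset.sum_mul]
  exact integral_finsetSum _ fun i _ => (hw i).integrable_mul ht φ

/-- The pairing at a fixed time as a linear functional. -/
def IsBoundedContinuous.pairingLM (hu : IsBoundedContinuous T u) {t : ℝ}
    (ht : t ∈ timeInterval T) : 𝓢(Space d, ℝ) →ₗ[ℝ] ℝ where
  toFun φ := pairing u φ t
  map_add' φ ψ := by
    simp only [pairing, add_apply, mul_add]
    exact integral_add (hu.integrable_mul ht φ) (hu.integrable_mul ht ψ)
  map_smul' r φ := by
    simp only [pairing, smul_apply, smul_eq_mul, RingHom.id_apply, ← integral_const_mul]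
    congr 1
    funext x
    ring

end BoundedContinuous

variable {c : Coeffs d} {T : EReal} {g : Fin c.N → ℝ → SignedMeasure (Space d)}

/-- Continuity is part of the assumptions on `g`; boundedness up to a finite `T` rests on
`exists_totalMass_le`. -/
theorem isBoundedContinuous_conv (hT : 0 < T) (h_tempered : TemperedHat c T)
    (hg : GreenMeasures c T g) (n : Fin c.N) {f : Space d → ℝ} (hf : Continuous f) {C : ℝ}
    (hC : ∀ x, |f x| ≤ C) : IsBoundedContinuous T fun t x => conv (g n t) f x where
  continuousOn := hg.continuous_conv n (BoundedContinuousFunction.ofNormedAddCommGroup f hf C hC)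
  bounded S := by
    obtain ⟨K, hK⟩ := exists_totalMass_le hT h_tempered hg S
    have hC0 : 0 ≤ C := (abs_nonneg _).trans (hC 0)
    refine ⟨C * K, fun t ht hS x => (abs_conv_le _ hC x).trans ?_⟩
    gcongr
    exact hK t ht hS n

/-- The evolution equation of the pairings with the convolutions, in integrated form. -/
theorem pairing_conv_eq_add_integral (hT : 0 < T) (h_tempered : TemperedHat c T)
    (hg : GreenMeasures c T g) {f : Space d → ℝ} (hf : Continuous f) {C : ℝ}
    (hC : ∀ x, |f x| ≤ C) (n : Fin c.N) (φ : 𝓢(Space d, ℝ)) {t : ℝ} (ht : t ∈ timeInterval T) :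
    pairing (fun t x => conv (g n t) f x) φ t = (if n = c.first then ∫ x, f x * φ x else 0) +
      ∫ r in (0 : ℝ)..t, ∑ k,
        pairing (fun t x => conv (g k t) f x) (c.act (c.polyCompanion k n) φ) r := by
  obtain ⟨K, hK⟩ := exists_totalMass_le hT h_tempered hg t
  have hsub := Icc_subset_timeInterval ht
  have hC0 : 0 ≤ C := (abs_nonneg _).trans (hC 0)
  have hae : ∀ᵐ w ∂((volume.restrict (uIoc 0 t)).prod (volume : Measure (Space d))),
      w.1 ∈ Ioc 0 t := by
    rw [uIoc_of_le ht.1]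
    exact (Measure.quasiMeasurePreserving_fst).ae (ae_restrict_mem measurableSet_Ioc)
  -- Joint integrability for Fubini: measurability comes from joint continuity, and the spatial `L¹`
  -- norm is at most `C K ‖ψ‖₁` for every `r`.
  have hint : ∀ k (ψ : 𝓢(Space d, ℝ)), Integrable (fun w : ℝ × Space d =>
      f w.2 * correlation (g k w.1) ψ w.2) ((volume.restrict (uIoc 0 t)).prod volume) := by
    intro k ψ
    have hmeas : AEStronglyMeasurable (fun w : ℝ × Space d =>
        f w.2 * correlation (g k w.1) ψ w.2) ((volume.restrict (uIoc 0 t)).prod volume) := by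
      have h1 : ContinuousOn (fun w : ℝ × Space d => f w.2 * correlation (g k w.1) ψ w.2)
          (Ioc 0 t ×ˢ univ) :=
        (hf.comp continuous_snd).continuousOn.mul ((continuousOn_correlation hg k ψ).mono
          (prod_mono_left (Ioc_subset_Icc_self.trans hsub)))
      have h2 := h1.aestronglyMeasurable (μ := (volume : Measure (ℝ × Space d)))
        (measurableSet_Ioc.prod MeasurableSet.univ)
      rwa [Measure.volume_eq_prod, ← Measure.prod_restrict, Measure.restrict_univ,
        ← uIoc_of_le ht.1] at h2
    rw [integrable_prod_iff hmeas]
    have hbd : ∀ r ∈ Ioc 0 t, ∫ z, ‖f z * correlation (g k r) ψ z‖ ≤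
        C * (K * ∫ x, |ψ x|) := fun r hr => by
      have hr' : r ∈ timeInterval T := hsub (Ioc_subset_Icc_self hr)
      calc ∫ z, ‖f z * correlation (g k r) ψ z‖
          ≤ ∫ z, C * |correlation (g k r) ψ z| := by
            refine integral_mono_of_nonneg (Eventually.of_forall fun z => norm_nonneg _)
              ((integrable_correlation _ ψ).abs.const_mul C) (Eventually.of_forall fun z => ?_)
            simp only [norm_mul, Real.norm_eq_abs]
            gcongr
            exact hC z
        _ ≤ C * (K * ∫ x, |ψ x|) := by
            rw [integral_const_mul]
            gcongr
            refine (integral_abs_correlation_le _ ψ).trans ?_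
            gcongr
            exact hK r hr' hr.2 k
    rw [uIoc_of_le ht.1] at hmeas ⊢
    refine ⟨Eventually.of_forall fun r => (integrable_correlation (g k r) ψ).bdd_mul
      hf.aestronglyMeasurable (Eventually.of_forall hC), ?_⟩
    refine Integrable.of_bound hmeas.norm.integral_prod_right' (C * (K * ∫ x, |ψ x|)) ?_
    filter_upwards [ae_restrict_mem measurableSet_Ioc] with r hr
    rw [Real.norm_of_nonneg (integral_nonneg fun z => norm_nonneg _)]
    exact hbd r hr
  have hpair : ∀ k ψ r, pairing (fun t x => conv (g k t) f x) ψ r =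
      ∫ z, f z * correlation (g k r) ψ z := fun k ψ r => integral_conv_mul (g k r) ψ hf hC
  have h0 : ∫ z, f z * correlation (g n 0) φ z = if n = c.first then ∫ x, f x * φ x else 0 := by
    simp_rw [correlation_zero hT h_tempered hg]
    split_ifs <;> simp
  have hfint : ∀ r k ψ, Integrable fun z => f z * correlation (g k r) ψ z := fun r k ψ =>
    (integrable_correlation (g k r) ψ).bdd_mul hf.aestronglyMeasurable (Eventually.of_forall hC)
  simp only [hpair]
  rw [← h0, ← sub_eq_iff_eq_add', ← integral_sub (hfint _ _ _) (hfint _ _ _)]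
  have h1 : ∀ r, ∑ k, ∫ z, f z * correlation (g k r) (c.act (c.polyCompanion k n) φ) z =
      ∫ z, ∑ k, f z * correlation (g k r) (c.act (c.polyCompanion k n) φ) z := fun r =>
    (integral_finsetSum _ fun k _ => hfint r k _).symm
  simp only [h1]
  rw [intervalIntegral_integral_swap]
  · refine integral_congr_ae (Eventually.of_forall fun z => ?_)
    simp only [← Finset.mul_sum, intervalIntegral.integral_const_mul]
    rw [correlation_eq_add_integral hT h_tempered hg ht n φ z]
    ring
  · exact integrable_finsetSum _ fun k _ => hint k _

end Pairing

/-! ### Convolution in time -/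

section TimeConvolution

open Set Filter Topology

theorem intervalIntegral_ite_lt_right {t τ : ℝ} (hτ : 0 ≤ τ) (hτt : τ ≤ t) (h : ℝ → ℝ) :
    ∫ ρ in (0 : ℝ)..t, (if τ < ρ then h ρ else 0) = ∫ ρ in τ..t, h ρ := by
  rw [intervalIntegral.integral_of_le (hτ.trans hτt), intervalIntegral.integral_of_le hτt]
  have h1 : (fun ρ => if τ < ρ then h ρ else 0) = (Ioi τ).indicator h := by
    funext ρ
    simp [indicator_apply]
  rw [h1, setIntegral_indicator measurableSet_Ioi]
  congr 2
  ext ρ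
  simp only [mem_inter_iff, mem_Ioc, mem_Ioi]
  exact ⟨fun h => ⟨h.2, h.1.2⟩, fun h => ⟨⟨hτ.trans_lt h.1, h.2⟩, h.1⟩⟩

theorem intervalIntegral_ite_lt_left {t ρ : ℝ} (hρ : 0 ≤ ρ) (hρt : ρ ≤ t) (h : ℝ → ℝ) :
    ∫ τ in (0 : ℝ)..t, (if τ < ρ then h τ else 0) = ∫ τ in (0 : ℝ)..ρ, h τ := by
  rw [intervalIntegral.integral_of_le (hρ.trans hρt), intervalIntegral.integral_of_le hρ,
    integral_Ioc_eq_integral_Ioo (x := (0 : ℝ)) (y := ρ)]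
  have h1 : (fun τ => if τ < ρ then h τ else 0) = (Iio ρ).indicator h := by
    funext τ
    simp [indicator_apply]
  rw [h1, setIntegral_indicator measurableSet_Iio]
  congr 2
  ext τ
  simp only [mem_inter_iff, mem_Ioc, mem_Iio, mem_Ioo]
  exact ⟨fun h => ⟨h.1.1, h.2⟩, fun h => ⟨⟨h.1, h.2.le.trans hρt⟩, h.2⟩⟩

/-- If `K(τ, ·)` is a primitive of `L(τ, ·)` then `t ↦ ∫_0^t K(t - s, s) ds` is a primitive of
`K(t, 0) + ∫_0^t L(t - s, s) ds`. -/
theorem integral_timeConvolution {K L : ℝ → ℝ → ℝ} {K₀ : ℝ → ℝ} {t C : ℝ} (ht : 0 ≤ t)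
    (hL : Measurable (Function.uncurry L))
    (hC : ∀ τ ∈ Icc 0 t, ∀ s ∈ Icc 0 t, |L τ s| ≤ C)
    (hK : ∀ τ ∈ Icc 0 t, ∀ s ∈ Icc 0 t, K τ s = K₀ τ + ∫ r in (0 : ℝ)..s, L τ r)
    (hK₀ : IntervalIntegrable K₀ volume 0 t) :
    ∫ s in (0 : ℝ)..t, K (t - s) s =
      (∫ τ in (0 : ℝ)..t, K₀ τ) + ∫ ρ in (0 : ℝ)..t, ∫ s in (0 : ℝ)..ρ, L (ρ - s) s := by
  -- In the variables `τ` and `ρ = τ + r` the domain is the triangle `τ < ρ ≤ t`; extension by zero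
  -- makes it a square, on which Fubini exchanges the integrals.
  set J : ℝ → ℝ → ℝ := fun τ ρ => if τ < ρ then L τ (ρ - τ) else 0 with hJ
  have hJm : Measurable (Function.uncurry J) := by
    refine Measurable.ite (measurableSet_lt measurable_fst measurable_snd) ?_ measurable_const
    exact hL.comp (measurable_fst.prodMk (measurable_snd.sub measurable_fst))
  have hC0 : 0 ≤ C := (abs_nonneg _).trans (hC 0 ⟨le_rfl, ht⟩ 0 ⟨le_rfl, ht⟩)
  have hJb : ∀ τ ∈ Ioc 0 t, ∀ ρ ∈ Ioc 0 t, |J τ ρ| ≤ C := by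
    intro τ hτ ρ hρ
    simp only [hJ]
    split_ifs with h
    · exact hC τ (Ioc_subset_Icc_self hτ) _ ⟨by linarith, by linarith [hρ.2, hτ.1]⟩
    · simpa using hC0
  have hJint : Integrable (Function.uncurry J)
      ((volume.restrict (uIoc 0 t)).prod (volume.restrict (uIoc 0 t))) := by
    rw [uIoc_of_le ht]
    refine Integrable.of_bound hJm.aestronglyMeasurable C ?_
    rw [Measure.prod_restrict]
    filter_upwards [ae_restrict_mem (measurableSet_Ioc.prod measurableSet_Ioc)] with w hw
    exact hJb w.1 hw.1 w.2 hw.2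
  have h1 : ∫ s in (0 : ℝ)..t, K (t - s) s = ∫ τ in (0 : ℝ)..t, K τ (t - τ) := by
    have := intervalIntegral.integral_comp_sub_left (a := 0) (b := t)
      (fun τ => K τ (t - τ)) t
    simpa using this
  have h2 : ∀ τ ∈ Icc 0 t, K τ (t - τ) = K₀ τ + ∫ ρ in (0 : ℝ)..t, J τ ρ := by
    intro τ hτ
    rw [hK τ hτ _ ⟨by linarith [hτ.2], by linarith [hτ.1]⟩,
      intervalIntegral_ite_lt_right hτ.1 hτ.2 fun ρ => L τ (ρ - τ),
      intervalIntegral.integral_comp_sub_right (fun r => L τ r) τ, sub_self]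
  have h3 : ∀ ρ ∈ Icc 0 t, ∫ s in (0 : ℝ)..ρ, L (ρ - s) s = ∫ τ in (0 : ℝ)..t, J τ ρ := by
    intro ρ hρ
    rw [intervalIntegral_ite_lt_left hρ.1 hρ.2 fun τ => L τ (ρ - τ)]
    have := intervalIntegral.integral_comp_sub_left (a := 0) (b := ρ)
      (fun τ => L τ (ρ - τ)) ρ
    simpa using this
  have hII : IntervalIntegrable (fun τ => ∫ ρ in (0 : ℝ)..t, J τ ρ) volume 0 t := by
    rw [intervalIntegrable_iff]
    have := hJint.integral_prod_left
    rw [uIoc_of_le ht] at this ⊢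
    simp only [intervalIntegral.integral_of_le ht]
    exact this
  have h2' : ∫ τ in (0 : ℝ)..t, K τ (t - τ) =
      ∫ τ in (0 : ℝ)..t, (K₀ τ + ∫ ρ in (0 : ℝ)..t, J τ ρ) :=
    intervalIntegral.integral_congr fun τ hτ => h2 τ (by rwa [uIcc_of_le ht] at hτ)
  have h3' : ∫ ρ in (0 : ℝ)..t, ∫ s in (0 : ℝ)..ρ, L (ρ - s) s =
      ∫ ρ in (0 : ℝ)..t, ∫ τ in (0 : ℝ)..t, J τ ρ :=
    intervalIntegral.integral_congr fun ρ hρ => h3 ρ (by rwa [uIcc_of_le ht] at hρ)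
  rw [h1, h2', intervalIntegral.integral_add hK₀ hII, h3']
  congr 1
  refine intervalIntegral_intervalIntegral_swap ?_
  rw [IntegrableOn, Measure.volume_eq_prod, ← Measure.prod_restrict]
  exact hJint

end TimeConvolution

/-! ### The Duhamel term -/

section DuhamelTerm

open Set Filter Topology

theorem measurableSet_timeInterval (T : EReal) : MeasurableSet (timeInterval T) := by
  have : timeInterval T = Ici 0 ∩ (fun t : ℝ => (t : EReal)) ⁻¹' Iio T := rfl
  rw [this]
  exact measurableSet_Ici.inter (measurable_coe_real_ereal measurableSet_Iio)

theorem continuous_conv_uncurry (γ : SignedMeasure (Space d)) {F : ℝ → Space d → ℝ}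
    (hF : Continuous fun w : ℝ × Space d => F w.1 w.2) {C : ℝ} (hC : ∀ t x, |F t x| ≤ C) :
    Continuous fun w : ℝ × Space d => conv γ (F w.1) w.2 := by
  have h : ∀ μ : Measure (Space d), [IsFiniteMeasure μ] →
      Continuous fun w : ℝ × Space d => ∫ y, F w.1 (w.2 - y) ∂μ := by
    intro μ _
    refine continuous_of_dominated (bound := fun _ => C) (fun w => ?_)
      (fun w => Eventually.of_forall fun y => hC _ _) (integrable_const C)
      (Eventually.of_forall fun y => ?_)
    · exact (hF.comp (f := fun y => (w.1, w.2 - y)) (by fun_prop)).aestronglyMeasurable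
    · exact hF.comp (f := fun w : ℝ × Space d => (w.1, w.2 - y)) (by fun_prop)
  exact (h _).sub (h _)

/-- The term `∫_0^t (F(t - s, ·) * g(s, ·))(x) ds`. -/
def duhamelTerm (g : ℝ → SignedMeasure (Space d)) (F : ℝ → Space d → ℝ) (t : ℝ) (x : Space d) :
    ℝ :=
  ∫ s in (0 : ℝ)..t, conv (g s) (F (t - s)) x

variable {c : Coeffs d} {T : EReal} {g : Fin c.N → ℝ → SignedMeasure (Space d)}
  {F : ℝ → Space d → ℝ} {C : ℝ}

/-- Continuity in `(t, x)` for fixed `s` together with measurability in `s` gives joint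
measurability. The indicator is needed because nothing is known about `g n s` outside `[0, T)`. -/
theorem measurable_indicator_conv (hg : GreenMeasures c T g)
    (hF : Continuous fun w : ℝ × Space d => F w.1 w.2) (hC : ∀ t x, |F t x| ≤ C) (n : Fin c.N) :
    Measurable (Function.uncurry fun (w : ℝ × Space d) (s : ℝ) =>
      (timeInterval T).indicator (fun s => conv (g n s) (F w.1) w.2) s) := by
  refine measurable_uncurry_of_continuous_of_measurable (fun s => ?_) (fun w => ?_)
  · by_cases hs : s ∈ timeInterval T
    · simpa only [indicator_of_mem hs] using continuous_conv_uncurry (g n s) hF hC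
    · simpa only [indicator_of_notMem hs] using continuous_const
  · have hFw : Continuous (F w.1) := hF.comp (f := fun x => (w.1, x)) (by fun_prop)
    have h : ContinuousOn (fun s => conv (g n s) (F w.1) w.2) (timeInterval T) :=
      (hg.continuous_conv n (BoundedContinuousFunction.ofNormedAddCommGroup _ hFw C
        (hC w.1))).comp (f := fun s : ℝ => (s, w.2)) (by fun_prop) fun s hs => ⟨hs, mem_univ _⟩
    classical
    rw [← piecewise_eq_indicator]
    exact h.measurable_piecewise continuousOn_const (measurableSet_timeInterval T)

theorem intervalIntegrable_conv (hT : 0 < T) (h_tempered : TemperedHat c T)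
    (hg : GreenMeasures c T g) (hF : Continuous fun w : ℝ × Space d => F w.1 w.2)
    (hC : ∀ t x, |F t x| ≤ C) (n : Fin c.N) {t : ℝ} (ht : t ∈ timeInterval T) (x : Space d) :
    IntervalIntegrable (fun s => conv (g n s) (F (t - s)) x) volume 0 t := by
  obtain ⟨K, hK⟩ := exists_totalMass_le hT h_tempered hg t
  have hC0 : 0 ≤ C := (abs_nonneg _).trans (hC 0 0)
  rw [intervalIntegrable_iff, uIoc_of_le ht.1]
  have hmem : ∀ s ∈ Ioc 0 t, s ∈ timeInterval T := fun s hs =>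
    Icc_subset_timeInterval ht (Ioc_subset_Icc_self hs)
  have hm : Measurable fun s =>
      (timeInterval T).indicator (fun r => conv (g n r) (F (t - s)) x) s :=
    (measurable_indicator_conv hg hF hC n).comp
      (f := fun s : ℝ => (((t - s, x) : ℝ × Space d), s)) (by fun_prop)
  refine Integrable.of_bound (hm.aestronglyMeasurable.congr ?_) (C * K) ?_
  · filter_upwards [ae_restrict_mem measurableSet_Ioc] with s hs
    rw [indicator_of_mem (hmem s hs)]
  · filter_upwards [ae_restrict_mem measurableSet_Ioc] with s hs
    refine (abs_conv_le _ (hC _) x).trans ?_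
    gcongr
    exact hK s (hmem s hs) hs.2 n

/-- The variable upper limit is written as an indicator, so that dominated convergence applies with
a constant bound on a slightly longer time interval. -/
theorem isBoundedContinuous_duhamelTerm (hT : 0 < T) (h_tempered : TemperedHat c T)
    (hg : GreenMeasures c T g) (hF : Continuous fun w : ℝ × Space d => F w.1 w.2)
    (hC : ∀ t x, |F t x| ≤ C) (n : Fin c.N) :
    IsBoundedContinuous T (duhamelTerm (g n) F) where
  continuousOn := by
    rintro ⟨t₀, x₀⟩ ⟨ht₀, -⟩
    obtain ⟨K, hK⟩ := exists_totalMass_le hT h_tempered hg (t₀ + 1)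
    have hC0 : 0 ≤ C := (abs_nonneg _).trans (hC 0 0)
    have hK0 : 0 ≤ K :=
      (totalMass_nonneg _).trans (hK 0 (zero_mem_timeInterval hT) (by linarith [ht₀.1]) n)
    set H : ℝ × Space d → ℝ → ℝ := fun w s =>
      (Ioc 0 w.1).indicator (fun s => conv (g n s) (F (w.1 - s)) w.2) s with hH
    have heq : ∀ w ∈ timeInterval T ×ˢ (univ : Set (Space d)),
        duhamelTerm (g n) F w.1 w.2 = ∫ s, H w s := fun w hw => by
      rw [duhamelTerm, intervalIntegral.integral_of_le hw.1.1,
        ← integral_indicator measurableSet_Ioc]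
    refine ContinuousWithinAt.congr ?_ heq (heq _ ⟨ht₀, mem_univ _⟩)
    have hnear : ∀ᶠ w in 𝓝[timeInterval T ×ˢ univ] ((t₀, x₀) : ℝ × Space d),
        w.1 ∈ timeInterval T ∧ w.1 ≤ t₀ + 1 := by
      have h1 : ∀ᶠ w in 𝓝[timeInterval T ×ˢ univ] ((t₀, x₀) : ℝ × Space d),
          w ∈ timeInterval T ×ˢ (univ : Set (Space d)) := eventually_mem_nhdsWithin
      have h2 : ∀ᶠ w in 𝓝 ((t₀, x₀) : ℝ × Space d), w.1 < t₀ + 1 :=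
        continuous_fst.continuousAt.eventually_lt continuousAt_const (lt_add_one t₀)
      filter_upwards [h1, mem_nhdsWithin_of_mem_nhds h2] with w hw1 hw2
      exact ⟨hw1.1, le_of_lt hw2⟩
    refine continuousWithinAt_of_dominated
      (bound := (Ioc 0 (t₀ + 1)).indicator fun _ => C * K) ?_ ?_ ?_ ?_
    · filter_upwards [hnear] with w hw
      have := intervalIntegrable_conv hT h_tempered hg hF hC n hw.1 w.2
      rw [intervalIntegrable_iff, uIoc_of_le hw.1.1] at this
      exact (this.integrable_indicator measurableSet_Ioc).aestronglyMeasurable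
    · filter_upwards [hnear] with w hw
      refine Eventually.of_forall fun s => ?_
      simp only [hH]
      by_cases hs : s ∈ Ioc 0 w.1
      · rw [indicator_of_mem hs, indicator_of_mem (Ioc_subset_Ioc_right hw.2 hs)]
        refine (abs_conv_le _ (hC _) _).trans ?_
        gcongr
        exact hK s (mem_timeInterval_of_le hw.1 hs.1.le hs.2) (hs.2.trans hw.2) n
      · rw [indicator_of_notMem hs, norm_zero]
        exact indicator_nonneg (fun _ _ => mul_nonneg hC0 hK0) _
    · exact (integrable_indicator_iff measurableSet_Ioc).2 (integrable_const _)
    -- The indicator of `(0, t]` can jump in `t` at `t₀` only for `s = t₀`, a null set.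
    · have hne : ∀ᵐ s : ℝ, s ≠ t₀ := by simp [ae_iff]
      filter_upwards [hne] with s hs
      have hcont : Continuous fun w : ℝ × Space d => conv (g n s) (F (w.1 - s)) w.2 :=
        (continuous_conv_uncurry (g n s) hF hC).comp
          (f := fun w : ℝ × Space d => (w.1 - s, w.2)) (by fun_prop)
      refine ContinuousAt.continuousWithinAt ?_
      by_cases hs0 : 0 < s
      · rcases lt_or_gt_of_ne hs with hlt | hgt
        · have h2 : ∀ᶠ w in 𝓝 ((t₀, x₀) : ℝ × Space d), s < w.1 :=
            continuousAt_const.eventually_lt continuous_fst.continuousAt hlt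
          refine hcont.continuousAt.congr ?_
          filter_upwards [h2] with w hw
          rw [hH]
          simp only
          have hmem : s ∈ Ioc 0 w.1 := ⟨hs0, le_of_lt hw⟩
          rw [indicator_of_mem hmem]
        · have h2 : ∀ᶠ w in 𝓝 ((t₀, x₀) : ℝ × Space d), w.1 < s :=
            continuous_fst.continuousAt.eventually_lt continuousAt_const hgt
          refine (continuousAt_const (y := (0 : ℝ))).congr ?_
          filter_upwards [h2] with w hw
          rw [hH]
          simp only
          have hmem : s ∉ Ioc 0 w.1 := fun h => absurd h.2 (not_le.2 hw)
          rw [indicator_of_notMem hmem]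
      · have : (fun w => H w s) = fun _ => 0 := by
          funext w
          rw [hH]
          simp only
          have hmem : s ∉ Ioc 0 w.1 := fun h => hs0 h.1
          rw [indicator_of_notMem hmem]
        rw [this]
        exact continuousAt_const
  bounded S := by
    obtain ⟨K, hK⟩ := exists_totalMass_le hT h_tempered hg S
    have hC0 : 0 ≤ C := (abs_nonneg _).trans (hC 0 0)
    by_cases hne : 0 ≤ S
    · have hK0 : 0 ≤ K := (totalMass_nonneg _).trans (hK 0 (zero_mem_timeInterval hT) hne n)
      refine ⟨C * K * S, fun t ht htS x => ?_⟩
      have h := intervalIntegral.norm_integral_le_of_norm_le_const (a := 0) (b := t)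
        (f := fun s => conv (g n s) (F (t - s)) x) (C := C * K) fun s hs => by
          rw [uIoc_of_le ht.1] at hs
          refine (abs_conv_le _ (hC _) x).trans ?_
          gcongr
          exact hK s (mem_timeInterval_of_le ht hs.1.le hs.2) (hs.2.trans htS) n
      rw [sub_zero, abs_of_nonneg ht.1] at h
      refine h.trans ?_
      gcongr
    · exact ⟨0, fun t ht htS => absurd (ht.1.trans htS) hne⟩

theorem pairing_duhamelTerm (hT : 0 < T) (h_tempered : TemperedHat c T)
    (hg : GreenMeasures c T g) (hF : Continuous fun w : ℝ × Space d => F w.1 w.2)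
    (hC : ∀ t x, |F t x| ≤ C) (n : Fin c.N) (φ : 𝓢(Space d, ℝ)) {t : ℝ}
    (ht : t ∈ timeInterval T) :
    pairing (duhamelTerm (g n) F) φ t =
      ∫ s in (0 : ℝ)..t, pairing (fun r x => conv (g n r) (F (t - s)) x) φ s := by
  obtain ⟨K, hK⟩ := exists_totalMass_le hT h_tempered hg t
  have hmem : ∀ s ∈ Ioc 0 t, s ∈ timeInterval T := fun s hs =>
    Icc_subset_timeInterval ht (Ioc_subset_Icc_self hs)
  have hm : Measurable fun z : ℝ × Space d =>
      (timeInterval T).indicator (fun r => conv (g n r) (F (t - z.1)) z.2) z.1 :=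
    (measurable_indicator_conv hg hF hC n).comp
      (f := fun z : ℝ × Space d => (((t - z.1, z.2) : ℝ × Space d), z.1)) (by fun_prop)
  have hae : ∀ᵐ w ∂((volume.restrict (uIoc 0 t)).prod (volume : Measure (Space d))),
      w.1 ∈ Ioc 0 t := by
    rw [uIoc_of_le ht.1]
    exact (Measure.quasiMeasurePreserving_fst).ae (ae_restrict_mem measurableSet_Ioc)
  have : IsFiniteMeasure (volume.restrict (uIoc 0 t)) := by
    rw [uIoc_of_le ht.1]
    infer_instance
  simp only [pairing]
  rw [intervalIntegral_integral_swap]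
  · simp only [intervalIntegral.integral_mul_const]
    rfl
  · refine (φ.integrable.comp_snd (volume.restrict (uIoc 0 t))).bdd_mul (c := C * K)
      (hm.aestronglyMeasurable.congr ?_) ?_
    · filter_upwards [hae] with w hw
      rw [indicator_of_mem (hmem _ hw)]
    · filter_upwards [hae] with w hw
      refine (abs_conv_le _ (hC _) _).trans ?_
      have hC0 : 0 ≤ C := (abs_nonneg _).trans (hC 0 0)
      gcongr
      exact hK w.1 (hmem _ hw) hw.2 n

theorem intervalIntegrable_pairing_conv (hT : 0 < T) (h_tempered : TemperedHat c T)
    (hg : GreenMeasures c T g) (hF : Continuous fun w : ℝ × Space d => F w.1 w.2)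
    (hC : ∀ t x, |F t x| ≤ C) (n : Fin c.N) (φ : 𝓢(Space d, ℝ)) {t : ℝ}
    (ht : t ∈ timeInterval T) :
    IntervalIntegrable (fun s => pairing (fun r x => conv (g n r) (F (t - s)) x) φ s)
      volume 0 t := by
  obtain ⟨K, hK⟩ := exists_totalMass_le hT h_tempered hg t
  have hmem : ∀ s ∈ Ioc 0 t, s ∈ timeInterval T := fun s hs =>
    Icc_subset_timeInterval ht (Ioc_subset_Icc_self hs)
  have hm : Measurable fun s => ∫ x,
      (timeInterval T).indicator (fun r => conv (g n r) (F (t - s)) x) s * φ x := by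
    have h1 : Measurable fun z : ℝ × Space d =>
        (timeInterval T).indicator (fun r => conv (g n r) (F (t - z.1)) z.2) z.1 * φ z.2 := by
      refine Measurable.mul ?_ (φ.continuous.measurable.comp measurable_snd)
      exact (measurable_indicator_conv hg hF hC n).comp
        (f := fun z : ℝ × Space d => (((t - z.1, z.2) : ℝ × Space d), z.1)) (by fun_prop)
    exact h1.stronglyMeasurable.integral_prod_right.measurable
  rw [intervalIntegrable_iff, uIoc_of_le ht.1]
  refine Integrable.of_bound (hm.aestronglyMeasurable.congr ?_) (C * K * ∫ x, |φ x|) ?_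
  · filter_upwards [ae_restrict_mem measurableSet_Ioc] with s hs
    simp only [indicator_of_mem (hmem s hs), pairing]
  · filter_upwards [ae_restrict_mem measurableSet_Ioc] with s hs
    refine IsBoundedContinuous.abs_pairing_le (T := T) (S := t) (fun r hr hrt x => ?_) φ
      (hmem s hs) hs.2
    refine (abs_conv_le _ (hC _) _).trans ?_
    have hC0 : 0 ≤ C := (abs_nonneg _).trans (hC 0 0)
    gcongr
    exact hK r hr hrt n

/-- The evolution equation of the pairings with the Duhamel terms, in integrated form. -/
theorem pairing_duhamelTerm_eq_add_integral (hT : 0 < T) (h_tempered : TemperedHat c T)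
    (hg : GreenMeasures c T g) (hF : Continuous fun w : ℝ × Space d => F w.1 w.2)
    (hC : ∀ t x, |F t x| ≤ C) (n : Fin c.N) (φ : 𝓢(Space d, ℝ)) {t : ℝ}
    (ht : t ∈ timeInterval T) :
    pairing (duhamelTerm (g n) F) φ t =
      (∫ τ in (0 : ℝ)..t, if n = c.first then pairing F φ τ else 0) +
      ∫ ρ in (0 : ℝ)..t, ∑ k,
        pairing (duhamelTerm (g k) F) (c.act (c.polyCompanion k n) φ) ρ := by
  obtain ⟨K, hK⟩ := exists_totalMass_le hT h_tempered hg t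
  have hsub := Icc_subset_timeInterval ht
  have hFτ : ∀ τ, Continuous (F τ) := fun τ => hF.comp (f := fun x => (τ, x)) (by fun_prop)
  have hFb : IsBoundedContinuous ⊤ F := ⟨hF.continuousOn, fun _ => ⟨C, fun t _ _ => hC t⟩⟩
  set ψ : Fin c.N → 𝓢(Space d, ℝ) := fun k => c.act (c.polyCompanion k n) φ with hψ
  have hb : ∀ τ s, s ∈ Icc 0 t → ∀ k, |pairing (fun r x => conv (g k r) (F τ) x) (ψ k) s| ≤
      C * K * ∫ x, |ψ k x| := fun τ s hs k => by
    refine IsBoundedContinuous.abs_pairing_le (T := T) (S := t) (fun r hr hrt x => ?_) (ψ k)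
      (hsub hs) hs.2
    refine (abs_conv_le _ (hC _) _).trans ?_
    have hC0 : 0 ≤ C := (abs_nonneg _).trans (hC 0 0)
    gcongr
    exact hK r hr hrt k
  -- The indicator makes this measurable on the whole plane; for `s` in `[0, t]` it is the sum of
  -- the pairings.
  set L : ℝ → ℝ → ℝ := fun τ s => ∑ k, ∫ x,
    (timeInterval T).indicator (fun r => conv (g k r) (F τ) x) s * ψ k x with hL
  have hLeq : ∀ τ, ∀ s ∈ Icc 0 t,
      L τ s = ∑ k, pairing (fun r x => conv (g k r) (F τ) x) (ψ k) s := fun τ s hs => by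
    simp only [hL, indicator_of_mem (hsub hs)]
    rfl
  have hLm : Measurable (Function.uncurry L) := by
    simp only [hL, Function.uncurry_def]
    refine Finset.measurable_sum _ fun k _ => ?_
    have h1 : Measurable fun z : (ℝ × ℝ) × Space d =>
        (timeInterval T).indicator (fun r => conv (g k r) (F z.1.1) z.2) z.1.2 * ψ k z.2 := by
      refine Measurable.mul ?_ ((ψ k).continuous.measurable.comp measurable_snd)
      exact (measurable_indicator_conv hg hF hC k).comp
        (f := fun z : (ℝ × ℝ) × Space d => (((z.1.1, z.2) : ℝ × Space d), z.1.2)) (by fun_prop)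
    exact h1.stronglyMeasurable.integral_prod_right.measurable
  have hK₀ : IntervalIntegrable (fun τ => if n = c.first then pairing F φ τ else 0) volume 0 t := by
    split_ifs
    · refine ContinuousOn.intervalIntegrable ?_
      rw [uIcc_of_le ht.1]
      exact (hFb.continuousOn_pairing φ).mono fun s hs => ⟨hs.1, EReal.coe_lt_top s⟩
    · exact intervalIntegrable_const
  -- For a frozen source time `τ`, the function `F τ` is an initial datum, so the evolution in `s`
  -- is that of `pairing_conv_eq_add_integral`; `integral_timeConvolution` then superposes these
  -- evolutions.
  rw [pairing_duhamelTerm hT h_tempered hg hF hC n φ ht,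
    integral_timeConvolution
      (K := fun τ s => pairing (fun r x => conv (g n r) (F τ) x) φ s) (L := L)
      (K₀ := fun τ => if n = c.first then pairing F φ τ else 0)
      (C := ∑ k, C * K * ∫ x, |ψ k x|) ht.1 hLm ?_ ?_ hK₀]
  · congr 1
    refine intervalIntegral.integral_congr fun ρ hρ => ?_
    rw [uIcc_of_le ht.1] at hρ
    have hρT := hsub hρ
    rw [Finset.sum_congr rfl fun k _ =>
      pairing_duhamelTerm hT h_tempered hg hF hC k (c.act (c.polyCompanion k n) φ) hρT,
      ← intervalIntegral.integral_finsetSum]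
    · refine intervalIntegral.integral_congr fun s hs => ?_
      rw [uIcc_of_le hρ.1] at hs
      exact hLeq _ s ⟨hs.1, hs.2.trans hρ.2⟩
    · intro k _
      exact intervalIntegrable_pairing_conv hT h_tempered hg hF hC k _ hρT
  · intro τ _ s hs
    rw [hLeq τ s hs]
    exact (Finset.abs_sum_le_sum_abs _ _).trans (Finset.sum_le_sum fun k _ => hb τ s hs k)
  · intro τ _ s hs
    rw [pairing_conv_eq_add_integral hT h_tempered hg (hFτ τ) (hC τ) n φ (hsub hs)]
    congr 1
    refine intervalIntegral.integral_congr fun r hr => ?_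
    rw [uIcc_of_le hs.1] at hr
    exact (hLeq τ r ⟨hr.1, hr.2.trans hs.2⟩).symm

end DuhamelTerm

/-! ### Calculus on the time interval -/

section TimeInterval

open Set Filter Topology

variable {T : EReal}

theorem exists_lt_mem_timeInterval {t : ℝ} (ht : t ∈ timeInterval T) :
    ∃ S ∈ timeInterval T, t < S := by
  obtain ⟨S, h1, h2⟩ := EReal.lt_iff_exists_real_btwn.1 ht.2
  rw [EReal.coe_lt_coe_iff] at h1
  exact ⟨S, ⟨ht.1.trans h1.le, h2⟩, h1⟩

theorem Icc_mem_nhdsWithin_timeInterval {t S : ℝ} (htS : t < S) :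
    Icc 0 S ∈ 𝓝[timeInterval T] t := by
  filter_upwards [self_mem_nhdsWithin, mem_nhdsWithin_of_mem_nhds (Iic_mem_nhds htS)] with s h1 h2
  exact ⟨h1.1, h2⟩

theorem uniqueDiffOn_timeInterval (hT : 0 < T) : UniqueDiffOn ℝ (timeInterval T) := by
  obtain ⟨S, hS, hS0⟩ := exists_lt_mem_timeInterval (zero_mem_timeInterval hT)
  refine uniqueDiffOn_convex ?_ ⟨S / 2, ?_⟩
  · refine OrdConnected.convex ⟨fun a ha b hb s hs => ?_⟩
    exact mem_timeInterval_of_le hb (ha.1.trans hs.1) hs.2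
  · rw [mem_interior_iff_mem_nhds]
    exact mem_of_superset (Icc_mem_nhds (half_pos hS0) (half_lt_self hS0))
      (Icc_subset_timeInterval hS)

theorem hasDerivWithinAt_of_eq_add_integral {w q : ℝ → ℝ} {w₀ : ℝ}
    (hq : ContinuousOn q (timeInterval T))
    (hw : ∀ t ∈ timeInterval T, w t = w₀ + ∫ r in (0 : ℝ)..t, q r) {t : ℝ}
    (ht : t ∈ timeInterval T) : HasDerivWithinAt w (q t) (timeInterval T) t := by
  obtain ⟨S, hS, htS⟩ := exists_lt_mem_timeInterval ht
  have hsub := Icc_subset_timeInterval hS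
  -- Constant extension of `q` beyond `[0, S]` with `S > t` makes it continuous on the line, so the
  -- two-sided fundamental theorem of calculus applies, also at `0`.
  set qe := IccExtend hS.1 ((Icc 0 S).domRestrict q) with hqe
  have hqc : Continuous qe := ((hq.mono hsub).domRestrict).Icc_extend'
  have hqq : ∀ r ∈ Icc 0 S, qe r = q r := fun r hr => by
    rw [hqe, IccExtend_of_mem hS.1 _ hr, domRestrict_apply]
  have h1 : HasDerivAt (fun t => w₀ + ∫ r in (0 : ℝ)..t, qe r) (q t) t := by
    rw [← hqq t ⟨ht.1, htS.le⟩]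
    exact (hqc.integral_hasStrictDerivAt 0 t).hasDerivAt.const_add w₀
  have h2 : ∀ s ∈ Icc 0 S, w s = w₀ + ∫ r in (0 : ℝ)..s, qe r := fun s hs => by
    rw [hw s (hsub hs)]
    congr 1
    refine intervalIntegral.integral_congr fun r hr => ?_
    rw [uIcc_of_le hs.1] at hr
    exact (hqq r ⟨hr.1, hr.2.trans hs.2⟩).symm
  refine h1.hasDerivWithinAt.congr_of_eventuallyEq ?_ (h2 t ⟨ht.1, htS.le⟩)
  filter_upwards [Icc_mem_nhdsWithin_timeInterval htS] with s hs using h2 s hs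

theorem iteratedDerivWithin_timeInterval_of_chain (hT : 0 < T) {N : ℕ} {w : ℕ → ℝ → ℝ}
    (hw : ∀ j < N, ∀ t ∈ timeInterval T, HasDerivWithinAt (w j) (w (j + 1) t) (timeInterval T) t)
    {j : ℕ} (hj : j ≤ N) {t : ℝ} (ht : t ∈ timeInterval T) :
    iteratedDerivWithin j (w 0) (timeInterval T) t = w j t := by
  induction j generalizing t with
  | zero => simp
  | succ j ih =>
    rw [iteratedDerivWithin_succ, derivWithin_congr (fun s hs => ih (by omega) hs)
      (ih (by omega) ht)]
    exact (hw j (by omega) t ht).derivWithin (uniqueDiffOn_timeInterval hT t ht)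

theorem contDiffOn_timeInterval_of_chain (hT : 0 < T) {N : ℕ} {w : ℕ → ℝ → ℝ}
    (hw : ∀ j < N, ∀ t ∈ timeInterval T, HasDerivWithinAt (w j) (w (j + 1) t) (timeInterval T) t)
    (hc : ContinuousOn (w N) (timeInterval T)) :
    ContDiffOn ℝ (N : ℕ∞) (w 0) (timeInterval T) := by
  have hD : ∀ j < N, DifferentiableOn ℝ (w j) (timeInterval T) := fun j hj t ht =>
    (hw j hj t ht).differentiableWithinAt
  have heq : ∀ j ≤ N, EqOn (iteratedDerivWithin j (w 0) (timeInterval T)) (w j)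
      (timeInterval T) := fun j hj t ht => iteratedDerivWithin_timeInterval_of_chain hT hw hj ht
  refine contDiffOn_of_continuousOn_differentiableOn_deriv (fun m hm => ?_) fun m hm => ?_
  · have hm' : m ≤ N := by exact_mod_cast hm
    refine ContinuousOn.congr ?_ (heq m hm')
    rcases hm'.lt_or_eq with h | rfl
    · exact (hD m h).continuousOn
    · exact hc
  · have hm' : m < N := by exact_mod_cast hm
    exact (hD m hm').congr (heq m hm'.le)

end TimeInterval

/-! ### Systems driven by the companion matrix -/

section System

open Set Filter Topology Polynomial

theorem Coeffs.act_mul (c : Coeffs d) (q r : ℝ[X]) (φ : 𝓢(Space d, ℝ)) :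
    c.act (q * r) φ = c.act q (c.act r φ) := by
  simp [Coeffs.act]

theorem Coeffs.act_sum (c : Coeffs d) {ι : Type*} (s : Finset ι) (q : ι → ℝ[X])
    (φ : 𝓢(Space d, ℝ)) : c.act (∑ i ∈ s, q i) φ = ∑ i ∈ s, c.act (q i) φ := by
  simp [Coeffs.act]

theorem Coeffs.act_one (c : Coeffs d) (φ : 𝓢(Space d, ℝ)) : c.act 1 φ = φ := by
  simp [Coeffs.act]

theorem Coeffs.act_zero (c : Coeffs d) (φ : 𝓢(Space d, ℝ)) : c.act 0 φ = 0 := by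
  simp [Coeffs.act]

theorem Coeffs.act_X (c : Coeffs d) (φ : 𝓢(Space d, ℝ)) : c.act X φ = c.adjointOp φ := by
  simp [Coeffs.act]

theorem Coeffs.act_C_mul (c : Coeffs d) (r : ℝ) (q : ℝ[X]) (φ : 𝓢(Space d, ℝ)) :
    c.act (C r * q) φ = r • c.act q φ := by
  simp [Coeffs.act]

theorem polyCompanion_pow_first (c : Coeffs d) {j : ℕ} (hj : j < c.N) (n : Fin c.N) :
    (c.polyCompanion ^ j) c.first n = if n.val = j then 1 else 0 := by
  rw [Coeffs.polyCompanion, Coeffs.first]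
  obtain ⟨N, M, a, b', hN, _, _, _⟩ := c
  obtain ⟨m, rfl⟩ : ∃ m, N = m + 1 := ⟨N - 1, by omega⟩
  have := companionMatrix_pow_zero_apply (fun n => C (a n)) (X : ℝ[X]) ⟨j, hj⟩ n
  simp only [Fin.ext_iff] at this
  exact this

theorem sum_smul_polyCompanion_pow (c : Coeffs d) :
    ∑ j ∈ Finset.Icc 1 c.N, (C (c.a j) : ℝ[X]) • c.polyCompanion ^ j = (X : ℝ[X]) • 1 := by
  rw [Coeffs.polyCompanion]
  obtain ⟨N, M, a, b', hN, _, ha, _⟩ := c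
  obtain ⟨m, rfl⟩ : ∃ m, N = m + 1 := ⟨N - 1, by omega⟩
  exact sum_smul_companionMatrix_pow (fun n => C (a n)) (X : ℝ[X]) (by simp [ha])

variable {c : Coeffs d} {T : EReal} {W : Fin c.N → ℝ → Space d → ℝ}

/-- The expressions giving the time derivatives of `⟨W_n, φ⟩` for a system driven by the
companion matrix. -/
def systemDeriv (c : Coeffs d) (W : Fin c.N → ℝ → Space d → ℝ) (j : ℕ) (n : Fin c.N)
    (φ : 𝓢(Space d, ℝ)) (t : ℝ) : ℝ :=
  ∑ k, pairing (W k) (c.act ((c.polyCompanion ^ j) k n) φ) t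

theorem pairing_sum_right {u : ℝ → Space d → ℝ} (hu : IsBoundedContinuous T u) {ι : Type*}
    (s : Finset ι) (φ : ι → 𝓢(Space d, ℝ)) {t : ℝ} (ht : t ∈ timeInterval T) :
    pairing u (∑ i ∈ s, φ i) t = ∑ i ∈ s, pairing u (φ i) t :=
  map_sum (hu.pairingLM ht) φ s

theorem pairing_smul_right (u : ℝ → Space d → ℝ) (r : ℝ) (φ : 𝓢(Space d, ℝ)) (t : ℝ) :
    pairing u (r • φ) t = r * pairing u φ t := by
  simp only [pairing, smul_apply, smul_eq_mul, ← integral_const_mul]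
  congr 1
  funext x
  ring

theorem pairing_zero_right (u : ℝ → Space d → ℝ) (t : ℝ) : pairing u 0 t = 0 := by
  simp [pairing]

theorem systemDeriv_zero (n : Fin c.N) (φ : 𝓢(Space d, ℝ)) :
    systemDeriv c W 0 n φ = pairing (W n) φ := by
  funext t
  rw [systemDeriv, Finset.sum_eq_single n]
  · simp [Coeffs.act_one]
  · intro k _ hk
    rw [pow_zero, Matrix.one_apply_ne hk, Coeffs.act_zero, pairing_zero_right]
  · simp

theorem continuousOn_systemDeriv (hW : ∀ n, IsBoundedContinuous T (W n)) (j : ℕ) (n : Fin c.N)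
    (φ : 𝓢(Space d, ℝ)) : ContinuousOn (systemDeriv c W j n φ) (timeInterval T) :=
  continuousOn_finsetSum _ fun k _ => (hW k).continuousOn_pairing _

/-- In row notation the system is `W' = q e_1ᵀ + W B`, whence `(W B^j)' = q e_1ᵀ B^j + W B^{j+1}`.
For `j < N` the source thus reaches component `n` only at the step where `e_1ᵀ B^j` is the `n`-th
basis vector. -/
theorem hasDerivWithinAt_systemDeriv (hW : ∀ n, IsBoundedContinuous T (W n))
    {q : 𝓢(Space d, ℝ) → ℝ}
    {t : ℝ} (ht : t ∈ timeInterval T)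
    (hder : ∀ n φ, HasDerivWithinAt (pairing (W n) φ)
      ((if n = c.first then q φ else 0) +
        ∑ k, pairing (W k) (c.act (c.polyCompanion k n) φ) t) (timeInterval T) t)
    (j : ℕ) (n : Fin c.N) (φ : 𝓢(Space d, ℝ)) :
    HasDerivWithinAt (systemDeriv c W j n φ)
      (q (c.act ((c.polyCompanion ^ j) c.first n) φ) + systemDeriv c W (j + 1) n φ t)
      (timeInterval T) t := by
  refine (HasDerivWithinAt.fun_sum fun k _ =>
    hder k (c.act ((c.polyCompanion ^ j) k n) φ)).congr_deriv ?_
  rw [Finset.sum_add_distrib, Finset.sum_ite_eq' Finset.univ c.first, if_pos (Finset.mem_univ _),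
    Finset.sum_comm]
  congr 1
  refine Finset.sum_congr rfl fun l _ => ?_
  rw [pow_succ', Matrix.mul_apply, Coeffs.act_sum, pairing_sum_right (hW l) _ _ ht]
  simp only [Coeffs.act_mul]

/-- The companion matrix satisfies `∑ a_j B^j = X · 1`, and `X` acts as the adjoint of the spatial
operator. -/
theorem sum_mul_systemDeriv (hW : ∀ n, IsBoundedContinuous T (W n)) {t : ℝ}
    (ht : t ∈ timeInterval T) (n : Fin c.N) (φ : 𝓢(Space d, ℝ)) :
    ∑ j ∈ Finset.Icc 1 c.N, c.a j * systemDeriv c W j n φ t = pairing (W n) (c.adjointOp φ) t := by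
  simp only [systemDeriv, Finset.mul_sum, ← pairing_smul_right, ← Coeffs.act_C_mul]
  rw [Finset.sum_comm]
  have h : ∀ k, ∑ j ∈ Finset.Icc 1 c.N,
      pairing (W k) (c.act (C (c.a j) * (c.polyCompanion ^ j) k n) φ) t =
      pairing (W k) (c.act ((X • (1 : Matrix (Fin c.N) (Fin c.N) ℝ[X])) k n) φ) t := fun k => by
    rw [← pairing_sum_right (hW k) _ _ ht, ← Coeffs.act_sum, ← sum_smul_polyCompanion_pow,
      Matrix.sum_apply]
    simp only [Matrix.smul_apply, smul_eq_mul]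
  rw [Finset.sum_congr rfl fun k _ => h k, Finset.sum_eq_single n]
  · simp [Coeffs.act_X]
  · intro k _ hk
    rw [Matrix.smul_apply, Matrix.one_apply_ne hk, smul_zero, Coeffs.act_zero, pairing_zero_right]
  · simp

end System

/-! ### Existence -/

section Existence

open Set Filter Topology Polynomial

variable {c : Coeffs d} {T : EReal} {g : Fin c.N → ℝ → SignedMeasure (Space d)}
  {F : ℝ → Space d → ℝ} {C : ℝ}

theorem pairing_congr {u v : ℝ → Space d → ℝ} {t : ℝ} (h : ∀ x, u t x = v t x)
    (φ : 𝓢(Space d, ℝ)) : pairing u φ t = pairing v φ t := by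
  simp only [pairing, h]

theorem IsBoundedContinuous.congr {u v : ℝ → Space d → ℝ} (hv : IsBoundedContinuous T v)
    (h : ∀ t ∈ timeInterval T, ∀ x, u t x = v t x) : IsBoundedContinuous T u where
  continuousOn := hv.continuousOn.congr fun z hz => h z.1 hz.1 z.2
  bounded S := by
    obtain ⟨C, hC⟩ := hv.bounded S
    exact ⟨C, fun t ht hS x => by rw [h t ht x]; exact hC t ht hS x⟩

theorem isBoundedContinuous_of_continuous (hF : Continuous fun w : ℝ × Space d => F w.1 w.2)
    (hC : ∀ t x, |F t x| ≤ C) : IsBoundedContinuous T F :=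
  ⟨hF.continuousOn, fun _ => ⟨C, fun t _ _ => hC t⟩⟩

theorem IsBoundedContinuous.sum_mul_pairing_partialDeriv {u : ℝ → Space d → ℝ}
    (hu : IsBoundedContinuous T u) (φ : 𝓢(Space d, ℝ)) {t : ℝ} (ht : t ∈ timeInterval T) :
    ∑ α ∈ multiIndices d c.M, c.b α * ((-1) ^ (∑ i, α i) * pairing u (partialDeriv α φ) t) =
      pairing u (c.adjointOp φ) t := by
  rw [Coeffs.adjointOp_apply, pairing_sum_right hu _ _ ht]
  simp only [pairing_smul_right, mul_assoc]

theorem hasDerivWithinAt_pairing_conv (hT : 0 < T) (h_tempered : TemperedHat c T)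
    (hg : GreenMeasures c T g) {f : Space d → ℝ} (hf : Continuous f) (hC : ∀ x, |f x| ≤ C)
    (n : Fin c.N) (φ : 𝓢(Space d, ℝ)) {t : ℝ} (ht : t ∈ timeInterval T) :
    HasDerivWithinAt (pairing (fun t x => conv (g n t) f x) φ)
      (∑ k, pairing (fun t x => conv (g k t) f x) (c.act (c.polyCompanion k n) φ) t)
      (timeInterval T) t :=
  hasDerivWithinAt_of_eq_add_integral
    (continuousOn_finsetSum _ fun k _ =>
      (isBoundedContinuous_conv hT h_tempered hg k hf hC).continuousOn_pairing _)
    (fun _ ht => pairing_conv_eq_add_integral hT h_tempered hg hf hC n φ ht) ht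

theorem hasDerivWithinAt_pairing_duhamelTerm (hT : 0 < T) (h_tempered : TemperedHat c T)
    (hg : GreenMeasures c T g) (hF : Continuous fun w : ℝ × Space d => F w.1 w.2)
    (hC : ∀ t x, |F t x| ≤ C) (n : Fin c.N) (φ : 𝓢(Space d, ℝ)) {t : ℝ}
    (ht : t ∈ timeInterval T) :
    HasDerivWithinAt (pairing (duhamelTerm (g n) F) φ)
      ((if n = c.first then pairing F φ t else 0) +
        ∑ k, pairing (duhamelTerm (g k) F) (c.act (c.polyCompanion k n) φ) t)
      (timeInterval T) t := by
  have hc1 : ContinuousOn (fun t => if n = c.first then pairing F φ t else 0)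
      (timeInterval T) := by
    split_ifs
    · exact (isBoundedContinuous_of_continuous hF hC).continuousOn_pairing φ
    · exact continuousOn_const
  have hc2 : ContinuousOn
      (fun t => ∑ k, pairing (duhamelTerm (g k) F) (c.act (c.polyCompanion k n) φ) t)
      (timeInterval T) := continuousOn_finsetSum _ fun k _ =>
    (isBoundedContinuous_duhamelTerm hT h_tempered hg hF hC k).continuousOn_pairing _
  refine hasDerivWithinAt_of_eq_add_integral (w₀ := 0) (hc1.add hc2) (fun s hs => ?_) ht
  have hsub : uIcc 0 s ⊆ timeInterval T := by
    rw [uIcc_of_le hs.1]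
    exact Icc_subset_timeInterval hs
  rw [pairing_duhamelTerm_eq_add_integral hT h_tempered hg hF hC n φ hs, zero_add]
  exact (intervalIntegral.integral_add (hc1.mono hsub).intervalIntegrable
    (hc2.mono hsub).intervalIntegrable).symm

/-- At time `0` only the first component is nonzero, so only the first row of `B^j`, a basis vector,
contributes. -/
theorem systemDeriv_conv_zero (hT : 0 < T) (h_tempered : TemperedHat c T)
    (hg : GreenMeasures c T g) {f : Space d → ℝ} (hf : Continuous f) (hC : ∀ x, |f x| ≤ C)
    {j : ℕ} (hj : j < c.N) (n : Fin c.N) (φ : 𝓢(Space d, ℝ)) :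
    systemDeriv c (fun k t x => conv (g k t) f x) j n φ 0 =
      if n.val = j then ∫ x, f x * φ x else 0 := by
  simp only [systemDeriv]
  rw [Finset.sum_eq_single c.first]
  · rw [pairing_conv_eq_add_integral hT h_tempered hg hf hC _ _ (zero_mem_timeInterval hT),
      polyCompanion_pow_first c hj, if_pos rfl, intervalIntegral.integral_same, add_zero]
    split_ifs
    · rw [Coeffs.act_one]
    · simp [Coeffs.act_zero]
  · intro k _ hk
    rw [pairing_conv_eq_add_integral hT h_tempered hg hf hC _ _ (zero_mem_timeInterval hT),
      if_neg hk, intervalIntegral.integral_same, add_zero]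
  · simp

theorem systemDeriv_duhamelTerm_zero (j : ℕ) (n : Fin c.N) (φ : 𝓢(Space d, ℝ)) :
    systemDeriv c (fun k => duhamelTerm (g k) F) j n φ 0 = 0 := by
  simp [systemDeriv, pairing, duhamelTerm]

/-- The Duhamel formula solves the Cauchy problem for a globally defined source. -/
theorem isSolution_add_duhamelTerm (hT : 0 < T) (h_tempered : TemperedHat c T)
    (hg : GreenMeasures c T g) (p : Fin c.N → ℝ) {f : Fin c.N → Space d → ℝ}
    (hf : ∀ n, Continuous (f n)) (hf_bdd : ∀ n, ∃ C : ℝ, ∀ x, |f n x| ≤ C)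
    (hF : Continuous fun w : ℝ × Space d => F w.1 w.2) (hC : ∀ t x, |F t x| ≤ C)
    {u : ℝ → Space d → ℝ} (hu : ∀ t ∈ timeInterval T, ∀ x, u t x =
      (∑ n, p n * conv (g n t) (f n) x) + duhamelTerm (g c.last) F t x) :
    IsBoundedContinuous T u ∧ IsSolution c T p f F u := by
  choose Cf hCf using hf_bdd
  have hV : ∀ n k, IsBoundedContinuous T fun t x => conv (g k t) (f n) x := fun n k =>
    isBoundedContinuous_conv hT h_tempered hg k (hf n) (hCf n)
  have hD : ∀ k, IsBoundedContinuous T (duhamelTerm (g k) F) := fun k =>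
    isBoundedContinuous_duhamelTerm hT h_tempered hg hF hC k
  have hsum : IsBoundedContinuous T fun t x => ∑ n, p n * conv (g n t) (f n) x :=
    IsBoundedContinuous.sum _ fun n => (hV n n).const_mul (p n)
  have hub : IsBoundedContinuous T u := (hsum.add (hD c.last)).congr hu
  have hpair : ∀ φ, ∀ t ∈ timeInterval T, pairing u φ t =
      (∑ n, p n * pairing (fun t x => conv (g n t) (f n) x) φ t) +
        pairing (duhamelTerm (g c.last) F) φ t := fun φ t ht => by
    rw [pairing_congr (v := fun t x => (∑ n, p n * conv (g n t) (f n) x) +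
      duhamelTerm (g c.last) F t x) (hu t ht), pairing_add hsum (hD c.last) φ ht,
      pairing_sum _ (fun n => (hV n n).const_mul (p n)) φ ht]
    simp only [pairing_const_mul]
  -- The candidate for the `j`-th time derivative. For the last component the source first appears
  -- on passing from `j = N - 1` to `j = N`.
  set w : 𝓢(Space d, ℝ) → ℕ → ℝ → ℝ := fun φ j t =>
    (∑ n, p n * systemDeriv c (fun k t x => conv (g k t) (f n) x) j n φ t) +
      systemDeriv c (fun k => duhamelTerm (g k) F) j c.last φ t +
      (if j = c.N then pairing F φ t else 0) with hw
  have hN : 0 ≠ c.N := (Nat.pos_iff_ne_zero.1 c.one_le_N).symm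
  have hw0 : ∀ φ, EqOn (pairing u φ) (w φ 0) (timeInterval T) := fun φ t ht => by
    simp only [hw, systemDeriv_zero, if_neg hN, add_zero]
    exact hpair φ t ht
  have hder : ∀ φ, ∀ j < c.N, ∀ t ∈ timeInterval T,
      HasDerivWithinAt (w φ j) (w φ (j + 1) t) (timeInterval T) t := by
    intro φ j hj t ht
    have h1 : ∀ n, HasDerivWithinAt (systemDeriv c (fun k t x => conv (g k t) (f n) x) j n φ)
        (systemDeriv c (fun k t x => conv (g k t) (f n) x) (j + 1) n φ t)
        (timeInterval T) t := fun n => by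
      have := hasDerivWithinAt_systemDeriv (q := fun _ => 0) (hV n) ht (fun k ψ => by
        simpa using hasDerivWithinAt_pairing_conv hT h_tempered hg (hf n) (hCf n) k ψ ht) j n φ
      simpa using this
    have h2 := hasDerivWithinAt_systemDeriv (q := fun ψ => pairing F ψ t) hD ht (fun k ψ =>
      hasDerivWithinAt_pairing_duhamelTerm hT h_tempered hg hF hC k ψ ht) j c.last φ
    have h3 := (HasDerivWithinAt.fun_sum (u := Finset.univ)
      fun n _ => (h1 n).const_mul (p n)).add h2
    have hlast : c.last.val = j ↔ j + 1 = c.N := by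
      simp only [Coeffs.last]
      omega
    have h4 : pairing F (c.act ((c.polyCompanion ^ j) c.first c.last) φ) t =
        if j + 1 = c.N then pairing F φ t else 0 := by
      rw [polyCompanion_pow_first c hj]
      simp only [hlast]
      split_ifs
      · rw [Coeffs.act_one]
      · rw [Coeffs.act_zero, pairing_zero_right]
    simp only [hw, if_neg hj.ne, add_zero]
    refine h3.congr_deriv ?_
    rw [h4]
    ring
  have hcont : ∀ φ, ContinuousOn (w φ c.N) (timeInterval T) := fun φ => by
    simp only [hw, if_pos]
    exact ((continuousOn_finsetSum _ fun n _ =>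
      continuousOn_const.mul (continuousOn_systemDeriv (hV n) _ _ _)).add
      (continuousOn_systemDeriv hD _ _ _)).add
      ((isBoundedContinuous_of_continuous hF hC).continuousOn_pairing φ)
  have hit : ∀ φ, ∀ j ≤ c.N, ∀ t ∈ timeInterval T,
      iteratedDerivWithin j (pairing u φ) (timeInterval T) t = w φ j t := fun φ j hj t ht => by
    rw [iteratedDerivWithin_congr (hw0 φ) ht,
      iteratedDerivWithin_timeInterval_of_chain hT (hder φ) hj ht]
  refine ⟨hub, ⟨fun φ => ?_, fun φ t ht => ?_, fun φ n => ?_⟩⟩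
  · exact (contDiffOn_timeInterval_of_chain hT (hder φ) (hcont φ)).congr (hw0 φ)
  · rw [Finset.sum_congr rfl fun j hj => by rw [hit φ j (Finset.mem_Icc.1 hj).2 t ht],
      hub.sum_mul_pairing_partialDeriv φ ht, hpair _ t ht]
    simp only [hw, mul_add, Finset.sum_add_distrib, Finset.mul_sum]
    rw [Finset.sum_comm, sum_mul_systemDeriv hD ht]
    simp only [mul_left_comm (c.a _), ← Finset.mul_sum]
    rw [Finset.sum_congr rfl fun n _ => by rw [sum_mul_systemDeriv (hV n) ht]]
    -- The adjoint terms are accounted for; what remains is the source at `j = N`, with coefficient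
    -- `a_N = 1`.
    simp only [mul_ite, mul_zero]
    rw [Finset.sum_ite_eq' (Finset.Icc 1 c.N) c.N,
      if_pos (Finset.mem_Icc.2 ⟨c.one_le_N, le_rfl⟩), c.a_N]
    ring
  · rw [hit φ n n.2.le 0 (zero_mem_timeInterval hT)]
    simp only [hw, systemDeriv_duhamelTerm_zero, if_neg n.2.ne, add_zero,
      systemDeriv_conv_zero hT h_tempered hg (hf _) (hCf _) n.2, ← Fin.ext_iff]
    simp

end Existence

/-! ### An estimate for linear ordinary differential equations -/

section Gronwall

open Set Filter Topology

variable {T : EReal}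

/-- The vector `Y = (y_0, …, y_{N-1})` satisfies `‖Y'‖ ≤ K ‖Y‖ + Q e^{lt}` in the maximum norm and
is compared with `β(t) = Q/(l - K) e^{lt}`, which solves `β' = Kβ + Q e^{lt}`. The point is the
factor `1/(l - K)`, which becomes small for a steep weight. -/
theorem abs_le_of_abs_sum_le_exp {N : ℕ} (hN : 1 ≤ N) {a : ℕ → ℝ} (ha : a N = 1)
    {y : ℕ → ℝ → ℝ}
    (hy : ∀ j < N, ∀ t ∈ timeInterval T, HasDerivWithinAt (y j) (y (j + 1) t) (timeInterval T) t)
    (hy0 : ∀ j < N, y j 0 = 0) {S : ℝ} (hS : S ∈ timeInterval T) {Q l : ℝ} (hQ : 0 ≤ Q)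
    (hl : 1 + ∑ j ∈ Finset.Icc 1 N, |a j| < l)
    (hr : ∀ t ∈ Icc 0 S, |∑ j ∈ Finset.Icc 1 N, a j * y j t| ≤ Q * Real.exp (l * t))
    {t : ℝ} (ht : t ∈ Icc 0 S) :
    |y 0 t| ≤ Q / (l - (1 + ∑ j ∈ Finset.Icc 1 N, |a j|)) * Real.exp (l * t) := by
  obtain ⟨m, rfl⟩ : ∃ m, N = m + 1 := ⟨N - 1, by omega⟩
  set K := 1 + ∑ j ∈ Finset.Icc 1 (m + 1), |a j| with hK
  have hK1 : 1 ≤ K := le_add_of_nonneg_right (Finset.sum_nonneg fun _ _ => abs_nonneg _)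
  have hsub := Icc_subset_timeInterval hS
  set Y : ℝ → Fin (m + 1) → ℝ := fun t i => y i t with hY
  set Y' : ℝ → Fin (m + 1) → ℝ := fun t i => y (i + 1) t with hY'
  have hlK : 0 < l - K := sub_pos.2 hl
  have hder : ∀ s ∈ timeInterval T, HasDerivWithinAt Y (Y' s) (timeInterval T) s := fun s hs =>
    hasDerivWithinAt_pi.2 fun i => hy i i.2 s hs
  have hYle : ∀ s (j : ℕ), j < m + 1 → |y j s| ≤ ‖Y s‖ := fun s j hj =>
    norm_le_pi_norm (Y s) ⟨j, hj⟩
  have hbound : ∀ s ∈ Icc 0 S, ‖Y' s‖ ≤ K * ‖Y s‖ + Q * Real.exp (l * s) := by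
    intro s hs
    have hQe : 0 ≤ Q * Real.exp (l * s) := by positivity
    have hY0 : 0 ≤ ‖Y s‖ := norm_nonneg _
    refine (pi_norm_le_iff_of_nonneg (by positivity)).2 fun i => ?_
    rw [Real.norm_eq_abs]
    by_cases hi : i.val + 1 < m + 1
    · have h1 := hYle s _ hi
      have h2 : ‖Y s‖ ≤ K * ‖Y s‖ := le_mul_of_one_le_left hY0 hK1
      simp only [hY']
      linarith
    -- The last component of `Y'` is `y_N`; since `a_N = 1` it is the given sum minus the
    -- lower-order terms.
    · have hi' : i.val + 1 = m + 1 := by omega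
      have h1 := hr s hs
      rw [Finset.sum_Icc_succ_top (by omega), ha, one_mul] at h1
      have h2 : |∑ j ∈ Finset.Icc 1 m, a j * y j s| ≤ (K - 1) * ‖Y s‖ := by
        rw [hK, add_sub_cancel_left, Finset.sum_Icc_succ_top (by omega), add_mul, Finset.sum_mul]
        refine le_add_of_le_of_nonneg ((Finset.abs_sum_le_sum_abs _ _).trans
          (Finset.sum_le_sum fun j hj => ?_)) (by positivity)
        rw [abs_mul]
        gcongr
        exact hYle s j (by rw [Finset.mem_Icc] at hj; omega)
      simp only [hY', hi']
      rw [abs_le] at h1 h2 ⊢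
      constructor <;> nlinarith
  -- The comparison theorem needs a strict inequality on the boundary, so `Q` is enlarged by `ε`,
  -- which then tends to `0`.
  have main : ∀ ε > 0, ‖Y t‖ ≤ (Q + ε) / (l - K) * Real.exp (l * t) := by
    intro ε hε
    refine image_norm_le_of_norm_deriv_right_lt_deriv_boundary (f := Y) (f' := Y') (a := 0)
      (b := S) (B := fun s => (Q + ε) / (l - K) * Real.exp (l * s))
      (B' := fun s => (Q + ε) / (l - K) * (Real.exp (l * s) * l)) ?_ ?_ ?_ ?_ ?_ ht
    · exact fun s hs => ((hder s (hsub hs)).continuousWithinAt).mono hsub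
    · intro s hs
      refine (hder s (hsub (Ico_subset_Icc_self hs))).mono_of_mem_nhdsWithin ?_
      filter_upwards [self_mem_nhdsWithin, mem_nhdsWithin_of_mem_nhds (Iic_mem_nhds hs.2)]
        with r h1 h2
      exact hsub ⟨hs.1.trans h1, h2⟩
    · have : Y 0 = 0 := funext fun i => hy0 i i.2
      rw [this, norm_zero]
      positivity
    · intro s
      have := (((hasDerivAt_id s).const_mul l).exp).const_mul ((Q + ε) / (l - K))
      simpa using this
    · intro s hs heq
      refine (hbound s (Ico_subset_Icc_self hs)).trans_lt ?_
      rw [heq]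
      have h1 : (Q + ε) / (l - K) * (Real.exp (l * s) * l) =
          K * ((Q + ε) / (l - K) * Real.exp (l * s)) + (Q + ε) * Real.exp (l * s) := by
        field_simp
        ring
      rw [h1]
      have := Real.exp_pos (l * s)
      gcongr
      linarith
  have hlim : Tendsto (fun ε : ℝ => (Q + ε) / (l - K) * Real.exp (l * t)) (𝓝[>] 0)
      (𝓝 ((Q + 0) / (l - K) * Real.exp (l * t))) :=
    (Continuous.tendsto (by fun_prop) 0).mono_left nhdsWithin_le_nhds
  rw [add_zero] at hlim
  refine (hYle t 0 (by omega)).trans (ge_of_tendsto hlim ?_)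
  filter_upwards [self_mem_nhdsWithin] with ε hε using main ε hε

end Gronwall

/-! ### Band-limited test functions -/

section Bandlimited

open Set Filter Topology FourierTransform
open scoped ContDiff Convolution

/-- The Fourier transform of `φ` is supported in the ball of radius `R`. -/
def IsBandlimited (R : ℝ) (φ : 𝓢(Space d, ℝ)) : Prop := ∀ η, R ≤ ‖η‖ → realFourier φ η = 0

theorem IsBandlimited.adjointOp {R : ℝ} {φ : 𝓢(Space d, ℝ)} (hφ : IsBandlimited R φ)
    (c : Coeffs d) : IsBandlimited R (c.adjointOp φ) := fun η hη => by
  rw [realFourier_adjointOp, hφ η hη, mul_zero]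

theorem contDiff_symbol (c : Coeffs d) : ContDiff ℝ ∞ c.symbol := by
  unfold Coeffs.symbol
  refine ContDiff.sum fun α _ => contDiff_const.mul (contDiff_prod fun i _ => ContDiff.pow ?_ _)
  exact Complex.ofRealCLM.contDiff.comp (EuclideanSpace.proj (𝕜 := ℝ) i).contDiff

/-- Bernstein's inequality for the adjoint of the spatial operator. -/
theorem exists_integral_abs_adjointOp_le (c : Coeffs d) {R : ℝ} (hR : 0 < R) :
    ∃ κ > 0, ∀ φ : 𝓢(Space d, ℝ), IsBandlimited R φ →
      ∫ x, |c.adjointOp φ x| ≤ κ * ∫ x, |φ x| := by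
  let χ : ContDiffBump (0 : Space d) := ⟨R, R + 1, hR, by linarith⟩
  -- The cut-off equals `1` on the ball of radius `R`, so on band-limited functions the symbol may
  -- be replaced by a compactly supported multiplier. Its kernel `k` is a Schwartz function, and the
  -- bound is Young's inequality for `k * φ`.
  let ψ₀ : Space d → ℂ := fun η => (χ η : ℂ) * c.symbol (-(2 * Real.pi) • η)
  have hψc : HasCompactSupport ψ₀ :=
    (χ.hasCompactSupport.comp_left (g := fun r : ℝ => (r : ℂ)) Complex.ofReal_zero).mul_right
  have hψd : ContDiff ℝ ∞ ψ₀ :=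
    (Complex.ofRealCLM.contDiff.comp χ.contDiff).mul
      ((contDiff_symbol c).comp (contDiff_const_smul _))
  let ψ : 𝓢(Space d, ℂ) := hψc.toSchwartzMap hψd
  let k : 𝓢(Space d, ℂ) := 𝓕⁻ ψ
  -- The summand `1` only ensures that `κ` is positive.
  refine ⟨(∫ x, ‖k x‖) + 1, by positivity, fun φ hφ => ?_⟩
  have h1 : complexify d (c.adjointOp φ) =
      SchwartzMap.convolution (ContinuousLinearMap.mul ℂ ℂ) k (complexify d φ) := by
    have h2 : 𝓕 (complexify d (c.adjointOp φ)) =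
        𝓕 (SchwartzMap.convolution (ContinuousLinearMap.mul ℂ ℂ) k (complexify d φ)) := by
      rw [SchwartzMap.fourier_convolution]
      ext η
      rw [SchwartzMap.pairing_apply_apply]
      have h3 : (𝓕 k : 𝓢(Space d, ℂ)) = ψ := by simp [k]
      rw [h3]
      change realFourier (c.adjointOp φ) η =
        ((χ η : ℂ) * c.symbol (-(2 * Real.pi) • η)) * realFourier φ η
      rw [realFourier_adjointOp]
      by_cases hη : R ≤ ‖η‖
      · rw [hφ η hη, mul_zero, mul_zero]
      · rw [χ.one_of_mem_closedBall (by simpa using (not_le.1 hη).le), Complex.ofReal_one, one_mul]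
    have := congrArg (fun χ : 𝓢(Space d, ℂ) => 𝓕⁻ χ) h2
    simpa using this
  have h2 : ∀ x, |c.adjointOp φ x| ≤
      ((fun y => ‖k y‖) ⋆[ContinuousLinearMap.mul ℝ ℝ] fun y => |φ y|) x := fun x => by
    have h3 : ((c.adjointOp φ x : ℝ) : ℂ) = ∫ y, k y * ((φ (x - y) : ℝ) : ℂ) := by
      rw [← complexify_apply, h1, SchwartzMap.convolution_apply]
      rfl
    rw [← Real.norm_eq_abs, ← Complex.norm_real, h3]
    refine (norm_integral_le_integral_norm _).trans (le_of_eq ?_)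
    refine integral_congr_ae (Eventually.of_forall fun y => ?_)
    simp
  calc ∫ x, |c.adjointOp φ x|
      ≤ ∫ x, ((fun y => ‖k y‖) ⋆[ContinuousLinearMap.mul ℝ ℝ] fun y => |φ y|) x :=
        integral_mono (c.adjointOp φ).integrable.abs
          (k.integrable.norm.integrable_convolution _ φ.integrable.abs) h2
    _ = (∫ x, ‖k x‖) * ∫ x, |φ x| :=
        integral_convolution _ k.integrable.norm φ.integrable.abs
    _ ≤ ((∫ x, ‖k x‖) + 1) * ∫ x, |φ x| := by
        have : 0 ≤ ∫ x, |φ x| := integral_nonneg fun _ => abs_nonneg _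
        gcongr
        linarith

end Bandlimited

/-! ### Separation by band-limited test functions -/

section Separation

open Set Filter Topology FourierTransform
open scoped ContDiff

/-- The bump function equal to `1` on the unit ball and supported in the ball of radius `2`. -/
def fourierBump (d : ℕ) : ContDiffBump (0 : Space d) := ⟨1, 2, one_pos, one_lt_two⟩

/-- The modulated and dilated bump `ξ ↦ e^{-2π i ⟨ξ, x⟩} χ(ξ / R)`. -/
def modulatedBump (x : Space d) {R : ℝ} (hR : 0 < R) : 𝓢(Space d, ℂ) :=
  HasCompactSupport.toSchwartzMap
    (f := fun ξ : Space d => ((fourierBump d (R⁻¹ • ξ) : ℝ) : ℂ) *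
      Complex.exp ((-(2 * Real.pi * inner ℝ ξ x) : ℝ) * Complex.I))
    ((((fourierBump d).hasCompactSupport.comp_smul (inv_ne_zero hR.ne')).comp_left
      (g := fun r : ℝ => (r : ℂ)) Complex.ofReal_zero).mul_right)
    (by
      refine (Complex.ofRealCLM.contDiff.comp
        ((fourierBump d).contDiff.comp (contDiff_const_smul R⁻¹))).mul ?_
      refine Complex.contDiff_exp.comp (ContDiff.mul ?_ contDiff_const)
      refine Complex.ofRealCLM.contDiff.comp (contDiff_const.mul ?_).neg
      exact contDiff_id.inner ℝ contDiff_const)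

theorem modulatedBump_apply (x : Space d) {R : ℝ} (hR : 0 < R) (ξ : Space d) :
    modulatedBump x hR ξ = ((fourierBump d (R⁻¹ • ξ) : ℝ) : ℂ) *
      Complex.exp ((-(2 * Real.pi * inner ℝ ξ x) : ℝ) * Complex.I) := rfl

/-- The inverse Fourier transform of the bump. -/
def bumpKernel (d : ℕ) : 𝓢(Space d, ℂ) := 𝓕⁻ (modulatedBump (0 : Space d) one_pos)

theorem bumpKernel_apply (z : Space d) : bumpKernel d z =
    ∫ ξ, Complex.exp ((2 * Real.pi * inner ℝ ξ z : ℝ) * Complex.I) *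
      ((fourierBump d ξ : ℝ) : ℂ) := by
  rw [bumpKernel, SchwartzMap.fourierInv_coe, Real.fourierInv_eq']
  simp only [modulatedBump_apply]
  simp

/-- The bump is real and even; its inverse transform is therefore real, which allows real test
functions. -/
theorem conj_bumpKernel (z : Space d) : (starRingEnd ℂ) (bumpKernel d z) = bumpKernel d z := by
  rw [bumpKernel_apply, ← integral_conj, ← integral_neg_eq_self]
  refine integral_congr_ae (Eventually.of_forall fun ξ => ?_)
  simp only [map_mul, Complex.conj_ofReal, ← Complex.exp_conj, Complex.conj_I, inner_neg_left,
    (fourierBump d).neg]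
  congr 2
  push_cast
  ring

/-- Modulation in frequency is translation by `x`, and dilation by `R` concentrates the kernel at
scale `1/R`. -/
theorem fourierInv_modulatedBump (x : Space d) {R : ℝ} (hR : 0 < R) (y : Space d) :
    (𝓕⁻ (modulatedBump x hR) : 𝓢(Space d, ℂ)) y = ((R ^ d : ℝ) : ℂ) * bumpKernel d (R • (y - x)) := by
  rw [bumpKernel_apply, SchwartzMap.fourierInv_coe, Real.fourierInv_eq']
  have h := Measure.integral_comp_inv_smul_of_nonneg (volume : Measure (Space d))
    (fun ξ => Complex.exp ((2 * Real.pi * inner ℝ ξ (R • (y - x)) : ℝ) * Complex.I) *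
      ((fourierBump d ξ : ℝ) : ℂ)) hR.le
  rw [finrank_euclideanSpace_fin, Complex.real_smul] at h
  rw [← h]
  refine integral_congr_ae (Eventually.of_forall fun ξ => ?_)
  simp only [modulatedBump_apply, smul_eq_mul, inner_smul_left, inner_smul_right, inner_sub_right]
  rw [mul_left_comm, mul_comm, ← Complex.exp_add]
  congr 2
  rw [← add_mul]
  congr 1
  simp only [conj_trivial]
  push_cast
  have : (R : ℂ) ≠ 0 := by exact_mod_cast hR.ne'
  field_simp
  ring

theorem exists_bandlimited_kernel (x : Space d) {R : ℝ} (hR : 0 < R) :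
    ∃ φ : 𝓢(Space d, ℝ), IsBandlimited (2 * R) φ ∧
      ∀ y, φ y = R ^ d * (bumpKernel d (R • (y - x))).re := by
  refine ⟨SchwartzMap.postcompCLM Complex.reCLM (𝓕⁻ (modulatedBump x hR)), fun η hη => ?_,
    fun y => ?_⟩
  · have h : complexify d (SchwartzMap.postcompCLM Complex.reCLM (𝓕⁻ (modulatedBump x hR))) =
        𝓕⁻ (modulatedBump x hR) := by
      ext y
      rw [complexify_apply]
      refine Complex.conj_eq_iff_re.1 ?_
      rw [fourierInv_modulatedBump, map_mul, conj_bumpKernel, Complex.conj_ofReal]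
    have h' : realFourier (SchwartzMap.postcompCLM Complex.reCLM (𝓕⁻ (modulatedBump x hR))) =
        modulatedBump x hR := by
      rw [realFourier, h]
      simp
    rw [h', modulatedBump_apply, (fourierBump d).zero_of_le_dist, Complex.ofReal_zero, zero_mul]
    rw [dist_zero_right, norm_smul, norm_inv, Real.norm_of_nonneg hR.le]
    change 2 ≤ _
    rw [← div_eq_inv_mul, le_div_iff₀ hR]
    exact hη
  · change ((𝓕⁻ (modulatedBump x hR) : 𝓢(Space d, ℂ)) y).re = _
    rw [fourierInv_modulatedBump, Complex.re_ofReal_mul]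

theorem integral_re_bumpKernel : ∫ z, (bumpKernel d z).re = 1 := by
  have h : ∫ z, bumpKernel d z = 1 := by
    have h1 : (𝓕 (bumpKernel d) : 𝓢(Space d, ℂ)) 0 = modulatedBump (0 : Space d) one_pos 0 := by
      simp [bumpKernel]
    rw [SchwartzMap.fourier_coe, Real.fourier_eq', modulatedBump_apply] at h1
    have h2 : fourierBump d 0 = 1 :=
      (fourierBump d).one_of_mem_closedBall (by simp [(fourierBump d).rIn_pos.le])
    simpa [h2] using h1
  have := integral_re (𝕜 := ℂ) (SchwartzMap.integrable (μ := volume) (bumpKernel d))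
  rw [h] at this
  simpa using this

/-- A bounded continuous function orthogonal to all band-limited test functions vanishes. -/
theorem eq_zero_of_forall_bandlimited {w : Space d → ℝ} (hw : Continuous w) {C : ℝ}
    (hC : ∀ x, |w x| ≤ C)
    (h : ∀ R > 0, ∀ φ : 𝓢(Space d, ℝ), IsBandlimited R φ → ∫ y, w y * φ y = 0) (x : Space d) :
    w x = 0 := by
  -- The band-limited kernel with `R = n + 1`, after the substitution `z = (n + 1)(y - x)`.
  have hzero : ∀ n : ℕ, ∫ z, w (x + (n + 1 : ℝ)⁻¹ • z) * (bumpKernel d z).re = 0 := fun n => by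
    have hR : (0 : ℝ) < n + 1 := by positivity
    obtain ⟨φ, hφ, hφe⟩ := exists_bandlimited_kernel x hR
    have h1 := h _ (by positivity) φ hφ
    rw [← integral_add_left_eq_self _ x] at h1
    have h2 := Measure.integral_comp_smul_of_nonneg (volume : Measure (Space d))
      (fun z => w (x + (n + 1 : ℝ)⁻¹ • z) * (bumpKernel d z).re) (n + 1 : ℝ) (hR := hR.le)
    have h3 : ∀ y, w (x + y) * φ (x + y) = (n + 1 : ℝ) ^ d *
        (w (x + (n + 1 : ℝ)⁻¹ • (n + 1 : ℝ) • y) *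
          (bumpKernel d ((n + 1 : ℝ) • y)).re) := fun y => by
      rw [hφe, inv_smul_smul₀ hR.ne', add_sub_cancel_left]
      ring
    simp only [h3] at h1
    rw [integral_const_mul, h2, smul_eq_mul, mul_eq_zero, mul_eq_zero] at h1
    have h4 : ((n : ℝ) + 1) ^ d ≠ 0 := by positivity
    have h5 : (((n : ℝ) + 1) ^ Module.finrank ℝ (Space d))⁻¹ ≠ 0 := by positivity
    tauto
  -- As the kernel concentrates at `x`, dominated convergence applies; the limit is `w x` because
  -- the kernel has integral `1`.
  have hlim : Tendsto (fun n : ℕ => ∫ z, w (x + (n + 1 : ℝ)⁻¹ • z) * (bumpKernel d z).re) atTop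
      (𝓝 (∫ z, w x * (bumpKernel d z).re)) := by
    refine tendsto_integral_of_dominated_convergence (fun z => C * ‖bumpKernel d z‖)
      (fun n => ?_) ((bumpKernel d).integrable.norm.const_mul C) (fun n => ?_) ?_
    · refine Continuous.aestronglyMeasurable ?_
      have := (bumpKernel d).continuous
      fun_prop
    · refine Eventually.of_forall fun z => ?_
      rw [norm_mul]
      exact mul_le_mul (hC _) (Complex.abs_re_le_norm _) (norm_nonneg _)
        ((abs_nonneg _).trans (hC x))
    · refine Eventually.of_forall fun z => Tendsto.mul_const _ ?_
      have h1 : Tendsto (fun n : ℕ => ((n : ℝ) + 1)⁻¹) atTop (𝓝 0) := by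
        simpa using tendsto_one_div_add_atTop_nhds_zero_nat (𝕜 := ℝ)
      have h2 : Tendsto (fun n : ℕ => x + ((n : ℝ) + 1)⁻¹ • z) atTop (𝓝 (x + (0 : ℝ) • z)) :=
        tendsto_const_nhds.add (h1.smul_const z)
      rw [zero_smul, add_zero] at h2
      exact (hw.tendsto x).comp h2
  simp only [hzero] at hlim
  rw [integral_const_mul, integral_re_bumpKernel, mul_one] at hlim
  exact tendsto_nhds_unique hlim tendsto_const_nhds

end Separation

/-! ### Uniqueness -/

section Uniqueness

open Set Filter Topology

variable {c : Coeffs d} {T : EReal}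

theorem hasDerivWithinAt_iteratedDerivWithin (hT : 0 < T) {N : ℕ} {h : ℝ → ℝ}
    (hh : ContDiffOn ℝ (N : ℕ∞) h (timeInterval T)) {j : ℕ} (hj : j < N) {t : ℝ}
    (ht : t ∈ timeInterval T) :
    HasDerivWithinAt (iteratedDerivWithin j h (timeInterval T))
      (iteratedDerivWithin (j + 1) h (timeInterval T) t) (timeInterval T) t := by
  rw [iteratedDerivWithin_succ]
  exact (hh.differentiableOn_iteratedDerivWithin (by exact_mod_cast hj)
    (uniqueDiffOn_timeInterval hT) t ht).hasDerivWithinAt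

/-- A solution of the homogeneous Cauchy problem vanishes. -/
theorem eq_zero_of_isSolution_zero (hT : 0 < T) {w : ℝ → Space d → ℝ}
    (hw : IsBoundedContinuous T w)
    (hsmooth : ∀ φ : 𝓢(Space d, ℝ), ContDiffOn ℝ (c.N : ℕ∞) (pairing w φ) (timeInterval T))
    (heq : ∀ φ : 𝓢(Space d, ℝ), ∀ t ∈ timeInterval T, ∑ n ∈ Finset.Icc 1 c.N,
      c.a n * iteratedDerivWithin n (pairing w φ) (timeInterval T) t = pairing w (c.adjointOp φ) t)
    (hinit : ∀ φ : 𝓢(Space d, ℝ), ∀ n < c.N,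
      iteratedDerivWithin n (pairing w φ) (timeInterval T) 0 = 0)
    {S : ℝ} (hS : S ∈ timeInterval T) (x : Space d) : w S x = 0 := by
  obtain ⟨C, hC⟩ := hw.bounded S
  have hC0 : 0 ≤ C := (abs_nonneg _).trans (hC S hS le_rfl x)
  refine eq_zero_of_forall_bandlimited (hw.continuous hS) (hC S hS le_rfl) (fun R hR φ hφ => ?_) x
  obtain ⟨κ, hκ, hκφ⟩ := exists_integral_abs_adjointOp_le c hR
  set K := 1 + ∑ j ∈ Finset.Icc 1 c.N, |c.a j| with hK
  -- With `l - K = 2κ` the estimate for the ordinary differential equation divides by `2κ`, while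
  -- the adjoint costs a factor `κ`: each round gains `1/2`.
  set l := K + 2 * κ with hl
  have hK0 : 0 ≤ K := by positivity
  -- The induction runs over all `φ` with the same band `R`, because the next step applies it to
  -- `c.adjointOp φ`, which has no larger band.
  have hdecay : ∀ m : ℕ, ∀ φ : 𝓢(Space d, ℝ), IsBandlimited R φ → ∀ t ∈ Icc 0 S,
      |pairing w φ t| ≤ C * (1 / 2) ^ m * (∫ x, |φ x|) * Real.exp (l * t) := by
    intro m
    induction m with
    | zero =>
      intro φ _ t ht
      have hφ0 : 0 ≤ ∫ x, |φ x| := integral_nonneg fun _ => abs_nonneg _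
      refine (IsBoundedContinuous.abs_pairing_le hC φ (mem_timeInterval_of_le hS ht.1 ht.2)
        ht.2).trans ?_
      rw [pow_zero, mul_one]
      refine le_mul_of_one_le_right (by positivity) (Real.one_le_exp ?_)
      exact mul_nonneg (by positivity) ht.1
    | succ m ih =>
      intro φ hφ t ht
      have hφ0 : 0 ≤ ∫ x, |φ x| := integral_nonneg fun _ => abs_nonneg _
      have h := abs_le_of_abs_sum_le_exp c.one_le_N c.a_N
        (y := fun j => iteratedDerivWithin j (pairing w φ) (timeInterval T))
        (fun j hj s hs => hasDerivWithinAt_iteratedDerivWithin hT (hsmooth φ) hj hs)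
        (hinit φ) hS (Q := C * (1 / 2) ^ m * (κ * ∫ x, |φ x|)) (l := l) (by positivity)
        (by linarith) (fun s hs => by
          rw [heq φ s (mem_timeInterval_of_le hS hs.1 hs.2)]
          refine (ih _ (hφ.adjointOp c) s hs).trans ?_
          gcongr
          exact hκφ φ hφ) ht
      simp only [iteratedDerivWithin_zero] at h
      refine h.trans (le_of_eq ?_)
      rw [← hK, hl, add_sub_cancel_left, pow_succ]
      field_simp
  have hlim : Tendsto (fun m : ℕ => C * (1 / 2) ^ m * (∫ x, |φ x|) * Real.exp (l * S)) atTop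
      (𝓝 (C * 0 * (∫ x, |φ x|) * Real.exp (l * S))) :=
    (((tendsto_pow_atTop_nhds_zero_of_lt_one (by norm_num) (by norm_num)).const_mul
      C).mul_const _).mul_const _
  rw [mul_zero, zero_mul, zero_mul] at hlim
  have h0 := ge_of_tendsto' hlim fun m => hdecay m φ hφ S ⟨hS.1, le_rfl⟩
  exact abs_nonpos_iff.1 h0

/-- Solutions of the Cauchy problem are unique. -/
theorem IsSolution.unique (hT : 0 < T) {p : Fin c.N → ℝ} {f : Fin c.N → Space d → ℝ}
    {F u v : ℝ → Space d → ℝ} (hub : IsBoundedContinuous T u) (hu : IsSolution c T p f F u)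
    (hvb : IsBoundedContinuous T v) (hv : IsSolution c T p f F v) {t : ℝ}
    (ht : t ∈ timeInterval T) (x : Space d) : v t x = u t x := by
  have hub' := hub.const_mul (-1)
  have hwb : IsBoundedContinuous T fun t x => v t x + -1 * u t x := hvb.add hub'
  have hpair : ∀ φ, EqOn (pairing (fun t x => v t x + -1 * u t x) φ)
      (fun s => pairing v φ s - pairing u φ s) (timeInterval T) := fun φ s hs => by
    rw [pairing_add hvb hub' φ hs, pairing_const_mul]
    ring
  have hsm : ∀ φ, ContDiffOn ℝ (c.N : ℕ∞) (fun s => pairing v φ s - pairing u φ s)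
      (timeInterval T) := fun φ => (hv.contDiffOn φ).sub (hu.contDiffOn φ)
  have hder : ∀ φ, ∀ j ≤ c.N, ∀ s ∈ timeInterval T,
      iteratedDerivWithin j (pairing (fun t x => v t x + -1 * u t x) φ) (timeInterval T) s =
        iteratedDerivWithin j (pairing v φ) (timeInterval T) s -
          iteratedDerivWithin j (pairing u φ) (timeInterval T) s := fun φ j hj s hs => by
    have hj' : ((j : ℕ∞) : WithTop ℕ∞) ≤ ((c.N : ℕ∞) : WithTop ℕ∞) := by exact_mod_cast hj
    rw [iteratedDerivWithin_congr (hpair φ) hs]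
    exact iteratedDerivWithin_sub hs (uniqueDiffOn_timeInterval hT)
      (((hv.contDiffOn φ) s hs).of_le hj') (((hu.contDiffOn φ) s hs).of_le hj')
  have h := eq_zero_of_isSolution_zero (c := c) hT hwb (fun φ => (hsm φ).congr (hpair φ))
    (fun φ s hs => ?_) (fun φ n hn => ?_) ht x
  · linarith
  · have h1 := hv.equation φ s hs
    have h2 := hu.equation φ s hs
    rw [hvb.sum_mul_pairing_partialDeriv φ hs] at h1
    rw [hub.sum_mul_pairing_partialDeriv φ hs] at h2
    rw [Finset.sum_congr rfl fun j hj => by rw [hder φ j (Finset.mem_Icc.1 hj).2 s hs],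
      hpair _ hs]
    simp only [mul_sub, Finset.sum_sub_distrib]
    linarith
  · rw [hder φ n hn.le 0 (zero_mem_timeInterval hT), hv.initial φ ⟨n, hn⟩, hu.initial φ ⟨n, hn⟩,
      sub_self]

end Uniqueness

/-! ### The Cauchy problem -/

/-- The source is given for `t ≥ 0` only. Freezing it at its value at `0` for negative times yields
a source on the whole line, and the Duhamel integral evaluates it only at `t - s ≥ 0`. -/
theorem continuous_comp_max {F : ℝ → Space d → ℝ}
    (hF : ContinuousOn (fun z : ℝ × Space d => F z.1 z.2) (Set.Ici 0 ×ˢ Set.univ)) :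
    Continuous fun w : ℝ × Space d => F (max w.1 0) w.2 := by
  rw [← continuousOn_univ]
  exact hF.comp (f := fun w : ℝ × Space d => (max w.1 0, w.2)) (by fun_prop)
    fun w _ => ⟨Set.mem_Ici.2 (le_max_right _ _), Set.mem_univ _⟩

theorem IsSolution.congr_source {c : Coeffs d} {T : EReal} {p : Fin c.N → ℝ}
    {f : Fin c.N → Space d → ℝ} {F G u : ℝ → Space d → ℝ} (hu : IsSolution c T p f F u)
    (h : ∀ t ∈ timeInterval T, ∀ x, F t x = G t x) : IsSolution c T p f G u where
  contDiffOn := hu.contDiffOn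
  equation φ t ht := by
    rw [← pairing_congr (h t ht)]
    exact hu.equation φ t ht
  initial := hu.initial

end LinearCauchy

end

theorem proposition2p1 {d : ℕ} (c : LinearCauchy.Coeffs d)
    (p : Fin c.N → ℝ) (hp_pos : ∀ n, 0 < p n) (hp_sum : ∑ n, p n = 1)
    (f : Fin c.N → LinearCauchy.Space d → ℝ)
    (hf_cont : ∀ n, Continuous (f n)) (hf_bdd : ∀ n, ∃ C : ℝ, ∀ x, |f n x| ≤ C)
    (F : ℝ → LinearCauchy.Space d → ℝ)
    (hF_cont : ContinuousOn (fun z : ℝ × LinearCauchy.Space d => F z.1 z.2)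
      (Set.Ici 0 ×ˢ Set.univ))
    (hF_bdd : ∃ C : ℝ, ∀ t, 0 ≤ t → ∀ x, |F t x| ≤ C)
    (T : EReal) (hT : 0 < T)
    (h_tempered : LinearCauchy.TemperedHat c T)
    (g : Fin c.N → ℝ → MeasureTheory.SignedMeasure (LinearCauchy.Space d))
    (hg : LinearCauchy.GreenMeasures c T g) :
    (∀ t ∈ LinearCauchy.timeInterval T, ∀ x,
      IntervalIntegrable (fun s => LinearCauchy.conv (g c.last s) (F (t - s)) x)
        MeasureTheory.volume 0 t) ∧
    (LinearCauchy.IsBoundedContinuous T (LinearCauchy.duhamel c p f F g) ∧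
      LinearCauchy.IsSolution c T p f F (LinearCauchy.duhamel c p f F g)) ∧
    ∀ v : ℝ → LinearCauchy.Space d → ℝ,
      LinearCauchy.IsBoundedContinuous T v → LinearCauchy.IsSolution c T p f F v →
      ∀ t ∈ LinearCauchy.timeInterval T, ∀ x, v t x = LinearCauchy.duhamel c p f F g t x := by
  obtain ⟨C, hC⟩ := hF_bdd
  have hcont := LinearCauchy.continuous_comp_max hF_cont
  have hbdd : ∀ t x, |F (max t 0) x| ≤ C := fun t x => hC _ (le_max_right _ _) x
  have hsub : ∀ t ∈ LinearCauchy.timeInterval T, ∀ s ∈ Set.uIcc 0 t, max (t - s) 0 = t - s := by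
    intro t ht s hs
    rw [Set.uIcc_of_le ht.1] at hs
    exact max_eq_left (sub_nonneg.2 hs.2)
  have hu : ∀ t ∈ LinearCauchy.timeInterval T, ∀ x, LinearCauchy.duhamel c p f F g t x =
      (∑ n, p n * LinearCauchy.conv (g n t) (f n) x) +
        LinearCauchy.duhamelTerm (g c.last) (fun s => F (max s 0)) t x := fun t ht x => by
    rw [LinearCauchy.duhamel, LinearCauchy.duhamelTerm]
    congr 1
    refine intervalIntegral.integral_congr fun s hs => ?_
    simp only [hsub t ht s hs]
  obtain ⟨hb, hs⟩ := LinearCauchy.isSolution_add_duhamelTerm hT h_tempered hg p hf_cont hf_bdd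
    hcont hbdd hu
  replace hs := hs.congr_source (G := F) fun t ht x => by rw [max_eq_left ht.1]
  refine ⟨fun t ht x => ?_, ⟨hb, hs⟩, fun v hvb hv t ht x =>
    LinearCauchy.IsSolution.unique hT hb hs hvb hv ht x⟩
  refine (LinearCauchy.intervalIntegrable_conv hT h_tempered hg hcont hbdd c.last ht x).congr
    fun s hs => ?_
  simp only [hsub t ht s (Set.uIoc_subset_uIcc hs)]
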